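/- Let $a^2,b^2,c^2>0$ be constants, put $F(t)=-a^2t-\frac{b^2}{3}t^2+\frac{2c^2}{3}t^3$ and $s_+=\frac{b^2+\sqrt{b^4+24a^2c^2}}{4c^2}$, and let $u$ be the scalar profile of the melting hedgehog, that is, a solution, twice differentiable on $(0,\infty)$ and continuous on $[0,\infty)$, of $$u''+\frac2r u'-\frac6{r^2}u=F(u)\ \text{ on }(0,\infty),\qquad u(0)=0,\quad \lim_{r\to\infty}u(r)=s_+ .$$ Put $f(t)=-a^2-\frac{b^2t}{3}+\frac{2c^2t^2}{3}$, $\hat f(t)=-a^2-\frac{2b^2t}{3}+2c^2t^2$ and $\tilde f(t)=-a^2+\frac{2b^2t}{3}+\frac{2c^2t^2}{3}$. Use spherical coordinates $x=r(\sin\theta\cos\varphi,\sin\theta\sin\varphi,\cos\theta)$ on $\mathbb R^3$, so that $dx=r^2\sin\theta\,dr\,d\theta\,d\varphi$. For a $\varphi$-independent function $w=w(r,\theta)\in H^1(\mathbb R^3)$ define $$\mathcal Q_0(w)=\int_{\mathbb R^3}\Big\{|\partial_r w|^2+\frac1{r^2}|\partial_\theta w|^2+\frac6{r^2}w^2+\hat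 f(u)w^2\Big\}\,dx,$$ $$\mathcal Q_1(w)=\mathcal Q_2(w)=\int_{\mathbb R^3}\Big\{|\partial_r w|^2+\frac1{r^2}|\partial_\theta w|^2+\frac1{r^2}\Big(4+\frac1{\sin^2\theta}\Big)w^2+f(u)w^2\Big\}\,dx,$$ $$\mathcal Q_3(w)=\mathcal Q_4(w)=\int_{\mathbb R^3}\Big\{|\partial_r w|^2+\frac1{r^2}|\partial_\theta w|^2+\frac1{r^2}\Big(-2+\frac4{\sin^2\theta}\Big)w^2+\tilde f(u)w^2\Big\}\,dx$$ (equivalently, $\int_{\mathbb R^3}\{\cdots\}\,dx=2\pi\int_0^\infty\int_0^\pi\{\cdots\}\,r^2\sin\theta\,d\theta\,dr$), where $\mathcal Q_1,\dots,\mathcal Q_4$ take the value $+\infty$ if $\frac{w}{r\sin\theta}\notin L^2(\mathbb R^3)$. Then: 1. $\mathcal Q_0(w)\ge0$ for all $a^2,b^2,c^2>0$ and every $\varphi$-independent $w\in H^1(\mathbb R^3)$. 2. $\mathcal Q_1(w)\ge0$ and $\mathcal Q_2(w)\ge 0$ for all $a^2,b^2,c^2>0$ and every $\varphi$-independent $w\in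 H^1(\mathbb R^3)$. 3. For fixed $b^2,c^2>0$ there is $a_0^2>0$, depending only on $b^2$ and $c^2$, such that if $0<a^2<a_0^2$ then $\mathcal Q_3(w)\ge0$ and $\mathcal Q_4(w)\ge0$ for every $\varphi$-independent $w\in H^1(\mathbb R^3)$. 4. For fixed $b^2,c^2>0$ there is $a_1^2>0$, depending only on $b^2$ and $c^2$, such that if $a^2>a_1^2$ then there is a $\varphi$-independent $w_3\in C_c^\infty(\mathbb R^3)$ with $\mathcal Q_3(w_3)<0$. -/

import Mathlib

open MeasureTheory Filter Topology
open scoped ENNReal ContDiff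

noncomputable section

namespace MeltingHedgehog

/-! The parameters `asq`, `bsq`, `csq` are the positive material constants `a²`, `b²`, `c²`. -/

/-- The bulk nonlinearity `F(t) = -a² t - (b²/3) t² + (2c²/3) t³`. -/
def bulkF (asq bsq csq t : ℝ) : ℝ := -asq * t - bsq / 3 * t ^ 2 + 2 * csq / 3 * t ^ 3

/-- `f(t) = F(t) / t`, written out. -/
def f (asq bsq csq t : ℝ) : ℝ := -asq - bsq * t / 3 + 2 * csq * t ^ 2 / 3

/-- `f̂(t) = F'(t)`, written out. -/
def fHat (asq bsq csq t : ℝ) : ℝ := -asq - 2 * bsq * t / 3 + 2 * csq * t ^ 2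

/-- The function `f̃`. -/
def fTilde (asq bsq csq t : ℝ) : ℝ := -asq + 2 * bsq * t / 3 + 2 * csq * t ^ 2 / 3

/-- The positive zero `s₊` of `F`. -/
def sPlus (asq bsq csq : ℝ) : ℝ := (bsq + Real.sqrt (bsq ^ 2 + 24 * asq * csq)) / (4 * csq)

/-- `u` is the radial scalar profile of the melting hedgehog `u(|x|) (x/|x| ⊗ x/|x| - Id/3)`:
it solves `u'' + (2/r) u' - (6/r²) u = F(u)` on `(0,∞)`, with `u(0) = 0` (continuously)
and `u(∞) = s₊`. Nothing is required of the values of `u` at negative arguments. -/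
structure IsProfile (asq bsq csq : ℝ) (u : ℝ → ℝ) : Prop where
  differentiableAt : ∀ r, 0 < r → DifferentiableAt ℝ u r
  differentiableAt_deriv : ∀ r, 0 < r → DifferentiableAt ℝ (deriv u) r
  ode : ∀ r, 0 < r →
    deriv (deriv u) r + 2 / r * deriv u r - 6 / r ^ 2 * u r = bulkF asq bsq csq (u r)
  zero : u 0 = 0
  tendsto_zero : Tendsto u (𝓝[>] 0) (𝓝 0)
  tendsto_atTop : Tendsto u atTop (𝓝 (sPlus asq bsq csq))

/-- Three-dimensional Euclidean space, with the Euclidean norm and Lebesgue measure. -/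
abbrev E3 : Type := EuclideanSpace ℝ (Fin 3)

/-- The polar angle `θ ∈ [0,π]` of `x ≠ 0`. -/
def polarAngle (x : E3) : ℝ := Real.arccos (x 2 / ‖x‖)

/-- The azimuthal angle `φ` of a point off the `x₃`-axis, normalized to `(-π,π]`. It enters only
through `cos φ` and `sin φ`. -/
def azimuth (x : E3) : ℝ := Complex.arg ⟨x 0, x 1⟩

/-- The frame vector `n = (sin θ cos φ, sin θ sin φ, cos θ)`. -/
def frameN (θ φ : ℝ) : E3 :=
  !₂[Real.sin θ * Real.cos φ, Real.sin θ * Real.sin φ, Real.cos θ]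

/-- The frame vector `m = (cos θ cos φ, cos θ sin φ, -sin θ)`. -/
def frameM (θ φ : ℝ) : E3 :=
  !₂[Real.cos θ * Real.cos φ, Real.cos θ * Real.sin φ, -Real.sin θ]

/-- `∂_r w` of a function `w` with gradient field `g`. -/
def radialDeriv (g : E3 → E3) (x : E3) : ℝ :=
  inner ℝ (g x) (frameN (polarAngle x) (azimuth x))

/-- `∂_θ w` of a function `w` with gradient field `g`. -/
def polarDeriv (g : E3 → E3) (x : E3) : ℝ :=
  ‖x‖ * inner ℝ (g x) (frameM (polarAngle x) (azimuth x))

/-- `g` is the weak gradient of `w` on `ℝ³`. -/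
def HasWeakGradient (w : E3 → ℝ) (g : E3 → E3) : Prop :=
  ∀ ψ : E3 → ℝ, ContDiff ℝ ∞ ψ → HasCompactSupport ψ → ∀ j : Fin 3,
    ∫ x, w x * fderiv ℝ ψ x (EuclideanSpace.single j 1) = -∫ x, g x j * ψ x

/-- `w ∈ H¹(ℝ³)`, with weak gradient `g`. -/
structure MemH1 (w : E3 → ℝ) (g : E3 → E3) : Prop where
  memLp : MemLp w 2 volume
  memLp_grad : MemLp g 2 volume
  weakGradient : HasWeakGradient w g

/-- `w = w(r,θ)` almost everywhere: `w` is independent of `φ`. -/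
def IsAxisymmetric (w : E3 → ℝ) : Prop :=
  ∃ W : ℝ → ℝ → ℝ, ∀ᵐ x : E3, w x = W ‖x‖ (polarAngle x)

/-- The coefficient of `w² / r²` in `𝒬ᵢ`. -/
def angularCoeff (i : Fin 5) (θ : ℝ) : ℝ :=
  match i with
  | 0 => 6
  | 1 | 2 => 4 + 1 / Real.sin θ ^ 2
  | 3 | 4 => -2 + 4 / Real.sin θ ^ 2

/-- The bulk coefficient of `w²` in `𝒬ᵢ`. -/
def bulkCoeff (asq bsq csq : ℝ) (i : Fin 5) (t : ℝ) : ℝ :=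
  match i with
  | 0 => fHat asq bsq csq t
  | 1 | 2 => f asq bsq csq t
  | 3 | 4 => fTilde asq bsq csq t

/-- The expression inside the braces in `𝒬ᵢ(w)`, for `w` with gradient field `g`:
`|∂_r w|² + r⁻² |∂_θ w|² + r⁻² (angular coefficient) w² + (bulk coefficient) w²`. -/
def density (asq bsq csq : ℝ) (u : ℝ → ℝ) (i : Fin 5) (w : E3 → ℝ) (g : E3 → E3) (x : E3) : ℝ :=
  radialDeriv g x ^ 2 + 1 / ‖x‖ ^ 2 * polarDeriv g x ^ 2
    + 1 / ‖x‖ ^ 2 * angularCoeff i (polarAngle x) * w x ^ 2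
    + bulkCoeff asq bsq csq i (u ‖x‖) * w x ^ 2

/-- The integral over `ℝ³` of a function whose integral may be `+∞`: the integral of the positive
part minus that of the negative part (both are computed in `[0,∞]`). It is the usual integral for
an integrable function; in the undefined case `∞ - ∞` its value is `⊥ = -∞`. -/
def extIntegral (h : E3 → ℝ) : EReal :=
  ((∫⁻ x, ENNReal.ofReal (h x) : ℝ≥0∞) : EReal) - ((∫⁻ x, ENNReal.ofReal (-h x) : ℝ≥0∞) : EReal)

/-- The functional `𝒬ᵢ(w)`, `i = 0, …, 4`, for `w` with gradient field `g`. The integral is taken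
with respect to `dx = r² sin θ dr dθ dφ`; for `φ`-independent `w`, integrating in `φ` gives the
form `2π ∫ ∫ {…} r² sin θ dr dθ`. The value is `+∞` if `i ≥ 1` and `w ∈ H¹` but
`w / (r sin θ) ∉ L²`. -/
def Q (asq bsq csq : ℝ) (u : ℝ → ℝ) (i : Fin 5) (w : E3 → ℝ) (g : E3 → E3) : EReal :=
  extIntegral (density asq bsq csq u i w g)

end MeltingHedgehog

end

/-!
Off the `x₃`-axis, a null set, `𝒬ᵢ` is the form of an operator `-Δ + V` on axisymmetric functions,
with a potential `V` made of the angular and bulk coefficients.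

*Stability.* If `Φ > 0` satisfies `ΔΦ ≤ V Φ`, then `X = ∇Φ / Φ` satisfies `div X + |X|² ≤ V`, and
the density of the form dominates `div (w² X)`, whose integral vanishes
(`MemH1.integral_cutoffDensity_nonneg`). For `w ∈ H¹` given only with a weak gradient, the
divergence theorem comes from mollification (`MemH1.integral_sq_mul_fderiv`), and the singularities
of `X` are avoided by cutoffs, which can be removed because the angular terms control `w² / r²` and
`w² / (r sin θ)²` whenever the form is finite (`Q_nonneg`). The supersolutions are

* `r u'` for `𝒬₀`: dilations of the profile;
* `u sin θ` for `𝒬₁` and `𝒬₂`, which is a solution;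
* `sin² θ` for `𝒬₃` and `𝒬₄`, as long as `f̃(u) ≥ -4 / r²`.

This needs `0 < u < s₊`, `u' > 0`, and a lower bound for `u` when `a²` is small. They are derived
in the variable `t = log r`, where the profile `U` solves `U'' + U' - 6 U = e^{2t} F(U)`. The upper
bound is a maximum principle. For positivity (`LogProfile.pos`), suppose that there is a last zero:
then the reflection `-U (t₀ - s)` of the part to the left of it stays above `U (t₀ + s)`, since the
cubic `F` restores negative values less strongly than positive ones and the factor `e^{2t}` is
smaller on the left. So it could not tend to zero. Monotonicity (`LogProfile.deriv_pos`) is a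
sliding argument: the maximum principle excludes a violation of `U t ≤ U (t + τ)` outside a compact
set of `t`, and a largest shift `τ > 0` for which equality occurs inside is impossible too. The
lower bound is a barrier `σ (1 - K r^{-1/2})` (`LogProfile.barrier`).

*Instability.* For `w = sin² θ k(log r)` the form reduces to a one-dimensional one
(`Q_three_sinSqMul`), which for `k = U e^{-t/2} ξ` becomes
`∫ U² (ξ'² - ξ ξ' + (-7/4 + r² b² U) ξ²) dt` (`LogProfile.integral_mul_exp_mul`). For large `a²`, in the region where `a r` is between two
large constants, `U` is comparable to the constant `s₊ ~ a` by the barrier, while `r² b² U` is of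
order `1 / a`. Hence the form is negative at a sufficiently long bump `ξ` in the variable
`log (a r)`.
-/

noncomputable section

namespace MeltingHedgehog

/-! ### The bulk potential -/

theorem bulkF_eq (a b c t : ℝ) : bulkF a b c t = t * f a b c t := by
  unfold bulkF f; ring

theorem sPlus_pos {a b c : ℝ} (_ha : 0 < a) (hb : 0 < b) (hc : 0 < c) : 0 < sPlus a b c := by
  unfold sPlus
  positivity

theorem f_sPlus {a b c : ℝ} (ha : 0 < a) (hc : 0 < c) : f a b c (sPlus a b c) = 0 := by
  have h : Real.sqrt (b ^ 2 + 24 * a * c) ^ 2 = b ^ 2 + 24 * a * c :=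
    Real.sq_sqrt (by positivity)
  have h2 : f a b c (sPlus a b c)
      = (Real.sqrt (b ^ 2 + 24 * a * c) ^ 2 - b ^ 2 - 24 * a * c) / (24 * c) := by
    unfold f sPlus
    field_simp
    ring
  rw [h2, h]
  ring

/-- The factorization of the quadratic polynomial `f` by its roots, which have product
`-3a² / (2c²)`. -/
theorem f_factor {a b c : ℝ} (ha : 0 < a) (hb : 0 < b) (hc : 0 < c) (t : ℝ) :
    f a b c t = (t - sPlus a b c) * (2 * c * t / 3 + a / sPlus a b c) := by
  have hs := sPlus_pos ha hb hc
  have h := f_sPlus (b := b) ha hc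
  unfold f at *
  have h2 : a / sPlus a b c = 2 * c * sPlus a b c / 3 - b / 3 := by
    rw [div_eq_iff hs.ne']
    linarith
  rw [h2]
  linear_combination h

theorem f_neg {a b c : ℝ} (ha : 0 < a) (hb : 0 < b) (hc : 0 < c) {t : ℝ} (h0 : 0 ≤ t)
    (h1 : t < sPlus a b c) : f a b c t < 0 := by
  have hs := sPlus_pos ha hb hc
  rw [f_factor ha hb hc]
  exact mul_neg_of_neg_of_pos (by linarith) (by positivity)

theorem bulkF_neg {a b c : ℝ} (ha : 0 < a) (hb : 0 < b) (hc : 0 < c) {t : ℝ} (h0 : 0 < t)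
    (h1 : t < sPlus a b c) : bulkF a b c t < 0 := by
  rw [bulkF_eq]
  exact mul_neg_of_pos_of_neg h0 (f_neg ha hb hc h0.le h1)

theorem bulkF_nonneg {a b c : ℝ} (ha : 0 < a) (hb : 0 < b) (hc : 0 < c) {t : ℝ}
    (h1 : sPlus a b c ≤ t) : 0 ≤ bulkF a b c t := by
  have hs := sPlus_pos ha hb hc
  have ht : 0 < t := by linarith
  rw [bulkF_eq, f_factor ha hb hc]
  have : 0 ≤ t - sPlus a b c := by linarith
  positivity

theorem hasDerivAt_bulkF (a b c t : ℝ) : HasDerivAt (bulkF a b c) (fHat a b c t) t := by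
  unfold bulkF fHat
  have h := ((((hasDerivAt_id t).const_mul (-a)).sub
    (((hasDerivAt_id t).pow 2).const_mul (b / 3))).add
    (((hasDerivAt_id t).pow 3).const_mul (2 * c / 3)))
  refine (h.congr_deriv ?_).congr_of_eventuallyEq (.of_forall fun x => ?_)
  · simp; ring
  · simp

theorem fHat_sPlus_pos {a b c : ℝ} (ha : 0 < a) (hb : 0 < b) (hc : 0 < c) :
    0 < fHat a b c (sPlus a b c) := by
  have hs := sPlus_pos ha hb hc
  have h := f_sPlus (b := b) ha hc
  unfold f at h
  unfold fHat
  nlinarith [mul_pos hb hs]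

/-! ### Calculus on the line -/

/-- The second derivative test, as a necessary condition at a maximum. -/
theorem second_deriv_nonpos_of_isLocalMax {y y' : ℝ → ℝ} {c t : ℝ}
    (h : ∀ s, HasDerivAt y (y' s) s) (h' : HasDerivAt y' c t) (hm : IsLocalMax y t) : c ≤ 0 := by
  by_contra! hc
  have h0 : y' t = 0 := hm.hasDerivAt_eq_zero (h t)
  have hpos : ∀ᶠ s in 𝓝[>] t, 0 < y' s := by
    have := (hasDerivAt_iff_tendsto_slope.1 h').mono_left
      (nhdsWithin_mono t (fun s (hs : t < s) => hs.ne') : 𝓝[>] t ≤ 𝓝[≠] t)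
    filter_upwards [this.eventually (lt_mem_nhds hc), self_mem_nhdsWithin] with s hs hts
    rw [slope_def_field, h0, sub_zero] at hs
    have : 0 < s - t := sub_pos.2 hts
    exact (div_pos_iff_of_pos_right this).1 hs
  obtain ⟨e, he, hpos⟩ := mem_nhdsGT_iff_exists_Ioo_subset.1 hpos
  have hmono : StrictMonoOn y (Set.Icc t e) := by
    refine strictMonoOn_of_deriv_pos (convex_Icc t e)
      (fun s _ => (h s).continuousAt.continuousWithinAt) fun s hs => ?_
    rw [interior_Icc] at hs
    rw [(h s).deriv]
    exact hpos hs
  have hm' : ∀ᶠ s in 𝓝[>] t, y s ≤ y t := hm.filter_mono nhdsWithin_le_nhds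
  have he' : ∀ᶠ s in 𝓝[>] t, s ∈ Set.Ioo t e := Ioo_mem_nhdsGT he
  obtain ⟨s, hs1, hs2⟩ := (hm'.and he').exists
  have := hmono ⟨le_rfl, he.le⟩ ⟨hs2.1.le, hs2.2.le⟩ hs2.1
  linarith

theorem second_deriv_nonneg_of_isLocalMin {y y' : ℝ → ℝ} {c t : ℝ}
    (h : ∀ s, HasDerivAt y (y' s) s) (h' : HasDerivAt y' c t) (hm : IsLocalMin y t) : 0 ≤ c := by
  have := second_deriv_nonpos_of_isLocalMax (fun s => (h s).neg) h'.neg hm.neg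
  linarith

theorem exists_forall_le_of_tendsto {y : ℝ → ℝ} (hy : Continuous y) {t₁ : ℝ}
    (hbot : ∀ᶠ t in atBot, y t ≤ y t₁) (htop : ∀ᶠ t in atTop, y t ≤ y t₁) :
    ∃ t, ∀ s, y s ≤ y t := by
  refine hy.exists_forall_ge' t₁ ?_
  rw [cocompact_eq_atBot_atTop]
  exact eventually_sup.2 ⟨hbot, htop⟩

/-! ### The profile in the logarithmic variable -/

/-- The profile equation in the variable `t = log r`, for `U t = u (exp t)` with derivative `U'`:
`U'' + U' - 6 U = e^{2t} F(U)`, with the limits `0` at `-∞` and `s₊` at `+∞`. -/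
structure LogProfile (a b c : ℝ) (U U' : ℝ → ℝ) : Prop where
  hasDerivAt : ∀ t, HasDerivAt U (U' t) t
  hasDerivAt' : ∀ t, HasDerivAt U' (-U' t + 6 * U t + Real.exp (2 * t) * bulkF a b c (U t)) t
  tendsto_atBot : Tendsto U atBot (𝓝 0)
  tendsto_atTop : Tendsto U atTop (𝓝 (sPlus a b c))

theorem IsProfile.logProfile {a b c : ℝ} {u : ℝ → ℝ} (hu : IsProfile a b c u) :
    LogProfile a b c (fun t => u (Real.exp t)) (fun t => Real.exp t * deriv u (Real.exp t)) where
  hasDerivAt t := by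
    have h := (hu.differentiableAt _ (Real.exp_pos t)).hasDerivAt.comp t (Real.hasDerivAt_exp t)
    exact h.congr_deriv (by ring)
  hasDerivAt' t := by
    have h := (Real.hasDerivAt_exp t).mul
      ((hu.differentiableAt_deriv _ (Real.exp_pos t)).hasDerivAt.comp t (Real.hasDerivAt_exp t))
    refine h.congr_deriv ?_
    have ho := hu.ode _ (Real.exp_pos t)
    have hp := Real.exp_pos t
    rw [two_mul, Real.exp_add, ← ho]
    simp only [Function.comp]
    field_simp
    ring
  tendsto_atBot := hu.tendsto_zero.comp Real.tendsto_exp_atBot_nhdsGT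
  tendsto_atTop := hu.tendsto_atTop.comp Real.tendsto_exp_atTop

namespace LogProfile

variable {a b c : ℝ} {U U' : ℝ → ℝ}

theorem continuous (h : LogProfile a b c U U') : Continuous U :=
  continuous_iff_continuousAt.2 fun t => (h.hasDerivAt t).continuousAt

theorem continuous' (h : LogProfile a b c U U') : Continuous U' :=
  continuous_iff_continuousAt.2 fun t => (h.hasDerivAt' t).continuousAt

theorem contDiff (h : LogProfile a b c U U') : ContDiff ℝ ∞ U ∧ ContDiff ℝ ∞ U' := by
  have hU : deriv U = U' := funext fun t => (h.hasDerivAt t).deriv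
  have hU' : deriv U' = fun t => -U' t + 6 * U t + Real.exp (2 * t) * bulkF a b c (U t) :=
    funext fun t => (h.hasDerivAt' t).deriv
  have key : ∀ n : ℕ, ContDiff ℝ n U ∧ ContDiff ℝ n U' := by
    intro n
    induction n with
    | zero => exact ⟨contDiff_zero.2 h.continuous, contDiff_zero.2 h.continuous'⟩
    | succ n ih =>
      constructor
      · rw [Nat.cast_succ, contDiff_succ_iff_deriv]
        refine ⟨fun t => (h.hasDerivAt t).differentiableAt, by simp, ?_⟩
        rw [hU]
        exact ih.2
      · rw [Nat.cast_succ, contDiff_succ_iff_deriv]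
        refine ⟨fun t => (h.hasDerivAt' t).differentiableAt, by simp, ?_⟩
        rw [hU']
        have h1 := ih.1
        have h2 := ih.2
        unfold bulkF
        fun_prop
  exact ⟨contDiff_infty.2 fun n => (key n).1, contDiff_infty.2 fun n => (key n).2⟩

theorem lt_sPlus (h : LogProfile a b c U U') (ha : 0 < a) (hb : 0 < b) (hc : 0 < c) (t : ℝ) :
    U t < sPlus a b c := by
  have hs := sPlus_pos ha hb hc
  -- the equation excludes a global maximum with a value `≥ s₊`
  have nomax : ∀ t, (∀ s, U s ≤ U t) → U t < sPlus a b c := by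
    intro t ht
    by_contra! hge
    have hm : IsLocalMax U t := .of_forall ht
    have h0 : U' t = 0 := hm.hasDerivAt_eq_zero (h.hasDerivAt t)
    have := second_deriv_nonpos_of_isLocalMax h.hasDerivAt (h.hasDerivAt' t) hm
    have hF := mul_nonneg (Real.exp_pos (2 * t)).le (bulkF_nonneg ha hb hc hge)
    rw [h0] at this
    linarith
  have hle : ∀ t, U t ≤ sPlus a b c := by
    intro t
    by_contra! hlt
    obtain ⟨m, hm⟩ := exists_forall_le_of_tendsto h.continuous (t₁ := t)
      ((h.tendsto_atBot.eventually (gt_mem_nhds (hs.trans hlt))).mono fun _ h => h.le)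
      ((h.tendsto_atTop.eventually (gt_mem_nhds hlt)).mono fun _ h => h.le)
    have := nomax m hm
    linarith [hm t]
  by_contra! hge
  have := nomax t fun s => (hle s).trans hge
  linarith

/-- A solution with vanishing Cauchy data at `t₀` vanishes to the right of `t₀`. -/
theorem eq_zero_of_cauchy (h : LogProfile a b c U U') {t₀ t₁ : ℝ} (ht : t₀ ≤ t₁)
    (h0 : U t₀ = 0) (h0' : U' t₀ = 0) : U t₁ = 0 := by
  set k : ℝ → ℝ := fun t => 6 + Real.exp (2 * t) * f a b c (U t)
  have hk : Continuous k := by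
    have := h.continuous
    unfold k f
    fun_prop
  obtain ⟨K, hK⟩ := (isCompact_Icc (a := t₀) (b := t₁)).exists_bound_of_continuousOn hk.continuousOn
  -- `(U² + U'²) e^{-(K+1) t}` is nonincreasing
  set E : ℝ → ℝ := fun t => (U t ^ 2 + U' t ^ 2) * Real.exp (-((K + 1) * t))
  have hE : ∀ t, HasDerivAt E ((2 * U t * U' t + 2 * U' t * (-U' t + k t * U t)
      - (K + 1) * (U t ^ 2 + U' t ^ 2)) * Real.exp (-((K + 1) * t))) t := by
    intro t
    have h1 := ((h.hasDerivAt t).pow 2).add ((h.hasDerivAt' t).pow 2)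
    have h2 := (((hasDerivAt_id t).const_mul (K + 1)).neg).exp
    refine (h1.mul h2).congr_deriv ?_
    simp only [bulkF_eq, k, id, Pi.add_apply, Pi.pow_apply, Pi.neg_apply]
    push_cast
    ring
  have hanti : AntitoneOn E (Set.Icc t₀ t₁) := by
    refine antitoneOn_of_deriv_nonpos (convex_Icc _ _)
      (fun s _ => (hE s).continuousAt.continuousWithinAt)
      (fun s _ => (hE s).differentiableAt.differentiableWithinAt) fun s hs => ?_
    rw [interior_Icc] at hs
    rw [(hE s).deriv]
    refine mul_nonpos_of_nonpos_of_nonneg ?_ (Real.exp_pos _).le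
    have hks := abs_le.1 (hK s ⟨hs.1.le, hs.2.le⟩)
    have h3 : 0 ≤ (K - k s) * (U s + U' s) ^ 2 := mul_nonneg (by linarith) (sq_nonneg _)
    have h4 : 0 ≤ (K + k s) * (U s - U' s) ^ 2 := mul_nonneg (by linarith) (sq_nonneg _)
    nlinarith [sq_nonneg (U s - U' s), sq_nonneg (U' s), sq_nonneg (U s + U' s)]
  have h1 := hanti ⟨le_rfl, ht⟩ ⟨ht, le_rfl⟩ ht
  have h2 : E t₀ = 0 := by simp [E, h0, h0']
  rw [h2] at h1
  have h3 : U t₁ ^ 2 + U' t₁ ^ 2 ≤ 0 := by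
    by_contra! hlt
    have := mul_pos hlt (Real.exp_pos (-((K + 1) * t₁)))
    simp only [E] at h1
    linarith
  have : U t₁ ^ 2 = 0 := le_antisymm (by nlinarith [sq_nonneg (U' t₁)]) (sq_nonneg _)
  exact pow_eq_zero_iff (by norm_num) |>.1 this

/-! ### Positivity of the profile -/

/-- The comparison of the restoring forces behind `LogProfile.pos`: reflection at a zero of the
profile replaces `f(u)` by `f(-v)`, which is larger as long as `v` is not much smaller than `u`. -/
theorem exp_mul_f_le (ha : 0 < a) (hb : 0 < b) (hc : 0 < c) {u v s : ℝ} (hs : 0 ≤ s)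
    (hu : 0 < u) (hu' : u < sPlus a b c) (hv : 0 < v) (hvu : u - b / (2 * c) ≤ v) :
    Real.exp (2 * s) * f a b c u ≤ Real.exp (-(2 * s)) * f a b c (-v) := by
  have h1 : f a b c u < 0 := f_neg ha hb hc hu.le hu'
  have h2 : f a b c u ≤ f a b c (-v) := by
    have h3 : 0 ≤ (v + u) * (b + 2 * c * (v - u)) := by
      refine mul_nonneg (by linarith) ?_
      have : b / (2 * c) * (2 * c) = b := by field_simp
      nlinarith
    unfold f
    linarith
  have h4 : (1 : ℝ) ≤ Real.exp (2 * s) := Real.one_le_exp (by linarith)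
  have h5 : Real.exp (-(2 * s)) ≤ 1 := Real.exp_le_one_iff.2 (by linarith)
  have h6 := Real.exp_pos (-(2 * s))
  rcases le_or_gt 0 (f a b c (-v)) with h | h
  · nlinarith [mul_nonneg h6.le h]
  · nlinarith

/-- If the profile has a simple zero at `t₀` and is positive on the right of it, then
`v s = -U (t₀ - s)` stays above `u s = U (t₀ + s)`: for `W = v' u - u' v - u v` one has
`W' = e^{2 t₀} u v (e^{-2s} f(-v) - e^{2s} f(u))` and `(v / u)' = (W + u v) / u²`. -/
theorem le_reflection (h : LogProfile a b c U U') (ha : 0 < a) (hb : 0 < b) (hc : 0 < c)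
    {t₀ τ : ℝ} (h0 : U t₀ = 0) (h0' : 0 < U' t₀) (hpos : ∀ t, t₀ < t → 0 < U t) (hτ : 0 < τ)
    (hv : ∀ s ∈ Set.Ioo 0 τ, 0 < -U (t₀ - s) ∧ U (t₀ + s) - b / (2 * c) ≤ -U (t₀ - s)) :
    U (t₀ + τ) ≤ -U (t₀ - τ) := by
  set u : ℝ → ℝ := fun s => U (t₀ + s)
  set v : ℝ → ℝ := fun s => -U (t₀ - s)
  have hu1 : ∀ s, HasDerivAt u (U' (t₀ + s)) s := fun s =>
    (h.hasDerivAt (t₀ + s)).comp_const_add t₀ s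
  have hv1 : ∀ s, HasDerivAt v (U' (t₀ - s)) s := fun s =>
    ((h.hasDerivAt (t₀ - s)).comp_const_sub t₀ s).neg.congr_deriv (neg_neg _)
  have hu2 : ∀ s, HasDerivAt (fun s => U' (t₀ + s))
      (-U' (t₀ + s) + 6 * u s + Real.exp (2 * (t₀ + s)) * bulkF a b c (u s)) s := fun s =>
    (h.hasDerivAt' (t₀ + s)).comp_const_add t₀ s
  have hv2 : ∀ s, HasDerivAt (fun s => U' (t₀ - s))
      (-(-U' (t₀ - s) + 6 * -v s + Real.exp (2 * (t₀ - s)) * bulkF a b c (-v s))) s := fun s =>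
    ((h.hasDerivAt' (t₀ - s)).comp_const_sub t₀ s).congr_deriv (by simp only [v, neg_neg])
  set W : ℝ → ℝ := fun s => U' (t₀ - s) * u s - U' (t₀ + s) * v s - u s * v s
  have hW : ∀ s, HasDerivAt W (Real.exp (2 * t₀) * (u s * v s *
      (Real.exp (-(2 * s)) * f a b c (-v s) - Real.exp (2 * s) * f a b c (u s)))) s := fun s => by
    refine ((((hv2 s).mul (hu1 s)).sub ((hu2 s).mul (hv1 s))).sub
      ((hu1 s).mul (hv1 s))).congr_deriv ?_
    have e1 : Real.exp (2 * (t₀ + s)) = Real.exp (2 * t₀) * Real.exp (2 * s) := by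
      rw [← Real.exp_add]; ring_nf
    have e2 : Real.exp (2 * (t₀ - s)) = Real.exp (2 * t₀) * Real.exp (-(2 * s)) := by
      rw [← Real.exp_add]; ring_nf
    rw [e1, e2, bulkF_eq, bulkF_eq]
    ring
  have hupos : ∀ s, 0 < s → 0 < u s := fun s hs => hpos _ (by linarith)
  have hWmono : MonotoneOn W (Set.Icc 0 τ) := by
    refine monotoneOn_of_deriv_nonneg (convex_Icc _ _)
      (fun s _ => (hW s).continuousAt.continuousWithinAt)
      (fun s _ => (hW s).differentiableAt.differentiableWithinAt) fun s hs => ?_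
    rw [interior_Icc] at hs
    rw [(hW s).deriv]
    have hvs := hv s hs
    have := exp_mul_f_le ha hb hc hs.1.le (hupos s hs.1) (h.lt_sPlus ha hb hc _) hvs.1 hvs.2
    have h1 := mul_pos (hupos s hs.1) hvs.1
    exact mul_nonneg (Real.exp_pos _).le (mul_nonneg h1.le (sub_nonneg.2 this))
  have hW0 : W 0 = 0 := by simp [W, u, v, h0]
  have hq : ∀ s, 0 < s → HasDerivAt (fun s => v s / u s) ((W s + u s * v s) / u s ^ 2) s :=
    fun s hs => ((hv1 s).div (hu1 s) (hupos s hs).ne').congr_deriv (by simp only [W]; ring)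
  have hqmono : MonotoneOn (fun s => v s / u s) (Set.Ioc 0 τ) := by
    refine monotoneOn_of_deriv_nonneg (convex_Ioc _ _)
      (fun s hs => (hq s hs.1).continuousAt.continuousWithinAt)
      (fun s hs => ?_) fun s hs => ?_
    · rw [interior_Ioc] at hs
      exact (hq s hs.1).differentiableAt.differentiableWithinAt
    · rw [interior_Ioc] at hs
      rw [(hq s hs.1).deriv]
      have h1 : W 0 ≤ W s := hWmono ⟨le_rfl, hτ.le⟩ ⟨hs.1.le, hs.2.le⟩ hs.1.le
      have h2 := mul_pos (hupos s hs.1) (hv s hs).1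
      have h3 := hupos s hs.1
      rw [hW0] at h1
      exact div_nonneg (add_nonneg h1 h2.le) (sq_nonneg _)
  have hlim : Tendsto (fun s => v s / u s) (𝓝[>] 0) (𝓝 1) := by
    have hle : 𝓝[>] (0 : ℝ) ≤ 𝓝[≠] 0 := nhdsWithin_mono _ fun s (hs : 0 < s) => hs.ne'
    have h1 := (hasDerivAt_iff_tendsto_slope.1 (hv1 0)).mono_left hle
    have h2 := (hasDerivAt_iff_tendsto_slope.1 (hu1 0)).mono_left hle
    simp only [sub_zero, add_zero] at h1 h2
    have h3 := h1.div h2 h0'.ne'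
    rw [div_self h0'.ne'] at h3
    refine h3.congr' ?_
    filter_upwards [self_mem_nhdsWithin] with s hs
    have hs' : s ≠ 0 := (Set.mem_Ioi.1 hs).ne'
    simp only [Pi.div_apply, slope_def_field, u, v, add_zero, sub_zero, h0, neg_zero]
    field_simp
  have h1 : 1 ≤ v τ / u τ := by
    refine le_of_tendsto hlim ?_
    filter_upwards [Ioo_mem_nhdsGT hτ] with s hs
    exact hqmono ⟨hs.1, hs.2.le⟩ ⟨hτ, le_rfl⟩ hs.2.le
  exact (one_le_div (hupos τ hτ)).1 h1

/-- At the last zero of a profile with a zero, the reflected profile dominates the profile for all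
time, which contradicts the limits at `±∞`. -/
theorem pos (h : LogProfile a b c U U') (ha : 0 < a) (hb : 0 < b) (hc : 0 < c) (t : ℝ) :
    0 < U t := by
  have hs := sPlus_pos ha hb hc
  by_contra! hneg
  -- `t₀` is the last zero
  set S : Set ℝ := {t | U t ≤ 0}
  have hSne : S.Nonempty := ⟨t, hneg⟩
  have hScl : IsClosed S := isClosed_le h.continuous continuous_const
  have hSbd : BddAbove S := by
    obtain ⟨T, hT⟩ := eventually_atTop.1 (h.tendsto_atTop.eventually (lt_mem_nhds hs))
    refine ⟨T, fun x hx => ?_⟩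
    by_contra! hlt
    have := hT x hlt.le
    exact absurd hx (not_le.2 this)
  set t₀ := sSup S
  have ht₀ : U t₀ ≤ 0 := hScl.csSup_mem hSne hSbd
  have hpos : ∀ t, t₀ < t → 0 < U t := fun t ht => by
    by_contra! hle
    exact absurd (le_csSup hSbd hle) (not_le.2 ht)
  have h0 : U t₀ = 0 := by
    refine le_antisymm ht₀ (ge_of_tendsto (h.continuous.continuousWithinAt (s := Set.Ioi t₀)) ?_)
    filter_upwards [self_mem_nhdsWithin] with s hs using (hpos s hs).le
  have h0' : 0 < U' t₀ := by
    have h1 : 0 ≤ U' t₀ := by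
      have := (hasDerivAt_iff_tendsto_slope.1 (h.hasDerivAt t₀)).mono_left
        (nhdsWithin_mono t₀ (fun s (hs : t₀ < s) => hs.ne') : 𝓝[>] t₀ ≤ 𝓝[≠] t₀)
      refine ge_of_tendsto this ?_
      filter_upwards [self_mem_nhdsWithin] with s hs
      rw [slope_def_field, h0, sub_zero]
      exact div_nonneg (hpos s hs).le (sub_nonneg.2 (le_of_lt hs))
    refine lt_of_le_of_ne h1 fun h2 => ?_
    have := h.eq_zero_of_cauchy (t₁ := t₀ + 1) (by linarith) h0 h2.symm
    linarith [hpos (t₀ + 1) (by linarith)]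
  set u : ℝ → ℝ := fun s => U (t₀ + s)
  set v : ℝ → ℝ := fun s => -U (t₀ - s)
  have hucont : Continuous u := h.continuous.comp (by fun_prop)
  have hvcont : Continuous v := (h.continuous.comp (by fun_prop)).neg
  set δ := b / (2 * c)
  have hδ : 0 < δ := by positivity
  have hu0 : u 0 = 0 := by simp [u, h0]
  have hv0 : v 0 = 0 := by simp [v, h0]
  have hv1 : HasDerivAt v (U' t₀) 0 := by
    have h1 := ((h.hasDerivAt (t₀ - 0)).comp_const_sub t₀ 0).neg
    exact h1.congr_deriv (by rw [neg_neg, sub_zero])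
  have hsmall : ∀ᶠ s in 𝓝[>] (0 : ℝ), 0 < v s ∧ u s - δ < v s := by
    have h1 := (hasDerivAt_iff_tendsto_slope.1 hv1).mono_left
      (nhdsWithin_mono 0 (fun s (hs : 0 < s) => hs.ne') : 𝓝[>] (0 : ℝ) ≤ 𝓝[≠] 0)
    have h2 : ∀ᶠ s in 𝓝 (0 : ℝ), u s - δ < v s :=
      (hucont.sub continuous_const).continuousAt.eventually_lt hvcont.continuousAt
        (by change u 0 - δ < v 0; rw [hu0, hv0]; linarith)
    filter_upwards [h1.eventually (lt_mem_nhds h0'), nhdsWithin_le_nhds h2,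
      self_mem_nhdsWithin] with s hs1 hs2 hs3
    refine ⟨?_, hs2⟩
    rw [slope_def_field, hv0, sub_zero, sub_zero] at hs1
    exact (div_pos_iff_of_pos_right hs3).1 hs1
  obtain ⟨e, he, hsmall⟩ := mem_nhdsGT_iff_exists_Ioo_subset.1 hsmall
  have he' : 0 < e := he
  -- `v` can neither reach zero nor fall behind `u` by `δ`
  have hgood : ∀ s, 0 < s → 0 < v s ∧ u s - δ < v s := by
    by_contra! hbad
    obtain ⟨s₁, hs₁, hbad⟩ := hbad
    set B : Set ℝ := {s | e / 2 ≤ s ∧ (v s ≤ 0 ∨ v s ≤ u s - δ)}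
    have hBcl : IsClosed B := (isClosed_le continuous_const continuous_id).inter
      ((isClosed_le hvcont continuous_const).union
        (isClosed_le hvcont (hucont.sub continuous_const)))
    have hBbd : BddBelow B := ⟨e / 2, fun s hs => hs.1⟩
    have hbad' : v s₁ ≤ 0 ∨ v s₁ ≤ u s₁ - δ := by
      by_cases hh : 0 < v s₁
      · exact .inr (hbad hh)
      · exact .inl (not_lt.1 hh)
    have hs₁B : s₁ ∈ B := by
      refine ⟨?_, hbad'⟩
      by_contra! hlt
      have h3 : 0 < v s₁ ∧ u s₁ - δ < v s₁ := hsmall (show s₁ ∈ Set.Ioo 0 e from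
        ⟨hs₁, by linarith⟩)
      rcases hbad' with h1 | h1 <;> linarith [h3.1, h3.2]
    have hτ := hBcl.csInf_mem ⟨s₁, hs₁B⟩ hBbd
    set τ := sInf B
    have hτ0 : 0 < τ := by linarith [hτ.1]
    have hlt : ∀ s ∈ Set.Ioo 0 τ, 0 < v s ∧ u s - δ < v s := by
      intro s hs
      rcases lt_or_ge s e with h1 | h1
      · exact hsmall ⟨hs.1, h1⟩
      · by_contra hcon
        have : s ∈ B := by
          refine ⟨by linarith, ?_⟩
          by_contra! hcc
          exact hcon hcc
        linarith [csInf_le hBbd this, hs.2]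
    have hle := h.le_reflection ha hb hc h0 h0' hpos hτ0
      fun s hs => ⟨(hlt s hs).1, (hlt s hs).2.le⟩
    have hup := hpos (t₀ + τ) (by linarith)
    rcases hτ.2 with h1 | h1
    · simp only [v] at h1; linarith
    · simp only [v, u] at h1; linarith
  have hle : ∀ s, 0 < s → U (t₀ + s) ≤ -U (t₀ - s) := fun s hs =>
    h.le_reflection ha hb hc h0 h0' hpos hs fun x hx => ⟨(hgood x hx.1).1, (hgood x hx.1).2.le⟩
  have hl1 : Tendsto (fun s => U (t₀ + s)) atTop (𝓝 (sPlus a b c)) :=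
    h.tendsto_atTop.comp (tendsto_atTop_add_const_left _ _ tendsto_id)
  have hl2 : Tendsto (fun s => -U (t₀ - s)) atTop (𝓝 (-0)) :=
    (h.tendsto_atBot.comp (tendsto_atBot_add_const_left _ t₀ tendsto_neg_atTop_atBot)).neg
  have := le_of_tendsto_of_tendsto hl1 hl2 ((eventually_gt_atTop 0).mono hle)
  linarith

/-! ### Monotonicity of the profile -/

/-- The difference `D t = U (t + τ) - U t` satisfies
`D'' + D' - 6 D = e^{2(t+τ)} F(U (t + τ)) - e^{2t} F(U t)`, where the right-hand side is at most
`e^{2t} (F(U (t + τ)) - F(U t))` because `F ≤ 0` on the range of `U`. Hence `D` has no negative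
minimum near `-∞`, where the coefficient `e^{2t}` is small, nor near `+∞`, where `F` is
increasing. -/
theorem le_shift_of_le_on_Icc (h : LogProfile a b c U U') (ha : 0 < a) (hb : 0 < b) (hc : 0 < c)
    {T₁ T₂ τ : ℝ} (hT₁ : Real.exp (2 * T₁) * (a + 2 * b / 3 * sPlus a b c) < 6)
    (hT₂ : ∀ t, T₂ ≤ t → 0 < -a - 2 * b / 3 * sPlus a b c + 2 * c * U t ^ 2) (hτ : 0 < τ)
    (hmid : ∀ t ∈ Set.Icc T₁ T₂, U t ≤ U (t + τ)) (t : ℝ) : U t ≤ U (t + τ) := by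
  have hs := sPlus_pos ha hb hc
  by_contra! hlt
  set D : ℝ → ℝ := fun t => U (t + τ) - U t
  have hD1 : ∀ t, HasDerivAt D (U' (t + τ) - U' t) t := fun t =>
    ((h.hasDerivAt (t + τ)).comp_add_const t τ).sub (h.hasDerivAt t)
  have hD2 : ∀ t, HasDerivAt (fun t => U' (t + τ) - U' t)
      ((-U' (t + τ) + 6 * U (t + τ) + Real.exp (2 * (t + τ)) * bulkF a b c (U (t + τ)))
        - (-U' t + 6 * U t + Real.exp (2 * t) * bulkF a b c (U t))) t := fun t =>
    ((h.hasDerivAt' (t + τ)).comp_add_const t τ).sub (h.hasDerivAt' t)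
  have hDc : Continuous D := (h.continuous.comp (by fun_prop)).sub h.continuous
  have hDt : D t < 0 := by simp only [D]; linarith
  have hDbot : Tendsto D atBot (𝓝 0) := by
    have := (h.tendsto_atBot.comp (tendsto_atBot_add_const_right _ τ tendsto_id)).sub
      h.tendsto_atBot
    simpa using this
  have hDtop : Tendsto D atTop (𝓝 0) := by
    have := (h.tendsto_atTop.comp (tendsto_atTop_add_const_right _ τ tendsto_id)).sub
      h.tendsto_atTop
    simpa using this
  obtain ⟨m, hm⟩ := exists_forall_le_of_tendsto (y := fun t => -D t) hDc.neg (t₁ := t)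
    ((hDbot.eventually (lt_mem_nhds hDt)).mono fun _ h => by linarith)
    ((hDtop.eventually (lt_mem_nhds hDt)).mono fun _ h => by linarith)
  have hDm : D m < 0 := by linarith [hm t]
  have hmin : IsLocalMin D m := .of_forall fun s => by linarith [hm s]
  have h0 := hmin.hasDerivAt_eq_zero (hD1 m)
  have h2 := second_deriv_nonneg_of_isLocalMin hD1 (hD2 m) hmin
  have hx := h.pos ha hb hc (m + τ)
  have hx' := h.lt_sPlus ha hb hc (m + τ)
  have hy := h.pos ha hb hc m
  have hy' := h.lt_sPlus ha hb hc m
  have hmmid : m ∉ Set.Icc T₁ T₂ := fun hmem => by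
    have := hmid m hmem
    simp only [D] at hDm
    linarith
  have hexp := Real.exp_pos (2 * m)
  have hF : Real.exp (2 * (m + τ)) * bulkF a b c (U (m + τ))
      ≤ Real.exp (2 * m) * bulkF a b c (U (m + τ)) :=
    mul_le_mul_of_nonpos_right (Real.exp_le_exp.2 (by linarith)) (bulkF_neg ha hb hc hx hx').le
  set x := U (m + τ)
  set y := U m
  have hxy : x < y := by simp only [D] at hDm; linarith
  have hfac : bulkF a b c x - bulkF a b c y
      = (x - y) * (-a - b / 3 * (x + y) + 2 * c / 3 * (x ^ 2 + x * y + y ^ 2)) := by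
    unfold bulkF; ring
  have hsum : 6 * (x - y) + Real.exp (2 * m) * (bulkF a b c x - bulkF a b c y) < 0 := by
    rw [hfac]
    rcases lt_or_ge m T₁ with hmT | hmT
    · have h3 : -(a + 2 * b / 3 * sPlus a b c)
          ≤ -a - b / 3 * (x + y) + 2 * c / 3 * (x ^ 2 + x * y + y ^ 2) := by
        have : 0 ≤ 2 * c / 3 * (x ^ 2 + x * y + y ^ 2) := by positivity
        nlinarith
      have h4 : Real.exp (2 * m) * (a + 2 * b / 3 * sPlus a b c) < 6 := by
        refine lt_of_le_of_lt ?_ hT₁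
        gcongr
      have h5 : 0 < 6 + Real.exp (2 * m)
          * (-a - b / 3 * (x + y) + 2 * c / 3 * (x ^ 2 + x * y + y ^ 2)) := by
        nlinarith
      nlinarith
    · have hmT₂ : T₂ < m := by
        by_contra! hle
        exact hmmid ⟨hmT, hle⟩
      have h3 := hT₂ (m + τ) (by linarith)
      have h4 : 0 ≤ -a - b / 3 * (x + y) + 2 * c / 3 * (x ^ 2 + x * y + y ^ 2) := by
        have h5 : x ^ 2 + x ^ 2 + x ^ 2 ≤ x ^ 2 + x * y + y ^ 2 := by nlinarith
        have h6 := mul_le_mul_of_nonneg_left h5 hc.le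
        have h7 : b * (x + y) ≤ b * (2 * sPlus a b c) :=
          mul_le_mul_of_nonneg_left (by linarith) hb.le
        change 0 < -a - 2 * b / 3 * sPlus a b c + 2 * c * x ^ 2 at h3
        linarith
      have h5 : (x - y) * (-a - b / 3 * (x + y) + 2 * c / 3 * (x ^ 2 + x * y + y ^ 2)) ≤ 0 :=
        mul_nonpos_of_nonpos_of_nonneg (by linarith) h4
      nlinarith [mul_nonneg hexp.le (neg_nonneg.2 h5)]
  nlinarith

/-- Sliding argument: the largest shift `τ` for which `U (t + τ) ≥ U t` fails would give a contact
point, where the second derivative of the difference is `e^{2t} (e^{2τ} - 1) F(U t) < 0`. -/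
theorem le_shift (h : LogProfile a b c U U') (ha : 0 < a) (hb : 0 < b) (hc : 0 < c)
    {τ : ℝ} (hτ : 0 < τ) (t : ℝ) : U t ≤ U (t + τ) := by
  have hs := sPlus_pos ha hb hc
  obtain ⟨T₁, hT₁⟩ : ∃ T₁, Real.exp (2 * T₁) * (a + 2 * b / 3 * sPlus a b c) < 6 := by
    have h1 : Tendsto (fun T : ℝ => Real.exp (2 * T) * (a + 2 * b / 3 * sPlus a b c)) atBot
        (𝓝 (0 * (a + 2 * b / 3 * sPlus a b c))) :=
      (Real.tendsto_exp_atBot.comp (tendsto_id.const_mul_atBot two_pos)).mul_const _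
    rw [zero_mul] at h1
    exact (h1.eventually (gt_mem_nhds (by norm_num : (0 : ℝ) < 6))).exists
  obtain ⟨T₂, hT₂⟩ : ∃ T₂, ∀ t, T₂ ≤ t →
      0 < -a - 2 * b / 3 * sPlus a b c + 2 * c * U t ^ 2 := by
    have h1 : Tendsto (fun t => -a - 2 * b / 3 * sPlus a b c + 2 * c * U t ^ 2) atTop
        (𝓝 (-a - 2 * b / 3 * sPlus a b c + 2 * c * sPlus a b c ^ 2)) :=
      ((h.tendsto_atTop.pow 2).const_mul _).const_add _
    have h2 := fHat_sPlus_pos ha hb hc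
    unfold fHat at h2
    exact eventually_atTop.1 (h1.eventually (lt_mem_nhds (by linarith)))
  have key := fun {τ : ℝ} (hτ : 0 < τ) =>
    h.le_shift_of_le_on_Icc ha hb hc (τ := τ) hT₁ hT₂ hτ
  by_contra! hlt
  have hne : ∃ t ∈ Set.Icc T₁ T₂, U (t + τ) < U t := by
    by_contra! hcon
    exact absurd (key hτ hcon t) (not_le.2 hlt)
  obtain ⟨t₁, ht₁, hlt₁⟩ := hne
  -- large shifts are unproblematic
  obtain ⟨M, hM⟩ : ∃ M, ∀ τ', M ≤ τ' → ∀ t ∈ Set.Icc T₁ T₂, U t < U (t + τ') := by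
    obtain ⟨p, hp, hmax⟩ := (isCompact_Icc (a := T₁) (b := T₂)).exists_isMaxOn ⟨t₁, ht₁⟩
      h.continuous.continuousOn
    obtain ⟨N, hN⟩ := eventually_atTop.1
      (h.tendsto_atTop.eventually (lt_mem_nhds (h.lt_sPlus ha hb hc p)))
    refine ⟨N - T₁, fun τ' hτ' t ht => (hmax ht).trans_lt (hN _ ?_)⟩
    linarith [ht.1]
  set K : Set (ℝ × ℝ) := (Set.Icc τ M ×ˢ Set.Icc T₁ T₂) ∩ {p | U (p.2 + p.1) ≤ U p.2}
  have hK : IsCompact K := (isCompact_Icc.prod isCompact_Icc).inter_right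
    (isClosed_le (h.continuous.comp (by fun_prop)) (h.continuous.comp (by fun_prop)))
  have hτM : τ ≤ M := by
    by_contra! hcon
    exact absurd (hM τ hcon.le t₁ ht₁) (not_lt.2 hlt₁.le)
  have hKne : K.Nonempty := ⟨(τ, t₁), ⟨⟨⟨le_rfl, hτM⟩, ht₁⟩, hlt₁.le⟩⟩
  obtain ⟨⟨τ', m⟩, ⟨⟨hτ', hm⟩, hle⟩, hmax⟩ := hK.exists_isMaxOn hKne continuous_fst.continuousOn
  simp only [Set.mem_ofPred_eq] at hle hτ' hm
  have hτ'0 : 0 < τ' := hτ.trans_le hτ'.1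
  have hbeyond : ∀ σ, τ' < σ → ∀ t, U t ≤ U (t + σ) := by
    intro σ hσ
    refine key (hτ'0.trans hσ) fun t ht => ?_
    by_contra! hcon
    rcases le_or_gt M σ with h1 | h1
    · exact absurd (hM σ h1 t ht) (not_lt.2 hcon.le)
    · have hmem : (σ, t) ∈ K := ⟨⟨⟨by linarith [hτ'.1], h1.le⟩, ht⟩, hcon.le⟩
      have := hmax hmem
      simp only [Set.mem_ofPred_eq] at this
      linarith
  have hall : ∀ t, U t ≤ U (t + τ') := by
    intro t
    have hcont : Continuous fun σ => U (t + σ) := h.continuous.comp (by fun_prop)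
    refine ge_of_tendsto (hcont.continuousWithinAt (s := Set.Ioi τ') (x := τ')) ?_
    filter_upwards [self_mem_nhdsWithin] with σ hσ using hbeyond σ hσ t
  have heq : U (m + τ') = U m := le_antisymm hle (hall m)
  have hD1 : ∀ t, HasDerivAt (fun t => U (t + τ') - U t) (U' (t + τ') - U' t) t := fun t =>
    ((h.hasDerivAt (t + τ')).comp_add_const t τ').sub (h.hasDerivAt t)
  have hD2 := ((h.hasDerivAt' (m + τ')).comp_add_const m τ').sub (h.hasDerivAt' m)
  have hmin : IsLocalMin (fun t => U (t + τ') - U t) m := .of_forall fun s => by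
    simp only [heq, sub_self]
    linarith [hall s]
  have h0 := hmin.hasDerivAt_eq_zero (hD1 m)
  have h2 := second_deriv_nonneg_of_isLocalMin hD1 hD2 hmin
  have hF := bulkF_neg ha hb hc (h.pos ha hb hc m) (h.lt_sPlus ha hb hc m)
  rw [heq] at h2
  have hexp : Real.exp (2 * m) < Real.exp (2 * (m + τ')) := Real.exp_lt_exp.2 (by linarith)
  nlinarith

theorem hasDerivAt'' (h : LogProfile a b c U U') (t : ℝ) :
    HasDerivAt (fun t => -U' t + 6 * U t + Real.exp (2 * t) * bulkF a b c (U t))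
      (-(-U' t + 6 * U t + Real.exp (2 * t) * bulkF a b c (U t)) + 6 * U' t
        + Real.exp (2 * t) * (2 * bulkF a b c (U t) + fHat a b c (U t) * U' t)) t := by
  have h1 : HasDerivAt (fun t : ℝ => Real.exp (2 * t)) (Real.exp (2 * t) * 2) t := by
    simpa using ((hasDerivAt_id t).const_mul 2).exp
  have h2 := (hasDerivAt_bulkF a b c (U t)).comp t (h.hasDerivAt t)
  refine (((h.hasDerivAt' t).neg.add ((h.hasDerivAt t).const_mul 6)).add
    (h1.mul h2)).congr_deriv ?_
  simp only [Function.comp]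
  ring

theorem deriv_pos (h : LogProfile a b c U U') (ha : 0 < a) (hb : 0 < b) (hc : 0 < c) (t : ℝ) :
    0 < U' t := by
  have hmono : Monotone U := by
    intro s t hst
    rcases hst.eq_or_lt with rfl | hlt
    · exact le_rfl
    · simpa using h.le_shift ha hb hc (sub_pos.2 hlt) s
  have hnn : ∀ t, 0 ≤ U' t := fun t => by
    rw [← (h.hasDerivAt t).deriv]
    exact hmono.deriv_nonneg
  refine lt_of_le_of_ne (hnn t) fun h0 => ?_
  -- a zero of `U'` would be a minimum of `U'`, where `U''' = 2 e^{2t} F(U) < 0`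
  have hmin : IsLocalMin U' t := .of_forall fun s => by rw [← h0]; exact hnn s
  have h1 := hmin.hasDerivAt_eq_zero (h.hasDerivAt' t)
  have h2 := second_deriv_nonneg_of_isLocalMin h.hasDerivAt' (h.hasDerivAt'' t) hmin
  have hF := bulkF_neg ha hb hc (h.pos ha hb hc t) (h.lt_sPlus ha hb hc t)
  rw [h1, ← h0] at h2
  nlinarith [Real.exp_pos (2 * t)]

/-! ### Lower barriers for the profile -/

/-- A lower bound for the profile by `σ (1 - K r^{-1/2})`. It holds as soon as this function, and
all its dilations to the right, are subsolutions. In terms of `z = r^{1/2} (1 - u / σ)` the claim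
reads `z ≤ K`, and the hypothesis `hK`, with `y = z r^{-1/2} = 1 - u / σ`, contradicts the equation
at a maximum of `z` with a larger value. -/
theorem barrier (h : LogProfile a b c U U') (ha : 0 < a) (hb : 0 < b) (hc : 0 < c)
    {σ K : ℝ} (hσ : 0 < σ) (hσ' : σ < sPlus a b c) (hK0 : 0 < K)
    (hK : ∀ y, 0 < y → y < 1 → 6 * (1 - y) + K ^ 4 / y ^ 4 * (1 - y) * f a b c (σ * (1 - y)) < y / 4)
    (t : ℝ) : σ * (1 - K * Real.exp (-(t / 2))) ≤ U t := by
  set z : ℝ → ℝ := fun t => Real.exp (t / 2) * (1 - U t / σ)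
  set z' : ℝ → ℝ := fun t => z t / 2 - Real.exp (t / 2) * (U' t / σ)
  have hexp : ∀ t : ℝ, HasDerivAt (fun t : ℝ => Real.exp (t / 2)) (Real.exp (t / 2) / 2) t :=
    fun t => by simpa [div_eq_mul_inv] using ((hasDerivAt_id t).div_const 2).exp
  have hz1 : ∀ t, HasDerivAt z (z' t) t := fun t => by
    refine ((hexp t).mul (((h.hasDerivAt t).div_const σ).const_sub 1)).congr_deriv ?_
    simp only [z', z]; ring
  have hz2 : ∀ t, HasDerivAt z' (z' t / 2 - (Real.exp (t / 2) / 2 * (U' t / σ)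
      + Real.exp (t / 2) * ((-U' t + 6 * U t + Real.exp (2 * t) * bulkF a b c (U t)) / σ))) t :=
    fun t => ((hz1 t).div_const 2).sub ((hexp t).mul ((h.hasDerivAt' t).div_const σ))
  have hzle : z t ≤ K := by
    by_contra! hlt
    have hbot : Tendsto z atBot (𝓝 0) := by
      have h1 : Tendsto (fun t : ℝ => Real.exp (t / 2)) atBot (𝓝 0) :=
        Real.tendsto_exp_atBot.comp (tendsto_id.atBot_div_const two_pos)
      have h2 := h1.mul ((h.tendsto_atBot.div_const σ).const_sub 1)
      simpa using h2
    have htop : ∀ᶠ t in atTop, z t ≤ 0 := by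
      filter_upwards [h.tendsto_atTop.eventually (lt_mem_nhds hσ')] with s hs
      refine mul_nonpos_of_nonneg_of_nonpos (Real.exp_pos _).le ?_
      rw [sub_nonpos, one_le_div hσ]
      exact hs.le
    obtain ⟨m, hm⟩ := exists_forall_le_of_tendsto
      (continuous_iff_continuousAt.2 fun t => (hz1 t).continuousAt) (t₁ := t)
      ((hbot.eventually (gt_mem_nhds (hK0.trans hlt))).mono fun _ h => h.le)
      (htop.mono fun _ h => h.trans (hK0.trans hlt).le)
    have hmax : IsLocalMax z m := .of_forall hm
    have h0 := hmax.hasDerivAt_eq_zero (hz1 m)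
    have h2 := second_deriv_nonpos_of_isLocalMax hz1 (hz2 m) hmax
    have hzm : K < z m := hlt.trans_le (hm t)
    set e := Real.exp (m / 2)
    have he : 0 < e := Real.exp_pos _
    have hU := h.pos ha hb hc m
    set y := 1 - U m / σ
    have hzy : z m = e * y := rfl
    have hy0 : 0 < y := (pos_iff_pos_of_mul_pos (by rw [← hzy]; linarith : 0 < e * y)).1 he
    have hy1 : y < 1 := by
      have : 0 < U m / σ := by positivity
      simp only [y]; linarith
    have hUy : U m = σ * (1 - y) := by simp only [y]; field_simp; ring
    have hU1 : U' m = σ * (y / 2) := by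
      have h3 : e * y / 2 - e * (U' m / σ) = 0 := by rw [← h0, ← hzy]
      have h4 : e * (y / 2 - U' m / σ) = 0 := by linarith
      have h5 : y / 2 - U' m / σ = 0 := (mul_eq_zero.1 h4).resolve_left he.ne'
      have h6 : U' m / σ = y / 2 := by linarith
      rw [div_eq_iff hσ.ne'] at h6
      linarith
    have hexp4 : Real.exp (2 * m) = e ^ 4 := by
      rw [← Real.exp_nat_mul]; congr 1; push_cast; ring
    rw [h0, hU1, hexp4, bulkF_eq, hUy] at h2
    have h3 : e / 2 * (σ * (y / 2) / σ) + e * ((-(σ * (y / 2)) + 6 * (σ * (1 - y))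
        + e ^ 4 * (σ * (1 - y) * f a b c (σ * (1 - y)))) / σ)
        = e * (6 * (1 - y) + e ^ 4 * (1 - y) * f a b c (σ * (1 - y)) - y / 4) := by
      field_simp; ring
    rw [h3] at h2
    have h4 : 0 ≤ e * (6 * (1 - y) + e ^ 4 * (1 - y) * f a b c (σ * (1 - y)) - y / 4) := by
      linarith
    have h5 : 0 ≤ 6 * (1 - y) + e ^ 4 * (1 - y) * f a b c (σ * (1 - y)) - y / 4 :=
      nonneg_of_mul_nonneg_right h4 he
    have h6 : K ^ 4 / y ^ 4 ≤ e ^ 4 := by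
      rw [div_le_iff₀ (by positivity), ← mul_pow, ← hzy]
      gcongr
    have h7 : f a b c (σ * (1 - y)) < 0 := by
      rw [← hUy]
      exact f_neg ha hb hc hU.le (h.lt_sPlus ha hb hc m)
    have h8 : (1 - y) * f a b c (σ * (1 - y)) ≤ 0 :=
      mul_nonpos_of_nonneg_of_nonpos (by linarith) h7.le
    have := hK y hy0 hy1
    nlinarith
  have h1 : Real.exp (-(t / 2)) * Real.exp (t / 2) = 1 := by rw [← Real.exp_add]; simp
  have h2 : 1 - U t / σ ≤ K * Real.exp (-(t / 2)) := by
    have := mul_le_mul_of_nonneg_left hzle (Real.exp_pos (-(t / 2))).le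
    simp only [z] at this
    rw [← mul_assoc, h1, one_mul] at this
    linarith
  have h3 : 1 - K * Real.exp (-(t / 2)) ≤ U t / σ := by linarith
  rw [le_div_iff₀ hσ] at h3
  linarith

end LogProfile

/-! ### Products of Sobolev functions with smooth fields -/

theorem continuous_integral_translate_mul {f g : E3 → ℝ} (hf : MemLp f 2) (hg : MemLp g 2) :
    Continuous fun y => ∫ x, f (x - y) * g x := by
  have : Fact ((2 : ℝ≥0∞) ≠ ⊤) := ⟨by norm_num⟩
  have h1 : Continuous fun y : E3 =>
      inner ℝ (hg.toLp g) ((DomAddAct.mk (-y)) +ᵥ (hf.toLp f)) := by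
    refine continuous_const.inner ?_
    have h2 : Continuous fun y : E3 => (DomAddAct.mk (-y) : E3ᵈᵃᵃ) :=
      DomAddAct.continuous_mk.comp continuous_neg
    exact h2.vadd continuous_const
  refine h1.congr fun y => ?_
  rw [DomAddAct.mk_vadd_toLp, L2.inner_def]
  refine integral_congr_ae ?_
  have h5 : (((hf.comp_measurePreserving (measurePreserving_vadd (-y) volume)).toLp
      (fun x => f (-y +ᵥ x)) : Lp ℝ 2 volume) : E3 → ℝ) =ᵐ[volume] fun x => f (-y +ᵥ x) :=
    MemLp.coeFn_toLp _
  filter_upwards [hg.coeFn_toLp, h5] with x h3 h4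
  rw [h3, h4]
  simp [neg_add_eq_sub]

theorem integrable_prod_mollify {f g ρ : E3 → ℝ} (hf : MemLp f 2) (hg : MemLp g 2)
    (hρ : Integrable ρ) :
    Integrable (fun p : E3 × E3 => ρ p.2 * f (p.1 - p.2) * g p.1) (volume.prod volume) := by
  have hm : AEStronglyMeasurable (fun p : E3 × E3 => ρ p.2 * f (p.1 - p.2) * g p.1)
      (volume.prod volume) :=
    (AEStronglyMeasurable.convolution_integrand (ContinuousLinearMap.mul ℝ ℝ)
      hρ.aestronglyMeasurable hf.aestronglyMeasurable).mul hg.aestronglyMeasurable.comp_fst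
  have hft : ∀ t, MemLp (fun x => f (x - t)) 2 := fun t =>
    hf.comp_measurePreserving (measurePreserving_sub_right volume t)
  have hint : ∀ t, Integrable fun x => f (x - t) * g x := fun t =>
    (hft t).integrable_mul hg
  rw [integrable_prod_iff' hm]
  refine ⟨.of_forall fun t => ?_, ?_⟩
  · simpa only [mul_assoc] using (hint t).const_mul (ρ t)
  · refine Integrable.mono' (g := fun t => |ρ t| * (∫ x, (f x ^ 2 + g x ^ 2)))
      (hρ.abs.mul_const _) hm.norm.prod_swap.integral_prod_right' (.of_forall fun t => ?_)
    have h1 : ∫ x, ‖ρ t * f (x - t) * g x‖ = |ρ t| * ∫ x, |f (x - t) * g x| := by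
      rw [← integral_const_mul]
      simp [abs_mul, mul_assoc]
    have h2 : ∫ x, |f (x - t) * g x| ≤ ∫ x, (f x ^ 2 + g x ^ 2) := by
      calc ∫ x, |f (x - t) * g x| ≤ ∫ x, (f (x - t) ^ 2 + g x ^ 2) := by
            refine integral_mono (hint t).abs ((hft t).integrable_sq.add hg.integrable_sq)
              fun x => ?_
            exact abs_le.2 ⟨by nlinarith [sq_nonneg (f (x - t) + g x)],
              by nlinarith [sq_nonneg (f (x - t) - g x)]⟩
        _ = ∫ x, (f x ^ 2 + g x ^ 2) := by
            rw [integral_add (hft t).integrable_sq hg.integrable_sq,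
              integral_add hf.integrable_sq hg.integrable_sq,
              integral_sub_right_eq_self (fun x => f x ^ 2) t]
    have h3 : 0 ≤ ∫ x, |f (x - t) * g x| := integral_nonneg fun _ => abs_nonneg _
    rw [h1, Real.norm_of_nonneg (by positivity)]
    gcongr

/-- Mollifications converge weakly in `L²`. -/
theorem tendsto_integral_mollify_mul {f g : E3 → ℝ} (hf : MemLp f 2) (hg : MemLp g 2)
    {φ : ℕ → ContDiffBump (0 : E3)} (hφ : Tendsto (fun n => (φ n).rOut) atTop (𝓝 0)) :
    Tendsto (fun n => ∫ x, (convolution f ((φ n).normed volume) (ContinuousLinearMap.mul ℝ ℝ)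
      volume x) * g x) atTop (𝓝 (∫ x, f x * g x)) := by
  have hA := continuous_integral_translate_mul hf hg
  have hlim := ContDiffBump.convolution_tendsto_right_of_continuous (μ := (volume : Measure E3)) hφ
    (hA.comp continuous_neg) 0
  simp only [Function.comp, neg_zero, sub_zero] at hlim
  refine hlim.congr fun n => ?_
  have hint := integrable_prod_mollify hf hg ((φ n).integrable_normed (μ := volume))
  rw [convolution_def]
  calc ∫ t, (ContinuousLinearMap.lsmul ℝ ℝ) ((φ n).normed volume t)
        (∫ x, f (x - -(0 - t)) * g x)
      = ∫ t, ∫ x, (φ n).normed volume t * f (x - t) * g x := by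
        refine integral_congr_ae (.of_forall fun t => ?_)
        simp only [zero_sub, neg_neg, ContinuousLinearMap.lsmul_apply, smul_eq_mul]
        rw [← integral_const_mul]
        simp only [mul_assoc]
    _ = ∫ x, ∫ t, (φ n).normed volume t * f (x - t) * g x := by
        rw [integral_integral_swap]
        exact hint.swap
    _ = _ := by
        refine integral_congr_ae (.of_forall fun x => ?_)
        simp only
        rw [integral_mul_const, convolution_mul_swap]
        simp only [mul_comm]

theorem MemLp.mul_bounded_continuous {f : E3 → ℝ} (hf : MemLp f 2) {Y : E3 → ℝ}
    (hY : Continuous Y) (hYc : HasCompactSupport Y) : MemLp (fun x => f x * Y x) 2 := by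
  obtain ⟨C, hC⟩ := hY.bounded_above_of_compact_support hYc
  have := MemLp.of_le_mul (c := C) (f := f * Y) hf
    (hf.aestronglyMeasurable.mul hY.aestronglyMeasurable)
    (.of_forall fun x => by
      simp only [Pi.mul_apply, norm_mul]
      rw [mul_comm]
      exact mul_le_mul_of_nonneg_right (hC x) (norm_nonneg _))
  exact this

/-- The weak gradient of a mollification is the mollification of the weak gradient. -/
theorem HasWeakGradient.hasFDerivAt_mollify {w : E3 → ℝ} {g : E3 → E3}
    (hg : HasWeakGradient w g) (hw : LocallyIntegrable w) {ρ : E3 → ℝ} (hρ : ContDiff ℝ ∞ ρ)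
    (hρc : HasCompactSupport ρ) (x : E3) (j : Fin 3) :
    fderiv ℝ (convolution w ρ (ContinuousLinearMap.mul ℝ ℝ) volume) x (EuclideanSpace.single j 1)
      = convolution (fun y => g y j) ρ (ContinuousLinearMap.mul ℝ ℝ) volume x := by
  have h1 := hρc.hasFDerivAt_convolution_right (ContinuousLinearMap.mul ℝ ℝ) hw
    (hρ.of_le (by exact_mod_cast le_top)) x
  rw [h1.fderiv, convolution_precompR_apply _ hw (hρc.fderiv ℝ)
    (hρ.continuous_fderiv (by simp)), convolution_mul, convolution_mul]
  have hdiff : ∀ t, HasFDerivAt (fun t => ρ (x - t)) (-(fderiv ℝ ρ (x - t))) t := fun t => by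
    have h2 := (hρ.differentiable (by simp) (x - t)).hasFDerivAt.comp t
      ((hasFDerivAt_id t).const_sub x)
    exact h2.congr_fderiv (by ext; simp)
  have h3 := hg (fun t => ρ (x - t)) (hρ.comp (contDiff_const.sub contDiff_id))
    (hρc.comp_homeomorph (Homeomorph.subLeft x)) j
  simp only [(hdiff _).fderiv, neg_apply, mul_neg, integral_neg] at h3
  exact neg_injective h3

/-- The product rule `∂ⱼ(w²) = 2 w ∂ⱼw`, in the weak sense, for `w ∈ H¹`. -/
theorem MemH1.integral_sq_mul_fderiv {w : E3 → ℝ} {g : E3 → E3} (h : MemH1 w g) {Y : E3 → ℝ}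
    (hY : ContDiff ℝ ∞ Y) (hYc : HasCompactSupport Y) (j : Fin 3) :
    ∫ x, w x * (w x * fderiv ℝ Y x (EuclideanSpace.single j 1))
      = -(2 * ∫ x, w x * (g x j * Y x)) := by
  have hgj : MemLp (fun x => g x j) 2 := by
    refine h.memLp_grad.of_le
      ((EuclideanSpace.proj j : E3 →L[ℝ] ℝ).continuous.comp_aestronglyMeasurable
        h.memLp_grad.aestronglyMeasurable) (.of_forall fun x => ?_)
    exact PiLp.norm_apply_le (g x) j
  have hwl : LocallyIntegrable w := h.memLp.locallyIntegrable (by norm_num)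
  have hgl : LocallyIntegrable (fun x => g x j) := hgj.locallyIntegrable (by norm_num)
  obtain ⟨φ, hφ⟩ : ∃ φ : ℕ → ContDiffBump (0 : E3), Tendsto (fun n => (φ n).rOut) atTop (𝓝 0) := by
    refine ⟨fun n => ⟨1 / (n + 1) / 2, 1 / (n + 1), by positivity, half_lt_self (by positivity)⟩, ?_⟩
    exact tendsto_one_div_add_atTop_nhds_zero_nat
  have hdY : Continuous fun x => fderiv ℝ Y x (EuclideanSpace.single j 1) :=
    (hY.continuous_fderiv (by simp)).clm_apply continuous_const
  have hdYc : HasCompactSupport fun x => fderiv ℝ Y x (EuclideanSpace.single j 1) :=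
    hYc.fderiv_apply ℝ _
  have l1 := tendsto_integral_mollify_mul hgj (MemLp.mul_bounded_continuous h.memLp hY.continuous hYc) hφ
  have l2 := tendsto_integral_mollify_mul h.memLp (MemLp.mul_bounded_continuous h.memLp hdY hdYc) hφ
  have l3 := tendsto_integral_mollify_mul h.memLp (MemLp.mul_bounded_continuous hgj hY.continuous hYc) hφ
  have key : ∀ n, (∫ x, (convolution (fun x => g x j) ((φ n).normed volume)
        (ContinuousLinearMap.mul ℝ ℝ) volume x) * (w x * Y x))
      + (∫ x, (convolution w ((φ n).normed volume) (ContinuousLinearMap.mul ℝ ℝ) volume x)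
        * (w x * fderiv ℝ Y x (EuclideanSpace.single j 1)))
      = -∫ x, (convolution w ((φ n).normed volume) (ContinuousLinearMap.mul ℝ ℝ) volume x)
        * (g x j * Y x) := by
    intro n
    set ρ := (φ n).normed (volume : Measure E3)
    have hρ : ContDiff ℝ ∞ ρ := (φ n).contDiff_normed
    have hρc : HasCompactSupport ρ := (φ n).hasCompactSupport_normed
    set m := convolution w ρ (ContinuousLinearMap.mul ℝ ℝ) volume
    have hm : ContDiff ℝ ∞ m := hρc.contDiff_convolution_right _ hwl hρ
    have hmg : ∀ x, fderiv ℝ m x (EuclideanSpace.single j 1)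
        = convolution (fun y => g y j) ρ (ContinuousLinearMap.mul ℝ ℝ) volume x :=
      fun x => h.weakGradient.hasFDerivAt_mollify hwl hρ hρc x j
    have hmgc : Continuous
        (convolution (fun y => g y j) ρ (ContinuousLinearMap.mul ℝ ℝ) volume) :=
      (hρc.contDiff_convolution_right (n := 0) _ hgl (hρ.of_le (by simp))).continuous
    have h1 := h.weakGradient (fun x => m x * Y x) (hm.mul hY) hYc.mul_left j
    have h2 : ∀ x, fderiv ℝ (fun x => m x * Y x) x (EuclideanSpace.single j 1)
        = m x * fderiv ℝ Y x (EuclideanSpace.single j 1)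
          + convolution (fun y => g y j) ρ (ContinuousLinearMap.mul ℝ ℝ) volume x * Y x := by
      intro x
      rw [fderiv_fun_mul (hm.differentiable (by simp) x) (hY.differentiable (by simp) x)]
      simp only [add_apply, smul_apply, smul_eq_mul, hmg]
      ring
    simp only [h2] at h1
    have i1 : Integrable fun x => convolution (fun y => g y j) ρ (ContinuousLinearMap.mul ℝ ℝ)
        volume x * (w x * Y x) := by
      have : MemLp (fun x => convolution (fun y => g y j) ρ (ContinuousLinearMap.mul ℝ ℝ)
        volume x * Y x) 2 := (hmgc.mul hY.continuous).memLp_of_hasCompactSupport hYc.mul_left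
      exact (h.memLp.integrable_mul this).congr (.of_forall fun x => by
        simp only [Pi.mul_apply]; ring)
    have i2 : Integrable fun x => m x * (w x * fderiv ℝ Y x (EuclideanSpace.single j 1)) := by
      have : MemLp (fun x => m x * fderiv ℝ Y x (EuclideanSpace.single j 1)) 2 :=
        (hm.continuous.mul hdY).memLp_of_hasCompactSupport hdYc.mul_left
      exact (h.memLp.integrable_mul this).congr (.of_forall fun x => by
        simp only [Pi.mul_apply]; ring)
    rw [← integral_add i1 i2]
    have e1 : ∀ x, convolution (fun y => g y j) ρ (ContinuousLinearMap.mul ℝ ℝ) volume x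
        * (w x * Y x) + m x * (w x * fderiv ℝ Y x (EuclideanSpace.single j 1))
        = w x * (m x * fderiv ℝ Y x (EuclideanSpace.single j 1)
          + convolution (fun y => g y j) ρ (ContinuousLinearMap.mul ℝ ℝ) volume x * Y x) :=
      fun x => by ring
    have e2 : ∀ x, m x * (g x j * Y x) = g x j * (m x * Y x) := fun x => by ring
    simp only [e1, e2]
    exact h1
  have := tendsto_nhds_unique ((l1.add l2).congr key) l3.neg
  have e3 : ∫ x, g x j * (w x * Y x) = ∫ x, w x * (g x j * Y x) :=
    integral_congr_ae (.of_forall fun x => by simp only; ring)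
  rw [e3] at this
  linarith

/-! ### The spherical frame -/

/-- The radial unit vector `x / |x|` off the axis, as it enters `radialDeriv`. -/
def radialUnit (x : E3) : E3 := frameN (polarAngle x) (azimuth x)

/-- The unit vector in the direction of increasing `θ`, as it enters `polarDeriv`. -/
def polarUnit (x : E3) : E3 := frameM (polarAngle x) (azimuth x)

/-- The squared distance `x₁² + x₂² = r² sin² θ` to the axis. -/
def axisSq (x : E3) : ℝ := x 0 ^ 2 + x 1 ^ 2

theorem axisSq_nonneg (x : E3) : 0 ≤ axisSq x := by unfold axisSq; positivity

theorem norm_sq_eq (x : E3) : ‖x‖ ^ 2 = axisSq x + x 2 ^ 2 := by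
  rw [EuclideanSpace.real_norm_sq_eq, Fin.sum_univ_three, axisSq]

theorem norm_pos_of_axisSq_pos {x : E3} (hx : 0 < axisSq x) : 0 < ‖x‖ := by
  have : 0 < ‖x‖ ^ 2 := by rw [norm_sq_eq]; positivity
  exact lt_of_le_of_ne (norm_nonneg x) fun h => by simp [← h] at this

theorem contDiff_axisSq : ContDiff ℝ ∞ axisSq := by
  unfold axisSq
  fun_prop

theorem hasFDerivAt_axisSq (x : E3) :
    HasFDerivAt axisSq ((2 * x 0) • (EuclideanSpace.proj 0 : E3 →L[ℝ] ℝ)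
      + (2 * x 1) • (EuclideanSpace.proj 1 : E3 →L[ℝ] ℝ)) x := by
  have h0 := ((EuclideanSpace.proj 0 : E3 →L[ℝ] ℝ).hasFDerivAt (x := x)).pow 2
  have h1 := ((EuclideanSpace.proj 1 : E3 →L[ℝ] ℝ).hasFDerivAt (x := x)).pow 2
  refine (h0.add h1).congr_fderiv ?_
  ext v
  simp

theorem ae_axisSq_pos : ∀ᵐ x : E3, 0 < axisSq x := by
  have h : volume ((EuclideanSpace.proj (0 : Fin 3) : E3 →L[ℝ] ℝ).toLinearMap.ker : Set E3) = 0 := by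
    refine Measure.addHaar_submodule _ _ fun htop => ?_
    rw [LinearMap.ker_eq_top] at htop
    have := congrArg (fun ℓ : E3 →ₗ[ℝ] ℝ => ℓ (EuclideanSpace.single 0 1)) htop
    simp at this
  rw [ae_iff]
  refine measure_mono_null (fun x hx => ?_) h
  have h1 : axisSq x ≤ 0 := not_lt.1 hx
  have h2 : x 0 ^ 2 ≤ 0 := by unfold axisSq at h1; nlinarith [sq_nonneg (x 1)]
  have h3 : x 0 = 0 := by nlinarith
  simpa using h3

theorem cos_polarAngle (x : E3) : Real.cos (polarAngle x) = x 2 / ‖x‖ := by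
  have h : |x 2| ≤ ‖x‖ := by simpa using PiLp.norm_apply_le x 2
  refine Real.cos_arccos ?_ ?_
  · rcases (norm_nonneg x).eq_or_lt with h0 | h0
    · rw [← h0]; simp
    · rw [le_div_iff₀ h0]; linarith [neg_abs_le (x 2)]
  · exact div_le_one_of_le₀ ((le_abs_self _).trans h) (norm_nonneg _)

theorem sin_polarAngle (x : E3) (hx : 0 < axisSq x) :
    Real.sin (polarAngle x) = Real.sqrt (axisSq x) / ‖x‖ := by
  have hr := norm_pos_of_axisSq_pos hx
  have h1 := norm_sq_eq x
  unfold polarAngle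
  rw [Real.sin_arccos, ← Real.sqrt_sq hr.le, ← Real.sqrt_div (axisSq_nonneg x), Real.sqrt_sq hr.le]
  congr 1
  field_simp
  linarith

theorem sin_polarAngle_sq (x : E3) (hx : 0 < axisSq x) :
    Real.sin (polarAngle x) ^ 2 = axisSq x / ‖x‖ ^ 2 := by
  rw [sin_polarAngle x hx, div_pow, Real.sq_sqrt hx.le]

theorem cos_sin_azimuth (x : E3) (hx : 0 < axisSq x) :
    Real.cos (azimuth x) = x 0 / Real.sqrt (axisSq x) ∧
      Real.sin (azimuth x) = x 1 / Real.sqrt (axisSq x) := by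
  have hz : ‖(⟨x 0, x 1⟩ : ℂ)‖ = Real.sqrt (axisSq x) := by
    rw [Complex.norm_def, Complex.normSq_apply, axisSq]
    congr 1; simp; ring
  have hz0 : (⟨x 0, x 1⟩ : ℂ) ≠ 0 := by
    rw [← norm_ne_zero_iff, hz]
    exact (Real.sqrt_pos.2 hx).ne'
  unfold azimuth
  rw [Complex.cos_arg hz0, Complex.sin_arg, hz]
  exact ⟨rfl, rfl⟩

theorem radialUnit_eq {x : E3} (hx : 0 < axisSq x) : radialUnit x = (1 / ‖x‖) • x := by
  have hr := norm_pos_of_axisSq_pos hx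
  have hs := Real.sqrt_pos.2 hx
  obtain ⟨h1, h2⟩ := cos_sin_azimuth x hx
  ext j
  unfold radialUnit frameN
  rw [h1, h2, sin_polarAngle x hx, cos_polarAngle]
  fin_cases j <;> simp <;> field_simp

theorem polarUnit_eq {x : E3} (hx : 0 < axisSq x) :
    polarUnit x = !₂[x 2 * x 0 / (‖x‖ * Real.sqrt (axisSq x)),
      x 2 * x 1 / (‖x‖ * Real.sqrt (axisSq x)), -Real.sqrt (axisSq x) / ‖x‖] := by
  have hr := norm_pos_of_axisSq_pos hx
  have hs := Real.sqrt_pos.2 hx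
  obtain ⟨h1, h2⟩ := cos_sin_azimuth x hx
  ext j
  unfold polarUnit frameM
  rw [h1, h2, sin_polarAngle x hx, cos_polarAngle]
  fin_cases j <;> simp <;> field_simp

theorem norm_radialUnit (x : E3) : ‖radialUnit x‖ = 1 := by
  have h : ‖radialUnit x‖ ^ 2 = 1 := by
    rw [EuclideanSpace.real_norm_sq_eq, Fin.sum_univ_three]
    simp only [radialUnit, frameN, PiLp.toLp_apply, Matrix.cons_val]
    nlinarith [Real.sin_sq_add_cos_sq (azimuth x), Real.sin_sq_add_cos_sq (polarAngle x)]
  exact (pow_eq_one_iff_of_nonneg (norm_nonneg _) two_ne_zero).1 h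

theorem norm_polarUnit (x : E3) : ‖polarUnit x‖ = 1 := by
  have h : ‖polarUnit x‖ ^ 2 = 1 := by
    rw [EuclideanSpace.real_norm_sq_eq, Fin.sum_univ_three]
    simp only [polarUnit, frameM, PiLp.toLp_apply, Matrix.cons_val]
    nlinarith [Real.sin_sq_add_cos_sq (azimuth x), Real.sin_sq_add_cos_sq (polarAngle x)]
  exact (pow_eq_one_iff_of_nonneg (norm_nonneg _) two_ne_zero).1 h

theorem measurable_polarAngle : Measurable polarAngle := by
  unfold polarAngle
  have h : Measurable fun x : E3 => x 2 := (EuclideanSpace.proj (2 : Fin 3) : E3 →L[ℝ] ℝ).measurable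
  exact Real.continuous_arccos.measurable.comp (h.div measurable_norm)

theorem measurable_azimuth : Measurable azimuth := by
  unfold azimuth
  have h : ∀ j : Fin 3, Measurable fun x : E3 => x j := fun j =>
    (EuclideanSpace.proj j : E3 →L[ℝ] ℝ).measurable
  have h2 : Measurable fun x : E3 => (⟨x 0, x 1⟩ : ℂ) :=
    Complex.measurableEquivRealProd.symm.measurable.comp ((h 0).prodMk (h 1))
  exact Complex.measurable_arg.comp h2

theorem measurable_of_uncurry {F : ℝ → ℝ → E3} (hF : Measurable fun p : ℝ × ℝ => F p.1 p.2)
    {α β : E3 → ℝ} (hα : Measurable α) (hβ : Measurable β) : Measurable fun x => F (α x) (β x) :=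
  hF.comp (hα.prodMk hβ)

theorem measurable_radialUnit : Measurable radialUnit := by
  have h : Continuous fun p : ℝ × ℝ => frameN p.1 p.2 := by
    have h1 : Continuous fun p : ℝ × ℝ => (![Real.sin p.1 * Real.cos p.2,
        Real.sin p.1 * Real.sin p.2, Real.cos p.1] : Fin 3 → ℝ) := by
      refine continuous_pi fun j => ?_
      fin_cases j <;> simp <;> fun_prop
    exact (PiLp.continuous_toLp 2 fun _ : Fin 3 => ℝ).comp h1
  exact measurable_of_uncurry h.measurable measurable_polarAngle measurable_azimuth

theorem measurable_polarUnit : Measurable polarUnit := by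
  have h : Continuous fun p : ℝ × ℝ => frameM p.1 p.2 := by
    have h1 : Continuous fun p : ℝ × ℝ => (![Real.cos p.1 * Real.cos p.2,
        Real.cos p.1 * Real.sin p.2, -Real.sin p.1] : Fin 3 → ℝ) := by
      refine continuous_pi fun j => ?_
      fin_cases j <;> simp <;> fun_prop
    exact (PiLp.continuous_toLp 2 fun _ : Fin 3 => ℝ).comp h1
  exact measurable_of_uncurry h.measurable measurable_polarAngle measurable_azimuth

/-! ### Nonnegativity from a supersolution -/

/-- The divergence of a vector field on `ℝ³`. -/
def divergence (X : E3 → E3) (x : E3) : ℝ := ∑ j, fderiv ℝ X x (EuclideanSpace.single j 1) j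

theorem sum_coord_mul (ℓ : E3 →L[ℝ] ℝ) (v : E3) :
    ∑ j, v j * ℓ (EuclideanSpace.single j 1) = ℓ v := by
  have h : v = ∑ j, v j • EuclideanSpace.single j (1 : ℝ) := by
    ext i
    simp [Finset.sum_apply, Pi.single_apply]
  conv_rhs => rw [h]
  simp

theorem inner_eq_sum (u v : E3) : inner ℝ u v = ∑ j, u j * v j := by
  rw [PiLp.inner_apply]
  exact Finset.sum_congr rfl fun j _ => by simp [mul_comm]

/-- The weak divergence theorem `∫ div (w² X) = 0`, for `w ∈ H¹` and a compactly supported field. -/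
theorem MemH1.integral_divergence_sq {w : E3 → ℝ} {g : E3 → E3} (h : MemH1 w g) {Y : E3 → E3}
    (hY : ContDiff ℝ ∞ Y) (hYc : HasCompactSupport Y) :
    Integrable (fun x => w x ^ 2 * divergence Y x + 2 * w x * inner ℝ (g x) (Y x)) ∧
      ∫ x, (w x ^ 2 * divergence Y x + 2 * w x * inner ℝ (g x) (Y x)) = 0 := by
  have hYj : ∀ j : Fin 3, ContDiff ℝ ∞ fun x => Y x j := fun j => by fun_prop
  have hYjc : ∀ j : Fin 3, HasCompactSupport fun x => Y x j := fun j =>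
    hYc.comp_left (g := fun v : E3 => v j) rfl
  have hd : ∀ j x, fderiv ℝ (fun x => Y x j) x (EuclideanSpace.single j 1)
      = fderiv ℝ Y x (EuclideanSpace.single j 1) j := fun j x => by
    have h1 := (EuclideanSpace.proj j : E3 →L[ℝ] ℝ).hasFDerivAt.comp x
      (hY.differentiable (by simp) x).hasFDerivAt
    exact congrArg (fun ℓ : E3 →L[ℝ] ℝ => ℓ (EuclideanSpace.single j 1)) h1.fderiv
  have hgj : ∀ j : Fin 3, MemLp (fun x => g x j) 2 := fun j => by
    refine h.memLp_grad.of_le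
      ((EuclideanSpace.proj j : E3 →L[ℝ] ℝ).continuous.comp_aestronglyMeasurable
        h.memLp_grad.aestronglyMeasurable) (.of_forall fun x => ?_)
    exact PiLp.norm_apply_le (g x) j
  have i1 : ∀ j, Integrable fun x =>
      w x * (w x * fderiv ℝ (fun x => Y x j) x (EuclideanSpace.single j 1)) := fun j =>
    h.memLp.integrable_mul (MemLp.mul_bounded_continuous h.memLp
      (((hYj j).continuous_fderiv (by simp)).clm_apply continuous_const)
      ((hYjc j).fderiv_apply ℝ _))
  have i2 : ∀ j, Integrable fun x => w x * (g x j * Y x j) := fun j =>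
    h.memLp.integrable_mul (MemLp.mul_bounded_continuous (hgj j) (hYj j).continuous (hYjc j))
  have e : ∀ x, w x ^ 2 * divergence Y x + 2 * w x * inner ℝ (g x) (Y x)
      = ∑ j, (w x * (w x * fderiv ℝ (fun x => Y x j) x (EuclideanSpace.single j 1))
        + 2 * (w x * (g x j * Y x j))) := fun x => by
    simp only [hd, divergence, inner_eq_sum, Finset.sum_add_distrib, Finset.mul_sum]
    congr 1 <;> exact Finset.sum_congr rfl fun j _ => by ring
  simp only [e]
  have i3 : ∀ j, Integrable fun x =>
      w x * (w x * fderiv ℝ (fun x => Y x j) x (EuclideanSpace.single j 1))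
        + 2 * (w x * (g x j * Y x j)) := fun j => (i1 j).add ((i2 j).const_mul 2)
  refine ⟨integrable_finsetSum _ fun j _ => i3 j, ?_⟩
  rw [integral_finsetSum _ fun j _ => i3 j]
  refine Finset.sum_eq_zero fun j _ => ?_
  rw [integral_add (i1 j) ((i2 j).const_mul 2), h.integral_sq_mul_fderiv (hYj j) (hYjc j) j,
    integral_const_mul]
  ring

/-- The density of the quadratic form with potential `V`, evaluated at `χ w` for a smooth cutoff
`χ`, where `w` has gradient field `g`. Only the radial and polar components of the gradient are
taken into account. -/
def cutoffDensity (V : E3 → ℝ) (w : E3 → ℝ) (g : E3 → E3) (χ : E3 → ℝ) (x : E3) : ℝ :=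
  (χ x * inner ℝ (g x) (radialUnit x) + w x * fderiv ℝ χ x (radialUnit x)) ^ 2
    + (χ x * inner ℝ (g x) (polarUnit x) + w x * fderiv ℝ χ x (polarUnit x)) ^ 2
    + V x * (χ x * w x) ^ 2

/-- Let `X` be a vector field on the open set `Ω`, in the span of the frame vectors, with
`div X + |X|² ≤ V`. For `X = ∇Φ / Φ` this says that `Φ` is a positive supersolution of `-Δ + V`.
Then the quadratic form with potential `V` is nonnegative on functions supported in `Ω`: its
density dominates `div ((χ w)² X)`. -/
theorem MemH1.integral_cutoffDensity_nonneg {w : E3 → ℝ} {g : E3 → E3} (h : MemH1 w g)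
    {Ω : Set E3} (hΩ : IsOpen Ω) {X : E3 → E3} (hX : ContDiffOn ℝ ∞ X Ω) {V : E3 → ℝ}
    (hV : ∀ᵐ x, x ∈ Ω → ∃ α β : ℝ, X x = α • radialUnit x + β • polarUnit x ∧
      divergence X x + α ^ 2 + β ^ 2 ≤ V x)
    {χ : E3 → ℝ} (hχ : ContDiff ℝ ∞ χ) (hχc : HasCompactSupport χ) (hχΩ : tsupport χ ⊆ Ω)
    (hint : Integrable (cutoffDensity V w g χ)) :
    0 ≤ ∫ x, cutoffDensity V w g χ x := by
  set Y : E3 → E3 := fun x => (χ x ^ 2) • X x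
  have hsub : tsupport Y ⊆ tsupport χ := by
    refine closure_mono fun x hx => ?_
    contrapose! hx
    rw [Function.notMem_support] at hx
    simp [Y, hx]
  have hY : ContDiff ℝ ∞ Y := by
    refine contDiff_iff_contDiffAt.2 fun x => ?_
    by_cases hx : x ∈ tsupport Y
    · exact (hχ.contDiffAt.pow 2).smul (hX.contDiffAt (hΩ.mem_nhds (hχΩ (hsub hx))))
    · exact contDiffAt_const.congr_of_eventuallyEq (notMem_tsupport_iff_eventuallyEq.1 hx)
  have hYc : HasCompactSupport Y := hχc.of_isClosed_subset (isClosed_tsupport _) hsub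
  obtain ⟨i, e⟩ := h.integral_divergence_sq hY hYc
  rw [← e]
  refine integral_mono_ae i hint ?_
  filter_upwards [hV] with x hx
  by_cases hxΩ : x ∈ Ω
  · obtain ⟨α, β, hX1, hX2⟩ := hx hxΩ
    have hXd : DifferentiableAt ℝ X x :=
      (hX.contDiffAt (hΩ.mem_nhds hxΩ)).differentiableAt (by simp)
    have hχd : DifferentiableAt ℝ χ x := hχ.differentiable (by simp) x
    have hdiv : divergence Y x = 2 * χ x * fderiv ℝ χ x (X x) + χ x ^ 2 * divergence X x := by
      have h1 : fderiv ℝ Y x = χ x ^ 2 • fderiv ℝ X x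
          + ((2 * χ x) • fderiv ℝ χ x).smulRight (X x) := by
        have h2 : HasFDerivAt Y _ x := (hχd.hasFDerivAt.pow 2).smul hXd.hasFDerivAt
        rw [h2.fderiv]
        ext v j
        simp
      have h3 := sum_coord_mul (fderiv ℝ χ x) (X x)
      unfold divergence
      rw [h1, ← h3, Finset.mul_sum, Finset.mul_sum, ← Finset.sum_add_distrib]
      refine Finset.sum_congr rfl fun j _ => ?_
      simp
      ring
    have hinner : inner ℝ (g x) (Y x) = χ x ^ 2 * (α * inner ℝ (g x) (radialUnit x)
        + β * inner ℝ (g x) (polarUnit x)) := by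
      simp only [Y, hX1, inner_smul_right, inner_add_right]
    have hder : fderiv ℝ χ x (X x)
        = α * fderiv ℝ χ x (radialUnit x) + β * fderiv ℝ χ x (polarUnit x) := by
      rw [hX1]; simp
    rw [hdiv, hinner, hder]
    unfold cutoffDensity
    set p := inner ℝ (g x) (radialUnit x)
    set q := inner ℝ (g x) (polarUnit x)
    set p' := fderiv ℝ χ x (radialUnit x)
    set q' := fderiv ℝ χ x (polarUnit x)
    have h4 := mul_le_mul_of_nonneg_right hX2 (sq_nonneg (χ x * w x))
    nlinarith [sq_nonneg (χ x * p + w x * p' - χ x * w x * α),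
      sq_nonneg (χ x * q + w x * q' - χ x * w x * β)]
  · have hxχ : x ∉ tsupport χ := fun hmem => hxΩ (hχΩ hmem)
    have h1 : χ x = 0 := image_eq_zero_of_notMem_tsupport hxχ
    have h2 : fderiv ℝ χ x = 0 := fderiv_of_notMem_tsupport ℝ hxχ
    have h3 : fderiv ℝ Y x = 0 := fderiv_of_notMem_tsupport ℝ fun hmem => hxχ (hsub hmem)
    simp [cutoffDensity, divergence, h1, h2, h3, Y]

/-- Removal of the cutoff: the quadratic form with potential `V` is nonnegative at every `w ∈ H¹`
for which its density is integrable, provided that there are cutoffs whose gradients are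
controlled by a function `d` with `w d ∈ L²`. -/
theorem MemH1.integral_nonneg_of_cutoffs {w : E3 → ℝ} {g : E3 → E3} (h : MemH1 w g)
    {Ω : Set E3} (hΩ : IsOpen Ω) {X : E3 → E3} (hX : ContDiffOn ℝ ∞ X Ω) {V : E3 → ℝ}
    (hV : ∀ᵐ x, x ∈ Ω → ∃ α β : ℝ, X x = α • radialUnit x + β • polarUnit x ∧
      divergence X x + α ^ 2 + β ^ 2 ≤ V x)
    {D : E3 → ℝ} (hD : Integrable D)
    (hDV : ∀ᵐ x, D x = inner ℝ (g x) (radialUnit x) ^ 2 + inner ℝ (g x) (polarUnit x) ^ 2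
      + V x * w x ^ 2)
    {χ : ℕ → E3 → ℝ} (hχ : ∀ n, ContDiff ℝ ∞ (χ n)) (hχc : ∀ n, HasCompactSupport (χ n))
    (hχΩ : ∀ n, tsupport (χ n) ⊆ Ω) (hχ1 : ∀ n x, |χ n x| ≤ 1)
    (hχlim : ∀ᵐ x, ∀ᶠ n in atTop, χ n =ᶠ[𝓝 x] fun _ => 1)
    {d : E3 → ℝ} (hχd : ∀ n x, ‖fderiv ℝ (χ n) x‖ ≤ d x) (hd : MemLp (fun x => w x * d x) 2) :
    0 ≤ ∫ x, D x := by
  have e : ∀ n, cutoffDensity V w g (χ n) =ᵐ[volume] fun x => χ n x ^ 2 * D x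
      + (2 * χ n x * (w x * (inner ℝ (g x) (radialUnit x) * fderiv ℝ (χ n) x (radialUnit x)
          + inner ℝ (g x) (polarUnit x) * fderiv ℝ (χ n) x (polarUnit x)))
        + w x ^ 2 * (fderiv ℝ (χ n) x (radialUnit x) ^ 2
          + fderiv ℝ (χ n) x (polarUnit x) ^ 2)) := by
    intro n
    filter_upwards [hDV] with x hx
    rw [hx]
    unfold cutoffDensity
    ring
  have hw := h.memLp.aestronglyMeasurable
  have hg := h.memLp_grad.aestronglyMeasurable
  have hmeas : ∀ n, AEStronglyMeasurable (cutoffDensity V w g (χ n)) volume := by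
    intro n
    refine AEStronglyMeasurable.congr ?_ (e n).symm
    have m0 := (hχ n).continuous.aestronglyMeasurable (μ := (volume : Measure E3))
    have m1 := hg.inner (𝕜 := ℝ) measurable_radialUnit.aestronglyMeasurable
    have m2 := hg.inner (𝕜 := ℝ) measurable_polarUnit.aestronglyMeasurable
    have hf : Continuous fun p : E3 × E3 => fderiv ℝ (χ n) p.1 p.2 :=
      (((hχ n).continuous_fderiv (by simp)).comp continuous_fst).clm_apply continuous_snd
    have m3 := (hf.measurable.comp (measurable_id.prodMk measurable_radialUnit)).aestronglyMeasurable
      (μ := (volume : Measure E3))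
    have m4 := (hf.measurable.comp (measurable_id.prodMk measurable_polarUnit)).aestronglyMeasurable
      (μ := (volume : Measure E3))
    exact ((m0.pow 2).mul hD.aestronglyMeasurable).add
      (((m0.const_mul 2).mul (hw.mul ((m1.mul m3).add (m2.mul m4)))).add
        ((hw.pow 2).mul ((m3.pow 2).add (m4.pow 2))))
  set bound : E3 → ℝ := fun x => |D x| + (4 * |(w x * d x) * ‖g x‖| + 2 * (w x * d x) ^ 2)
  have hbound : Integrable bound :=
    hD.abs.add ((((hd.integrable_mul h.memLp_grad.norm).abs).const_mul 4).add
      (hd.integrable_sq.const_mul 2))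
  have hle : ∀ n, ∀ᵐ x, ‖cutoffDensity V w g (χ n) x‖ ≤ bound x := by
    intro n
    filter_upwards [e n] with x hx
    rw [hx, Real.norm_eq_abs]
    have hd0 : 0 ≤ d x := (norm_nonneg _).trans (hχd n x)
    have b1 : |inner ℝ (g x) (radialUnit x)| ≤ ‖g x‖ := by
      simpa [norm_radialUnit] using abs_real_inner_le_norm (g x) (radialUnit x)
    have b2 : |inner ℝ (g x) (polarUnit x)| ≤ ‖g x‖ := by
      simpa [norm_polarUnit] using abs_real_inner_le_norm (g x) (polarUnit x)
    have b3 : |fderiv ℝ (χ n) x (radialUnit x)| ≤ d x := by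
      have := (fderiv ℝ (χ n) x).le_opNorm (radialUnit x)
      rw [norm_radialUnit, mul_one] at this
      exact this.trans (hχd n x)
    have b4 : |fderiv ℝ (χ n) x (polarUnit x)| ≤ d x := by
      have := (fderiv ℝ (χ n) x).le_opNorm (polarUnit x)
      rw [norm_polarUnit, mul_one] at this
      exact this.trans (hχd n x)
    have b0 := hχ1 n x
    set p := inner ℝ (g x) (radialUnit x)
    set q := inner ℝ (g x) (polarUnit x)
    set p' := fderiv ℝ (χ n) x (radialUnit x)
    set q' := fderiv ℝ (χ n) x (polarUnit x)
    have c1 : |χ n x ^ 2 * D x| ≤ |D x| := by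
      rw [abs_mul, abs_pow]
      exact mul_le_of_le_one_left (abs_nonneg _) (pow_le_one₀ (abs_nonneg _) b0)
    have c2 : |p * p' + q * q'| ≤ 2 * (‖g x‖ * d x) := by
      have c3 : |p * p'| ≤ ‖g x‖ * d x := by rw [abs_mul]; gcongr
      have c4 : |q * q'| ≤ ‖g x‖ * d x := by rw [abs_mul]; gcongr
      linarith [abs_add_le (p * p') (q * q')]
    have c5 : |2 * χ n x * (w x * (p * p' + q * q'))| ≤ 4 * |(w x * d x) * ‖g x‖| := by
      have c6 : |χ n x| * (|w x| * |p * p' + q * q'|) ≤ 1 * (|w x| * (2 * (‖g x‖ * d x))) := by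
        gcongr
      rw [abs_mul, abs_mul, abs_mul, abs_mul, abs_mul, abs_of_nonneg hd0, abs_norm, abs_two]
      linarith
    have c7 : |w x ^ 2 * (p' ^ 2 + q' ^ 2)| ≤ 2 * (w x * d x) ^ 2 := by
      have c8 : p' ^ 2 ≤ d x ^ 2 := sq_le_sq' (abs_le.1 b3).1 (abs_le.1 b3).2
      have c9 : q' ^ 2 ≤ d x ^ 2 := sq_le_sq' (abs_le.1 b4).1 (abs_le.1 b4).2
      rw [abs_of_nonneg (by positivity), mul_pow]
      nlinarith [sq_nonneg (w x)]
    calc |_| ≤ |χ n x ^ 2 * D x| + (|2 * χ n x * (w x * (p * p' + q * q'))|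
          + |w x ^ 2 * (p' ^ 2 + q' ^ 2)|) :=
        (abs_add_le _ _).trans (add_le_add_right (abs_add_le _ _) _)
      _ ≤ bound x := add_le_add c1 (add_le_add c5 c7)
  have hlim : ∀ᵐ x, Tendsto (fun n => cutoffDensity V w g (χ n) x) atTop (𝓝 (D x)) := by
    filter_upwards [hχlim, hDV] with x hx hx2
    refine tendsto_const_nhds.congr' ?_
    filter_upwards [hx] with n hn
    have h1 : χ n x = 1 := hn.eq_of_nhds
    have h2 : fderiv ℝ (χ n) x = 0 := by rw [hn.fderiv_eq]; simp
    simp [cutoffDensity, h1, h2, hx2]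
  refine ge_of_tendsto' (tendsto_integral_of_dominated_convergence bound hmeas hbound hle hlim)
    fun n => ?_
  exact h.integral_cutoffDensity_nonneg hΩ hX hV (hχ n) (hχc n) (hχΩ n)
    (hbound.mono' (hmeas n) (hle n))

/-! ### Logarithmic gradients of separated functions -/

/-- The projection along the axis, `x ↦ (x₁, x₂, 0)`. -/
def axisProj : E3 →L[ℝ] E3 :=
  ContinuousLinearMap.id ℝ E3
    - (EuclideanSpace.proj (2 : Fin 3) : E3 →L[ℝ] ℝ).smulRight (EuclideanSpace.single 2 1)

theorem axisProj_apply (x : E3) : axisProj x = !₂[x 0, x 1, 0] := by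
  ext j
  fin_cases j <;> simp [axisProj]

/-- The logarithmic gradient `∇Φ / Φ` of `Φ = e^{b(log r)} (r sin θ)^κ`, where `B = b'`. -/
def logGrad (B : ℝ → ℝ) (κ : ℝ) (x : E3) : E3 :=
  (B (Real.log (‖x‖ ^ 2) / 2) / ‖x‖ ^ 2) • x + (κ / axisSq x) • axisProj x

theorem contDiffOn_logGrad {B : ℝ → ℝ} (hB : ContDiff ℝ ∞ B) {κ : ℝ} {Ω : Set E3}
    (hΩ : ∀ x ∈ Ω, x ≠ 0) (hκ : κ = 0 ∨ ∀ x ∈ Ω, 0 < axisSq x) :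
    ContDiffOn ℝ ∞ (logGrad B κ) Ω := by
  intro x hx
  refine ContDiffAt.contDiffWithinAt ?_
  have h0 : ‖x‖ ^ 2 ≠ 0 := by simpa using hΩ x hx
  have hq : ContDiffAt ℝ ∞ (fun x : E3 => ‖x‖ ^ 2) x := (contDiff_norm_sq ℝ).contDiffAt
  have h1 : ContDiffAt ℝ ∞ (fun x : E3 => (B (Real.log (‖x‖ ^ 2) / 2) / ‖x‖ ^ 2) • x) x :=
    ((hB.contDiffAt.comp x ((hq.log h0).div_const 2)).div hq h0).smul contDiffAt_id
  have h2 : ContDiffAt ℝ ∞ (fun x : E3 => (κ / axisSq x) • axisProj x) x := by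
    rcases hκ with rfl | hs
    · simp only [zero_div, zero_smul]
      exact contDiffAt_const
    · exact (contDiffAt_const.div contDiff_axisSq.contDiffAt (hs x hx).ne').smul
        axisProj.contDiff.contDiffAt
  exact h1.add h2

theorem logGrad_eq_frame (B : ℝ → ℝ) (κ : ℝ) {x : E3} (hx : 0 < axisSq x) :
    logGrad B κ x = ((B (Real.log ‖x‖) + κ) / ‖x‖) • radialUnit x
      + (κ * x 2 / (‖x‖ * Real.sqrt (axisSq x))) • polarUnit x := by
  have hr := norm_pos_of_axisSq_pos hx
  have hs := Real.sqrt_pos.2 hx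
  have e1 : axisSq x = Real.sqrt (axisSq x) ^ 2 := (Real.sq_sqrt hx.le).symm
  have e2 : x 2 ^ 2 = ‖x‖ ^ 2 - Real.sqrt (axisSq x) ^ 2 := by
    rw [← e1, norm_sq_eq]; ring
  have e3 : Real.log (‖x‖ ^ 2) / 2 = Real.log ‖x‖ := by rw [Real.log_pow]; push_cast; ring
  rw [radialUnit_eq hx, polarUnit_eq hx, logGrad, axisProj_apply, e3, e1]
  rw [Real.sqrt_sq hs.le]
  set σ := Real.sqrt (axisSq x)
  ext j
  fin_cases j
  · simp
    field_simp
    linear_combination (-κ * x 0) * e2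
  · simp
    field_simp
    linear_combination (-κ * x 1) * e2
  · simp
    field_simp
    ring

theorem divergence_logGrad {B : ℝ → ℝ} {B' : ℝ} {x : E3} (κ : ℝ) (hx : 0 < axisSq x)
    (hB : HasDerivAt B B' (Real.log ‖x‖)) :
    divergence (logGrad B κ) x = (B' + B (Real.log ‖x‖)) / ‖x‖ ^ 2 := by
  have hr := norm_pos_of_axisSq_pos hx
  have e3 : ∀ x : E3, Real.log (‖x‖ ^ 2) / 2 = Real.log ‖x‖ := fun x => by
    rw [Real.log_pow]; push_cast; ring
  have hq : HasFDerivAt (fun x : E3 => ‖x‖ ^ 2) (2 • innerSL ℝ x) x :=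
    (hasStrictFDerivAt_norm_sq x).hasFDerivAt
  have hlog := (hq.log (by positivity : ‖x‖ ^ 2 ≠ 0)).mul_const (1 / 2 : ℝ)
  have hBc : HasFDerivAt (fun x : E3 => B (Real.log (‖x‖ ^ 2) / 2))
      (B' • ((1 / 2 : ℝ) • (‖x‖ ^ 2)⁻¹ • (2 • innerSL ℝ x))) x := by
    rw [← e3] at hB
    have : HasDerivAt B B' (Real.log (‖x‖ ^ 2) * (1 / 2)) := by
      convert hB using 1; ring
    have h1 := this.comp_hasFDerivAt x hlog
    refine h1.congr_of_eventuallyEq (.of_forall fun y => ?_)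
    simp only [Function.comp]
    ring_nf
  have hqi := (hasDerivAt_inv (by positivity : ‖x‖ ^ 2 ≠ 0)).comp_hasFDerivAt x hq
  have ha := hBc.mul hqi
  have hs := hasFDerivAt_axisSq x
  have hb := ((hasDerivAt_inv hx.ne').comp_hasFDerivAt x hs).const_mul κ
  have heq : logGrad B κ = (((fun x : E3 => B (Real.log (‖x‖ ^ 2) / 2))
      * ((fun y : ℝ => y⁻¹) ∘ fun x : E3 => ‖x‖ ^ 2)) • id)
      + ((fun x : E3 => κ * ((fun y : ℝ => y⁻¹) ∘ axisSq) x) • fun x => axisProj x) := by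
    funext y
    simp [logGrad, div_eq_mul_inv]
  have hX := (ha.smul (hasFDerivAt_id x)).add (hb.smul (axisProj.hasFDerivAt (x := x)))
  rw [← heq] at hX
  have hq2 := norm_sq_eq x
  unfold divergence
  rw [hX.fderiv]
  have hx' := hx
  unfold axisSq at hx' hq2
  simp only [Fin.sum_univ_three, add_apply, smul_apply, PiLp.add_apply, PiLp.smul_apply,
    ContinuousLinearMap.smulRight_apply, axisProj_apply, e3]
  simp [EuclideanSpace.inner_single_right, axisSq]
  field_simp
  rw [show ‖x‖ ^ 4 = (‖x‖ ^ 2) ^ 2 by ring, hq2]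
  ring

/-! ### Cutoffs -/

/-- The smooth function `y ↦ smoothTransition (y - 1)`, which vanishes for `y ≤ 1` and equals `1`
for `y ≥ 2`. -/
def step (y : ℝ) : ℝ := Real.smoothTransition (y - 1)

theorem contDiff_step : ContDiff ℝ ∞ step :=
  Real.smoothTransition.contDiff.comp (contDiff_id.sub contDiff_const)

theorem step_of_le {y : ℝ} (h : y ≤ 1) : step y = 0 :=
  Real.smoothTransition.zero_of_nonpos (by linarith)

theorem step_of_ge {y : ℝ} (h : 2 ≤ y) : step y = 1 :=
  Real.smoothTransition.one_of_one_le (by linarith)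

theorem deriv_step_of_lt {y : ℝ} (h : y < 1) : deriv step y = 0 := by
  have : step =ᶠ[𝓝 y] fun _ => 0 := by
    filter_upwards [gt_mem_nhds h] with z hz using step_of_le (le_of_lt hz)
  rw [this.deriv_eq]; simp

theorem deriv_step_of_gt {y : ℝ} (h : 2 < y) : deriv step y = 0 := by
  have : step =ᶠ[𝓝 y] fun _ => 1 := by
    filter_upwards [lt_mem_nhds h] with z hz using step_of_ge (le_of_lt hz)
  rw [this.deriv_eq]; simp

theorem exists_deriv_step_le : ∃ C, 0 ≤ C ∧ ∀ y, |deriv step y| ≤ C := by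
  obtain ⟨C, hC⟩ := (isCompact_Icc (a := (1 : ℝ)) (b := 2)).exists_bound_of_continuousOn
    (contDiff_step.continuous_deriv (by simp)).continuousOn
  refine ⟨max C 0, le_max_right _ _, fun y => ?_⟩
  rcases lt_or_ge y 1 with h1 | h1
  · rw [deriv_step_of_lt h1]; simp
  rcases lt_or_ge 2 y with h2 | h2
  · rw [deriv_step_of_gt h2]; simp
  · exact (hC y ⟨h1, h2⟩).trans (le_max_left _ _)

/-- Cutoffs to the set where `ρ` is not small and `|x|` is not large. -/
def cutoff (ρ : E3 → ℝ) (n : ℕ) (x : E3) : ℝ :=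
  step ((n + 1 : ℝ) ^ 2 * ρ x) * (1 - step (‖x‖ ^ 2 / (n + 1 : ℝ) ^ 2))

theorem contDiff_cutoff {ρ : E3 → ℝ} (hρ : ContDiff ℝ ∞ ρ) (n : ℕ) :
    ContDiff ℝ ∞ (cutoff ρ n) :=
  (contDiff_step.comp (contDiff_const.mul hρ)).mul
    (contDiff_const.sub (contDiff_step.comp ((contDiff_norm_sq ℝ).div_const _)))

theorem abs_cutoff_le (ρ : E3 → ℝ) (n : ℕ) (x : E3) : |cutoff ρ n x| ≤ 1 := by
  have h1 : ∀ y, 0 ≤ step y := fun y => Real.smoothTransition.nonneg _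
  have h2 : ∀ y, step y ≤ 1 := fun y => Real.smoothTransition.le_one _
  have h3 := sub_nonneg.2 (h2 (‖x‖ ^ 2 / (n + 1 : ℝ) ^ 2))
  unfold cutoff
  rw [abs_of_nonneg (mul_nonneg (h1 _) h3)]
  exact mul_le_one₀ (h2 _) h3 (by linarith [h1 (‖x‖ ^ 2 / (n + 1 : ℝ) ^ 2)])

theorem hasCompactSupport_cutoff (ρ : E3 → ℝ) (n : ℕ) : HasCompactSupport (cutoff ρ n) := by
  refine HasCompactSupport.intro (isCompact_closedBall (0 : E3) (2 * (n + 1))) fun x hx => ?_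
  have h1 : 2 * (n + 1 : ℝ) < ‖x‖ := by simpa using hx
  have hn : (0 : ℝ) < n + 1 := by positivity
  have h2 : 2 ≤ ‖x‖ ^ 2 / (n + 1 : ℝ) ^ 2 := by
    rw [le_div_iff₀ (by positivity)]
    nlinarith
  simp [cutoff, step_of_ge h2]

theorem tsupport_cutoff_subset {ρ : E3 → ℝ} (hρ : Continuous ρ) (n : ℕ) :
    tsupport (cutoff ρ n) ⊆ {x | 0 < ρ x} := by
  have hn : (0 : ℝ) < (n + 1 : ℝ) ^ 2 := by positivity
  have hcl : IsClosed {x | 1 ≤ (n + 1 : ℝ) ^ 2 * ρ x} :=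
    isClosed_le continuous_const (continuous_const.mul hρ)
  refine (closure_minimal (fun x hx => ?_) hcl).trans fun x hx => ?_
  · by_contra hcon
    have h1 : (n + 1 : ℝ) ^ 2 * ρ x ≤ 1 := (not_le.1 hcon).le
    exact hx (by simp [cutoff, step_of_le h1])
  · have h1 : 1 ≤ (n + 1 : ℝ) ^ 2 * ρ x := hx
    exact (pos_iff_pos_of_mul_pos (by linarith : 0 < (n + 1 : ℝ) ^ 2 * ρ x)).1 hn

theorem eventually_cutoff_eq {ρ : E3 → ℝ} (hρ : Continuous ρ) {x : E3} (hx : 0 < ρ x) :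
    ∀ᶠ n in atTop, cutoff ρ n =ᶠ[𝓝 x] fun _ => 1 := by
  have hlim : Tendsto (fun n : ℕ => ((n : ℝ) + 1) ^ 2) atTop atTop :=
    (tendsto_pow_atTop two_ne_zero).comp
      (tendsto_atTop_add_const_right _ _ tendsto_natCast_atTop_atTop)
  filter_upwards [hlim.eventually_gt_atTop (2 / ρ x), hlim.eventually_gt_atTop (‖x‖ ^ 2)]
    with n h1 h2
  have hn : (0 : ℝ) < (n + 1 : ℝ) ^ 2 := by positivity
  rw [div_lt_iff₀ hx] at h1
  have c1 : ∀ᶠ y in 𝓝 x, 2 < (n + 1 : ℝ) ^ 2 * ρ y :=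
    (continuous_const.mul hρ).continuousAt.eventually (lt_mem_nhds h1)
  have c2 : ∀ᶠ y : E3 in 𝓝 x, ‖y‖ ^ 2 < (n + 1 : ℝ) ^ 2 :=
    (continuous_norm.pow 2).continuousAt.eventually (gt_mem_nhds h2)
  filter_upwards [c1, c2] with y hy1 hy2
  have h3 : ‖y‖ ^ 2 / (n + 1 : ℝ) ^ 2 ≤ 1 := (div_le_one hn).2 hy2.le
  simp [cutoff, step_of_ge hy1.le, step_of_le h3]

/-- The gradient of the cutoffs is bounded by a multiple of `1 + ρ^{-1/2}`, uniformly in `n`. -/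
theorem exists_norm_fderiv_cutoff_le {ρ : E3 → ℝ} (hρ : ContDiff ℝ ∞ ρ) (hρ0 : ∀ x, 0 ≤ ρ x)
    (hρ' : ∀ x, ‖fderiv ℝ ρ x‖ ≤ 2 * Real.sqrt (ρ x)) :
    ∃ C, ∀ n x, ‖fderiv ℝ (cutoff ρ n) x‖ ≤ C * (1 + 1 / Real.sqrt (ρ x)) := by
  obtain ⟨C, hC0, hC⟩ := exists_deriv_step_le
  refine ⟨4 * C, fun n x => ?_⟩
  set N : ℝ := n + 1
  have hN : 1 ≤ N := by simp [N]
  have hstep : ∀ y, HasDerivAt step (deriv step y) y := fun y =>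
    (contDiff_step.differentiable (by simp) y).hasDerivAt
  have hd1 : HasFDerivAt (fun x => N ^ 2 * ρ x) (N ^ 2 • fderiv ℝ ρ x) x :=
    (hρ.differentiable (by simp) x).hasFDerivAt.const_mul _
  have hd2 : HasFDerivAt (fun x : E3 => ‖x‖ ^ 2 * (1 / N ^ 2)) ((1 / N ^ 2) • (2 • innerSL ℝ x)) x :=
    (hasStrictFDerivAt_norm_sq x).hasFDerivAt.mul_const _
  have h1 := (hstep (N ^ 2 * ρ x)).comp_hasFDerivAt x hd1
  have h2 := (hstep (‖x‖ ^ 2 * (1 / N ^ 2))).comp_hasFDerivAt x hd2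
  have h3 := h1.mul (h2.const_sub 1)
  have heq : cutoff ρ n = (step ∘ fun x => N ^ 2 * ρ x)
      * fun x => 1 - (step ∘ fun x : E3 => ‖x‖ ^ 2 * (1 / N ^ 2)) x := by
    funext y
    simp [cutoff, N, div_eq_mul_inv]
  rw [heq, h3.fderiv]
  have s0 : ∀ y, |step y| ≤ 1 := fun y => by
    have h4 : step y ≤ 1 := Real.smoothTransition.le_one _
    have h5 : 0 ≤ step y := Real.smoothTransition.nonneg _
    rwa [abs_of_nonneg h5]
  have s1 : ∀ y, |1 - step y| ≤ 1 := fun y => by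
    have h4 : step y ≤ 1 := Real.smoothTransition.le_one _
    have h5 : 0 ≤ step y := Real.smoothTransition.nonneg _
    rw [abs_of_nonneg (by linarith)]; linarith
  have b1 : |deriv step (N ^ 2 * ρ x)| * (N ^ 2 * ‖fderiv ℝ ρ x‖) ≤ 4 * C * (1 / Real.sqrt (ρ x)) := by
    rcases lt_or_ge (N ^ 2 * ρ x) 1 with c1 | c1
    · rw [deriv_step_of_lt c1]; simp; positivity
    rcases lt_or_ge 2 (N ^ 2 * ρ x) with c2 | c2
    · rw [deriv_step_of_gt c2]; simp; positivity
    have hpos : 0 < ρ x := lt_of_le_of_ne (hρ0 x) fun h0 => by rw [← h0] at c1; norm_num at c1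
    have hsq := Real.sqrt_pos.2 hpos
    have h4 : N ^ 2 * ‖fderiv ℝ ρ x‖ ≤ 4 * (1 / Real.sqrt (ρ x)) := by
      rw [mul_one_div, le_div_iff₀ hsq]
      have h5 := Real.mul_self_sqrt hpos.le
      calc N ^ 2 * ‖fderiv ℝ ρ x‖ * Real.sqrt (ρ x)
          ≤ N ^ 2 * (2 * Real.sqrt (ρ x)) * Real.sqrt (ρ x) := by gcongr; exact hρ' x
        _ = 2 * (N ^ 2 * ρ x) := by rw [← h5]; ring_nf; rw [Real.sq_sqrt (by positivity)]
        _ ≤ 4 := by linarith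
    calc _ ≤ C * (4 * (1 / Real.sqrt (ρ x))) := by gcongr; exact hC _
      _ = _ := by ring
  have b2 : |deriv step (‖x‖ ^ 2 * (1 / N ^ 2))| * (1 / N ^ 2 * (2 * ‖x‖)) ≤ 4 * C := by
    rcases lt_or_ge 2 (‖x‖ ^ 2 * (1 / N ^ 2)) with c2 | c2
    · rw [deriv_step_of_gt c2]; simp; positivity
    have h4 : 1 / N ^ 2 * (2 * ‖x‖) ≤ 4 := by
      rw [mul_one_div, div_le_iff₀ (by positivity)] at c2
      rw [one_div_mul_eq_div, div_le_iff₀ (by positivity)]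
      have h5 : ‖x‖ ≤ 2 * N := by
        by_contra! hlt
        nlinarith
      nlinarith
    calc _ ≤ C * 4 := by gcongr; exact hC _
      _ = _ := by ring
  have n2 : ‖(2 • innerSL ℝ x : E3 →L[ℝ] ℝ)‖ = 2 * ‖x‖ := by
    rw [← Nat.cast_smul_eq_nsmul ℝ, norm_smul, innerSL_apply_norm]; simp
  calc _ ≤ ‖(step ∘ fun x => N ^ 2 * ρ x) x •
          -(deriv step (‖x‖ ^ 2 * (1 / N ^ 2)) • (1 / N ^ 2) • (2 • innerSL ℝ x))‖
        + ‖(1 - (step ∘ fun x : E3 => ‖x‖ ^ 2 * (1 / N ^ 2)) x) •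
          deriv step (N ^ 2 * ρ x) • N ^ 2 • fderiv ℝ ρ x‖ := norm_add_le _ _
    _ = |step (N ^ 2 * ρ x)| * (|deriv step (‖x‖ ^ 2 * (1 / N ^ 2))| * (1 / N ^ 2 * (2 * ‖x‖)))
        + |1 - step (‖x‖ ^ 2 * (1 / N ^ 2))|
          * (|deriv step (N ^ 2 * ρ x)| * (N ^ 2 * ‖fderiv ℝ ρ x‖)) := by
        rw [norm_smul, norm_neg, norm_smul, norm_smul (1 / N ^ 2), n2, norm_smul, norm_smul, norm_smul]
        simp only [Real.norm_eq_abs, Function.comp]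
        rw [abs_of_nonneg (by positivity : (0 : ℝ) ≤ 1 / N ^ 2),
          abs_of_nonneg (by positivity : (0 : ℝ) ≤ N ^ 2)]
    _ ≤ 1 * (4 * C) + 1 * (4 * C * (1 / Real.sqrt (ρ x))) := by
        gcongr
        · exact s0 _
        · exact s1 _
    _ = _ := by ring

section

/-! ### The quadratic functionals -/

theorem extIntegral_congr {h k : E3 → ℝ} (e : h =ᵐ[volume] k) : extIntegral h = extIntegral k := by
  unfold extIntegral
  rw [lintegral_congr_ae (e.mono fun x hx => congrArg ENNReal.ofReal hx),
    lintegral_congr_ae (e.mono fun x hx => congrArg (fun t : ℝ => ENNReal.ofReal (-t)) hx)]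

theorem extIntegral_eq_integral {h : E3 → ℝ} (hh : Integrable h) :
    extIntegral h = ((∫ x, h x : ℝ) : EReal) := by
  have h1 : ∫⁻ x, ENNReal.ofReal (h x) ≠ ⊤ := hh.lintegral_lt_top.ne
  have h2 : ∫⁻ x, ENNReal.ofReal (-h x) ≠ ⊤ := hh.neg.lintegral_lt_top.ne
  rw [integral_eq_lintegral_pos_part_sub_lintegral_neg_part hh, extIntegral, EReal.coe_sub,
    EReal.coe_ennreal_toReal h1, EReal.coe_ennreal_toReal h2]

/-- An integral that may be `+∞`, of a function with integrable negative part, is nonnegative if it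
is so in the integrable case. -/
theorem extIntegral_nonneg {h k : E3 → ℝ} (hm : AEStronglyMeasurable h) (hk : Integrable k)
    (hhk : ∀ᵐ x, -k x ≤ h x) (hint : Integrable h → 0 ≤ ∫ x, h x) : 0 ≤ extIntegral h := by
  have hneg : ∫⁻ x, ENNReal.ofReal (-h x) ≠ ⊤ := by
    refine ne_top_of_le_ne_top hk.lintegral_lt_top.ne (lintegral_mono_ae ?_)
    filter_upwards [hhk] with x hx
    exact ENNReal.ofReal_le_ofReal (by linarith)
  by_cases hpos : ∫⁻ x, ENNReal.ofReal (h x) = ⊤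
  · unfold extIntegral
    rw [hpos, ← EReal.coe_ennreal_toReal hneg]
    simp
  · have hi : Integrable h := by
      refine ⟨hm, ?_⟩
      rw [hasFiniteIntegral_iff_norm]
      have e : ∀ x, ENNReal.ofReal ‖h x‖ = ENNReal.ofReal (h x) + ENNReal.ofReal (-h x) := by
        intro x
        rcases le_total 0 (h x) with h0 | h0
        · rw [Real.norm_of_nonneg h0, ENNReal.ofReal_of_nonpos (by linarith : -h x ≤ 0), add_zero]
        · rw [Real.norm_of_nonpos h0, ENNReal.ofReal_of_nonpos h0, zero_add]
      simp only [e]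
      rw [lintegral_add_left' hm.aemeasurable.ennreal_ofReal]
      exact ENNReal.add_lt_top.2 ⟨lt_top_iff_ne_top.2 hpos, lt_top_iff_ne_top.2 hneg⟩
    rw [extIntegral_eq_integral hi]
    exact_mod_cast hint hi

/-- The coefficient of `w²` in the density of `𝒬ᵢ`, in terms of the profile `U` in the
variable `log r`. -/
def potential (a b c : ℝ) (U : ℝ → ℝ) (i : Fin 5) (x : E3) : ℝ :=
  angularCoeff i (polarAngle x) / ‖x‖ ^ 2 + bulkCoeff a b c i (U (Real.log ‖x‖))

theorem density_eq (a b c : ℝ) (u : ℝ → ℝ) (i : Fin 5) (w : E3 → ℝ) (g : E3 → E3) {x : E3}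
    (hx : 0 < axisSq x) :
    density a b c u i w g x = inner ℝ (g x) (radialUnit x) ^ 2 + inner ℝ (g x) (polarUnit x) ^ 2
      + potential a b c (fun t => u (Real.exp t)) i x * w x ^ 2 := by
  have hr := norm_pos_of_axisSq_pos hx
  simp only [density, radialDeriv, polarDeriv, potential, radialUnit, polarUnit, Real.exp_log hr]
  field_simp
  ring

theorem continuous_bulkCoeff (a b c : ℝ) (i : Fin 5) : Continuous (bulkCoeff a b c i) := by
  have h0 : Continuous (fHat a b c) := by unfold fHat; fun_prop
  have h1 : Continuous (f a b c) := by unfold f; fun_prop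
  have h3 : Continuous (fTilde a b c) := by unfold fTilde; fun_prop
  fin_cases i
  exacts [h0, h1, h1, h3, h3]

theorem measurable_angularCoeff (i : Fin 5) : Measurable (angularCoeff i) := by
  have h1 : Measurable fun θ => 4 + 1 / Real.sin θ ^ 2 := by fun_prop
  have h3 : Measurable fun θ => -2 + 4 / Real.sin θ ^ 2 := by fun_prop
  fin_cases i
  exacts [measurable_const, h1, h1, h3, h3]

theorem measurable_potential (a b c : ℝ) {U : ℝ → ℝ} (hU : Continuous U) (i : Fin 5) :
    Measurable (potential a b c U i) := by
  have h1 := ((measurable_angularCoeff i).comp measurable_polarAngle).div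
    (measurable_norm (α := E3).pow_const 2)
  have h2 := ((continuous_bulkCoeff a b c i).comp hU).measurable.comp
    (Real.measurable_log.comp (measurable_norm (α := E3)))
  exact h1.add h2

/-- The functional `𝒬ᵢ` is nonnegative if `e^{∫ B} (r sin θ)^κ` is a positive supersolution of the
corresponding equation. The function `ρ` is `r²` or the squared distance to the axis, such that
`1 / ρ` is bounded by the angular part of the potential; it determines the cutoffs. -/
theorem Q_nonneg {a b c : ℝ} {u : ℝ → ℝ} {i : Fin 5} {w : E3 → ℝ} {g : E3 → E3} (h : MemH1 w g)
    (hU : Continuous fun t => u (Real.exp t)) {C : ℝ}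
    (hC : ∀ t, |bulkCoeff a b c i (u (Real.exp t))| ≤ C)
    {B B' : ℝ → ℝ} (hB : ContDiff ℝ ∞ B) (hB' : ∀ t, HasDerivAt B (B' t) t) {κ : ℝ}
    (hsup : ∀ t θ, Real.sin θ ≠ 0 → B' t + B t + B t ^ 2 + 2 * κ * B t + κ ^ 2 / Real.sin θ ^ 2
      ≤ angularCoeff i θ + Real.exp (2 * t) * bulkCoeff a b c i (u (Real.exp t)))
    {ρ : E3 → ℝ} (hρ : ContDiff ℝ ∞ ρ) (hρ0 : ∀ x, 0 ≤ ρ x)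
    (hρ' : ∀ x, ‖fderiv ℝ ρ x‖ ≤ 2 * Real.sqrt (ρ x)) (hρne : ∀ x, 0 < ρ x → x ≠ 0)
    (hρs : ∀ x, 0 < axisSq x → 0 < ρ x) (hρκ : κ = 0 ∨ ∀ x, 0 < ρ x → 0 < axisSq x)
    (hang : ∀ x, 0 < axisSq x → 1 / ρ x ≤ angularCoeff i (polarAngle x) / ‖x‖ ^ 2) :
    0 ≤ Q a b c u i w g := by
  set U : ℝ → ℝ := fun t => u (Real.exp t)
  set D : E3 → ℝ := fun x => inner ℝ (g x) (radialUnit x) ^ 2 + inner ℝ (g x) (polarUnit x) ^ 2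
      + potential a b c U i x * w x ^ 2
  have hD : density a b c u i w g =ᵐ[volume] D := by
    filter_upwards [ae_axisSq_pos] with x hx using density_eq a b c u i w g hx
  rw [Q, extIntegral_congr hD]
  have hw := h.memLp.aestronglyMeasurable
  have hg := h.memLp_grad.aestronglyMeasurable
  have hDm : AEStronglyMeasurable D volume := by
    have m1 := hg.inner (𝕜 := ℝ) measurable_radialUnit.aestronglyMeasurable
    have m2 := hg.inner (𝕜 := ℝ) measurable_polarUnit.aestronglyMeasurable
    have m3 := (measurable_potential a b c hU i).aestronglyMeasurable (μ := (volume : Measure E3))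
    exact ((m1.pow 2).add (m2.pow 2)).add (m3.mul (hw.pow 2))
  have hlow : ∀ᵐ x, w x ^ 2 / ρ x ≤ D x + C * w x ^ 2 := by
    filter_upwards [ae_axisSq_pos] with x hx
    have h1 := mul_le_mul_of_nonneg_right (hang x hx) (sq_nonneg (w x))
    have h2 : -C * w x ^ 2 ≤ bulkCoeff a b c i (U (Real.log ‖x‖)) * w x ^ 2 :=
      mul_le_mul_of_nonneg_right (abs_le.1 (hC _)).1 (sq_nonneg _)
    simp only [D, potential]
    have h3 : w x ^ 2 / ρ x = 1 / ρ x * w x ^ 2 := by ring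
    rw [h3]
    nlinarith [sq_nonneg (inner ℝ (g x) (radialUnit x)), sq_nonneg (inner ℝ (g x) (polarUnit x))]
  refine extIntegral_nonneg (k := fun x => C * w x ^ 2) hDm (h.memLp.integrable_sq.const_mul C) ?_
    fun hDi => ?_
  · filter_upwards [hlow] with x hx
    have : 0 ≤ w x ^ 2 / ρ x := div_nonneg (sq_nonneg _) (hρ0 x)
    linarith
  obtain ⟨K, hK⟩ := exists_norm_fderiv_cutoff_le hρ hρ0 hρ'
  have hsqrt : MemLp (fun x => w x * (1 / Real.sqrt (ρ x))) 2 := by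
    have m : AEStronglyMeasurable (fun x => w x * (1 / Real.sqrt (ρ x))) volume :=
      hw.mul (by
        have : Measurable fun x => 1 / Real.sqrt (ρ x) :=
          measurable_const.div (Real.continuous_sqrt.measurable.comp hρ.continuous.measurable)
        exact this.aestronglyMeasurable)
    rw [memLp_two_iff_integrable_sq m]
    refine (hDi.add (h.memLp.integrable_sq.const_mul C)).mono' (m.pow 2) ?_
    filter_upwards [hlow] with x hx
    have e : (w x * (1 / Real.sqrt (ρ x))) ^ 2 = w x ^ 2 / ρ x := by
      rw [mul_pow, div_pow, Real.sq_sqrt (hρ0 x)]; ring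
    rw [Real.norm_of_nonneg (sq_nonneg _), e]
    exact hx
  have hd : MemLp (fun x => w x * (K * (1 + 1 / Real.sqrt (ρ x)))) 2 := by
    refine ((h.memLp.add hsqrt).const_mul K).congr_norm ?_ (.of_forall fun x => ?_)
    · refine ((hw.add hsqrt.aestronglyMeasurable).const_mul K).congr (.of_forall fun x => ?_)
      simp only [Pi.add_apply]; ring
    · congr 1; simp only [Pi.add_apply]; ring
  refine h.integral_nonneg_of_cutoffs (Ω := {x | 0 < ρ x}) (X := logGrad B κ)
    (V := potential a b c U i) (isOpen_lt continuous_const hρ.continuous)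
    (contDiffOn_logGrad hB hρne hρκ) ?_ hDi (.of_forall fun x => rfl) (χ := cutoff ρ)
    (contDiff_cutoff hρ) (hasCompactSupport_cutoff ρ) (tsupport_cutoff_subset hρ.continuous)
    (abs_cutoff_le ρ) ?_ hK hd
  · filter_upwards [ae_axisSq_pos] with x hx _
    refine ⟨_, _, logGrad_eq_frame B κ hx, ?_⟩
    have hr := norm_pos_of_axisSq_pos hx
    have hsin : Real.sin (polarAngle x) ≠ 0 := by
      rw [sin_polarAngle x hx]
      exact (div_pos (Real.sqrt_pos.2 hx) hr).ne'
    have h1 := hsup (Real.log ‖x‖) (polarAngle x) hsin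
    have h2 : Real.exp (2 * Real.log ‖x‖) = ‖x‖ ^ 2 := by
      rw [two_mul, Real.exp_add, Real.exp_log hr]; ring
    rw [divergence_logGrad κ hx (hB' _)]
    have h3 : (κ * x 2 / (‖x‖ * Real.sqrt (axisSq x))) ^ 2
        = (κ ^ 2 / Real.sin (polarAngle x) ^ 2 - κ ^ 2) / ‖x‖ ^ 2 := by
      rw [sin_polarAngle_sq x hx, div_pow, mul_pow, mul_pow, Real.sq_sqrt hx.le]
      have := norm_sq_eq x
      field_simp
      rw [this]
      ring
    rw [h2] at h1
    rw [h3]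
    have h4 : potential a b c U i x = (angularCoeff i (polarAngle x)
        + ‖x‖ ^ 2 * bulkCoeff a b c i (U (Real.log ‖x‖))) / ‖x‖ ^ 2 := by
      unfold potential; field_simp
    rw [h4]
    rw [div_pow, ← add_div, ← add_div, div_le_div_iff_of_pos_right (by positivity)]
    simp only [U]
    nlinarith
  · filter_upwards [ae_axisSq_pos] with x hx using eventually_cutoff_eq hρ.continuous (hρs x hx)

theorem norm_fderiv_norm_sq (x : E3) :
    ‖fderiv ℝ (fun x : E3 => ‖x‖ ^ 2) x‖ ≤ 2 * Real.sqrt (‖x‖ ^ 2) := by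
  rw [(hasStrictFDerivAt_norm_sq x).hasFDerivAt.fderiv, ← Nat.cast_smul_eq_nsmul ℝ, norm_smul,
    innerSL_apply_norm, Real.sqrt_sq (norm_nonneg _)]
  simp

theorem norm_fderiv_axisSq (x : E3) : ‖fderiv ℝ axisSq x‖ ≤ 2 * Real.sqrt (axisSq x) := by
  have hs := hasFDerivAt_axisSq x
  rw [hs.fderiv]
  refine ContinuousLinearMap.opNorm_le_bound _ (by positivity) fun v => ?_
  simp only [add_apply, smul_apply, PiLp.proj_apply, smul_eq_mul, Real.norm_eq_abs]
  have h1 := norm_sq_eq v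
  have h2 : 0 ≤ Real.sqrt (axisSq x) := Real.sqrt_nonneg _
  have h3 : Real.sqrt (axisSq x) ^ 2 = axisSq x := Real.sq_sqrt (axisSq_nonneg x)
  refine abs_le_of_sq_le_sq ?_ (by positivity)
  rw [mul_pow, mul_pow, h3, h1]
  unfold axisSq
  nlinarith [sq_nonneg (x 0 * v 1 - x 1 * v 0),
    mul_nonneg (add_nonneg (sq_nonneg (x 0)) (sq_nonneg (x 1))) (sq_nonneg (v 2))]

variable {a b c : ℝ} {u : ℝ → ℝ}

theorem IsProfile.exists_abs_bulkCoeff_le (hu : IsProfile a b c u) (ha : 0 < a) (hb : 0 < b)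
    (hc : 0 < c) (i : Fin 5) : ∃ C, ∀ t, |bulkCoeff a b c i (u (Real.exp t))| ≤ C := by
  obtain ⟨C, hC⟩ := (isCompact_Icc (a := (0 : ℝ)) (b := sPlus a b c)).exists_bound_of_continuousOn
    (continuous_bulkCoeff a b c i).continuousOn
  exact ⟨C, fun t => hC _ ⟨(hu.logProfile.pos ha hb hc t).le,
    (hu.logProfile.lt_sPlus ha hb hc t).le⟩⟩

/-- The supersolution is `r u'`, the generator of dilations applied to the profile. -/
theorem IsProfile.Q_zero_nonneg (hu : IsProfile a b c u) (ha : 0 < a) (hb : 0 < b) (hc : 0 < c)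
    {w : E3 → ℝ} {g : E3 → E3} (h : MemH1 w g) : 0 ≤ Q a b c u 0 w g := by
  have hL := hu.logProfile
  obtain ⟨C, hC⟩ := hu.exists_abs_bulkCoeff_le ha hb hc 0
  set U : ℝ → ℝ := fun t => u (Real.exp t)
  set U' : ℝ → ℝ := fun t => Real.exp t * deriv u (Real.exp t)
  set U'' : ℝ → ℝ := fun t => -U' t + 6 * U t + Real.exp (2 * t) * bulkF a b c (U t)
  have hpos : ∀ t, 0 < U' t := hL.deriv_pos ha hb hc
  have hU'' : ContDiff ℝ ∞ U'' := by
    have h1 := hL.contDiff.1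
    have h2 := hL.contDiff.2
    unfold U'' bulkF
    fun_prop
  refine Q_nonneg h hL.continuous hC (B := fun t => U'' t / U' t) (κ := 0)
    (hU''.div hL.contDiff.2 fun t => (hpos t).ne')
    (fun t => (hL.hasDerivAt'' t).div (hL.hasDerivAt' t) (hpos t).ne') (fun t θ _ => ?_)
    (ρ := fun x => ‖x‖ ^ 2) (contDiff_norm_sq ℝ) (fun x => sq_nonneg _) norm_fderiv_norm_sq
    (fun x hx h0 => by simp [h0] at hx) (fun x hx => pow_pos (norm_pos_of_axisSq_pos hx) 2)
    (.inl rfl) (fun x hx => ?_)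
  · have hF := bulkF_neg ha hb hc (hL.pos ha hb hc t) (hL.lt_sPlus ha hb hc t)
    have hp := hpos t
    have he := Real.exp_pos (2 * t)
    simp only [bulkCoeff, angularCoeff]
    change _ ≤ 6 + Real.exp (2 * t) * fHat a b c (U t)
    have e : ((-(U'' t) + 6 * U' t + Real.exp (2 * t) * (2 * bulkF a b c (U t)
          + fHat a b c (U t) * U' t)) * U' t - U'' t * U'' t) / U' t ^ 2 + U'' t / U' t
          + (U'' t / U' t) ^ 2
        = 6 + Real.exp (2 * t) * fHat a b c (U t)
          + 2 * (Real.exp (2 * t) * bulkF a b c (U t)) / U' t := by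
      field_simp
      ring
    have h1 : 2 * (Real.exp (2 * t) * bulkF a b c (U t)) / U' t ≤ 0 :=
      div_nonpos_of_nonpos_of_nonneg (by nlinarith) hp.le
    simp only [mul_zero, zero_mul, add_zero, ne_eq, OfNat.ofNat_ne_zero, not_false_eq_true,
      zero_pow, zero_div]
    exact e.le.trans (by linarith)
  · simp only [angularCoeff]
    have hr := norm_pos_of_axisSq_pos hx
    gcongr
    norm_num

/-- The function `u sin θ` is a positive solution. -/
theorem IsProfile.Q_one_nonneg (hu : IsProfile a b c u) (ha : 0 < a) (hb : 0 < b) (hc : 0 < c)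
    {w : E3 → ℝ} {g : E3 → E3} (h : MemH1 w g) : 0 ≤ Q a b c u 1 w g := by
  have hL := hu.logProfile
  obtain ⟨C, hC⟩ := hu.exists_abs_bulkCoeff_le ha hb hc 1
  set U : ℝ → ℝ := fun t => u (Real.exp t)
  set U' : ℝ → ℝ := fun t => Real.exp t * deriv u (Real.exp t)
  have hpos : ∀ t, 0 < U t := hL.pos ha hb hc
  refine Q_nonneg h hL.continuous hC (B := fun t => U' t / U t - 1) (κ := 1)
    ((hL.contDiff.2.div hL.contDiff.1 fun t => (hpos t).ne').sub contDiff_const)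
    (fun t => ((hL.hasDerivAt' t).div (hL.hasDerivAt t) (hpos t).ne').sub_const 1)
    (fun t θ _ => ?_)
    contDiff_axisSq axisSq_nonneg norm_fderiv_axisSq
    (fun x hx h0 => by simp [h0, axisSq] at hx) (fun x hx => hx) (.inr fun x hx => hx)
    (fun x hx => ?_)
  · have hp := hpos t
    simp only [bulkCoeff, angularCoeff]
    change _ ≤ 4 + 1 / Real.sin θ ^ 2 + Real.exp (2 * t) * f a b c (U t)
    refine le_of_eq ?_
    rw [bulkF_eq]
    field_simp
    ring
  · simp only [angularCoeff]
    have hr := norm_pos_of_axisSq_pos hx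
    rw [sin_polarAngle_sq x hx, div_le_div_iff₀ hx (by positivity)]
    field_simp
    linarith

theorem IsProfile.Q_two_nonneg (hu : IsProfile a b c u) (ha : 0 < a) (hb : 0 < b) (hc : 0 < c)
    {w : E3 → ℝ} {g : E3 → E3} (h : MemH1 w g) : 0 ≤ Q a b c u 2 w g :=
  hu.Q_one_nonneg ha hb hc h

/-- If `f̃(u) ≥ -4 / r²`, then `sin² θ` is a positive supersolution. -/
theorem IsProfile.Q_three_nonneg_of_le (hu : IsProfile a b c u) (ha : 0 < a) (hb : 0 < b)
    (hc : 0 < c) (hf : ∀ t, 0 ≤ 4 + Real.exp (2 * t) * fTilde a b c (u (Real.exp t)))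
    {w : E3 → ℝ} {g : E3 → E3} (h : MemH1 w g) : 0 ≤ Q a b c u 3 w g := by
  have hL := hu.logProfile
  obtain ⟨C, hC⟩ := hu.exists_abs_bulkCoeff_le ha hb hc 3
  refine Q_nonneg h hL.continuous hC (B := fun _ => -2) (κ := 2) contDiff_const
    (fun t => hasDerivAt_const t _) (fun t θ _ => ?_)
    contDiff_axisSq axisSq_nonneg norm_fderiv_axisSq
    (fun x hx h0 => by simp [h0, axisSq] at hx) (fun x hx => hx) (.inr fun x hx => hx)
    (fun x hx => ?_)
  · simp only [bulkCoeff, angularCoeff]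
    have := hf t
    norm_num
    linarith
  · simp only [angularCoeff]
    have hr := norm_pos_of_axisSq_pos hx
    have h1 := norm_sq_eq x
    rw [sin_polarAngle_sq x hx, div_le_div_iff₀ hx (by positivity)]
    field_simp
    nlinarith [sq_nonneg (x 2)]

/-- For small `a²` one has `f̃(u) ≥ -4 / r²`. Where `a r ≤ 2` this follows from `f̃ ≥ -a²`;
elsewhere the barrier with `σ = b² / (2 c²)` yields `u ≥ σ / 2`, and then `f̃(u) ≥ 0`. -/
theorem IsProfile.fTilde_nonneg (hu : IsProfile a b c u) (ha : 0 < a) (hb : 0 < b) (hc : 0 < c)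
    (hsmall : a < b ^ 2 / (1000 * c)) (t : ℝ) :
    0 ≤ 4 + Real.exp (2 * t) * fTilde a b c (u (Real.exp t)) := by
  have hL := hu.logProfile
  set U : ℝ → ℝ := fun t => u (Real.exp t)
  change 0 ≤ 4 + Real.exp (2 * t) * fTilde a b c (U t)
  have hpos := hL.pos ha hb hc t
  have he := Real.exp_pos (2 * t)
  rw [lt_div_iff₀ (by positivity)] at hsmall
  rcases le_or_gt (a * Real.exp (2 * t)) 4 with hle | hlt
  · have h1 : -a ≤ fTilde a b c (U t) := by
      have : 0 ≤ 2 * b * U t / 3 + 2 * c * U t ^ 2 / 3 := by positivity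
      unfold fTilde; linarith
    nlinarith
  · set σ := b / (2 * c)
    have hσ : 0 < σ := by positivity
    have hσ' : σ < sPlus a b c := by
      have hq : b < Real.sqrt (b ^ 2 + 24 * a * c) := by
        refine Real.lt_sqrt_of_sq_lt ?_
        have : 0 < 24 * a * c := by positivity
        linarith
      unfold sPlus σ
      rw [div_lt_div_iff₀ (by positivity) (by positivity)]
      nlinarith
    -- With this `K` the barrier condition follows from `6 (1 - y) - 40 (1 - y)² < y / 4`.
    set K := Real.sqrt (Real.sqrt (240 * c / b ^ 2))
    have hK0 : 0 < K := by positivity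
    have hK4 : K ^ 4 = 240 * c / b ^ 2 := by
      have : K ^ 4 = (K ^ 2) ^ 2 := by ring
      rw [this, Real.sq_sqrt (by positivity), Real.sq_sqrt (by positivity)]
    have hbar := hL.barrier ha hb hc hσ hσ' hK0 (fun y hy0 hy1 => by
      have hf : f a b c (σ * (1 - y)) ≤ -(b ^ 2 / (6 * c)) * ((1 - y) * y) := by
        have e : f a b c (σ * (1 - y)) = -a - b ^ 2 / (6 * c) * ((1 - y) * y) := by
          unfold f σ; field_simp; ring
        rw [e]; linarith
      have h1 : K ^ 4 / y ^ 4 * (1 - y) * f a b c (σ * (1 - y))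
          ≤ K ^ 4 / y ^ 4 * (1 - y) * (-(b ^ 2 / (6 * c)) * ((1 - y) * y)) := by
        have : 0 ≤ 1 - y := by linarith
        gcongr
      have h2 : K ^ 4 / y ^ 4 * (1 - y) * (-(b ^ 2 / (6 * c)) * ((1 - y) * y))
          = -40 * (1 - y) ^ 2 / y ^ 3 := by
        rw [hK4]; field_simp; ring
      have h3 : -40 * (1 - y) ^ 2 / y ^ 3 ≤ -40 * (1 - y) ^ 2 := by
        rw [div_le_iff₀ (by positivity)]
        have : y ^ 3 ≤ 1 := pow_le_one₀ hy0.le hy1.le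
        nlinarith [sq_nonneg (1 - y)]
      nlinarith [sq_nonneg (80 * (1 - y) - 6.25)]) t
    have hexp : K * Real.exp (-(t / 2)) ≤ 1 / 2 := by
      have h4 : (K * Real.exp (-(t / 2))) ^ 4 ≤ (1 / 2) ^ 4 := by
        have e1 : Real.exp (-(t / 2)) ^ 4 = (Real.exp (2 * t))⁻¹ := by
          rw [← Real.exp_nat_mul, ← Real.exp_neg]; congr 1; push_cast; ring
        rw [mul_pow, hK4, e1, ← div_eq_mul_inv, div_le_iff₀ he, div_le_iff₀ (by positivity)]
        nlinarith
      exact le_of_pow_le_pow_left₀ (by norm_num) (by norm_num) h4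
    have hUσ : σ / 2 ≤ U t := by nlinarith
    have h5 : 0 ≤ fTilde a b c (U t) := by
      have h6 : b * (b / (2 * c)) ≤ 2 * b * U t := by
        simp only [σ] at hUσ
        nlinarith
      have h8 : 3 * a ≤ b * (b / (2 * c)) := by
        rw [mul_div_assoc', le_div_iff₀ (by positivity)]
        nlinarith
      have : 0 ≤ 2 * c * U t ^ 2 / 3 := by positivity
      unfold fTilde
      linarith
    positivity

end

/-! ### Integration in polar coordinates -/

/-- The integral over `ℝ³` of a homogeneous function of degree `n` times a radial function. -/
theorem integral_homogeneous_mul_norm {p : E3 → ℝ} {n : ℕ}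
    (hp : ∀ (r : ℝ) (x : E3), p (r • x) = r ^ n * p x) (h : ℝ → ℝ) :
    ∫ x : E3, p x * h ‖x‖ =
      (∫ y, p y ∂(volume : Measure E3).toSphere) * ∫ r in Set.Ioi (0 : ℝ), r ^ (n + 2) * h r := by
  have hd : Module.finrank ℝ E3 - 1 = 2 := by simp
  have hm := (volume : Measure E3).measurePreserving_homeomorphUnitSphereProd
  rw [hd] at hm
  have e1 : ∫ x : E3, p x * h ‖x‖ =
      ∫ x : ({(0)}ᶜ : Set E3), p x * h ‖x.1‖ ∂((volume : Measure E3).comap (↑)) := by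
    rw [integral_subtype_comap (measurableSet_singleton _).compl fun x : E3 => p x * h ‖x‖,
      restrict_compl_singleton]
  have e2 := hm.integral_comp (Homeomorph.measurableEmbedding _)
    (fun q => p q.1 * ((q.2 : ℝ) ^ n * h q.2))
  rw [e1, show (∫ x : ({(0)}ᶜ : Set E3), p x * h ‖x.1‖ ∂((volume : Measure E3).comap (↑))) = _ from
    (integral_congr_ae (.of_forall fun x => ?_)).trans e2,
    integral_prod_mul (fun y : Metric.sphere (0 : E3) 1 => p y)
      (fun r : Set.Ioi (0 : ℝ) => (r : ℝ) ^ n * h r)]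
  · congr 1
    simp only [Measure.volumeIoiPow, ENNReal.ofReal]
    rw [integral_withDensity_eq_integral_smul (measurable_subtype_coe.pow_const _).real_toNNReal,
      integral_subtype_comap measurableSet_Ioi
        fun r : ℝ => Real.toNNReal (r ^ 2) • (r ^ n * h r)]
    refine setIntegral_congr_fun measurableSet_Ioi fun r hr => ?_
    have hr : (0 : ℝ) < r := hr
    simp only [NNReal.smul_def, Real.coe_toNNReal _ (pow_nonneg hr.le 2), smul_eq_mul]
    ring
  · have hx : (0 : ℝ) < ‖(x : E3)‖ := norm_pos_iff.2 x.2
    simp only [homeomorphUnitSphereProd_apply_fst_coe, homeomorphUnitSphereProd_apply_snd_coe]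
    have e : p x = ‖(x : E3)‖ ^ n * p (‖(x : E3)‖⁻¹ • (x : E3)) := by
      rw [← hp, smul_smul, mul_inv_cancel₀ hx.ne', one_smul]
    rw [e]
    ring

theorem axisSq_smul (r : ℝ) (x : E3) : axisSq (r • x) = r ^ 2 * axisSq x := by
  simp [axisSq]; ring

/-- `4 ∫ sin² θ = 5 ∫ sin⁴ θ` over the unit sphere. -/
theorem integral_sphere_axisSq :
    4 * ∫ y, axisSq (y : Metric.sphere (0 : E3) 1) ∂(volume : Measure E3).toSphere =
      5 * ∫ y, axisSq (y : Metric.sphere (0 : E3) 1) ^ 2 ∂(volume : Measure E3).toSphere := by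
  set h : ℝ → ℝ := fun y => Real.smoothTransition (2 - y)
  set m : E3 → ℝ := fun x => h (‖x‖ ^ 2)
  have hh : ContDiff ℝ ∞ h := Real.smoothTransition.contDiff.comp (contDiff_const.sub contDiff_id)
  have hm : ContDiff ℝ ∞ m := hh.comp (contDiff_norm_sq ℝ)
  have hmc : HasCompactSupport m := by
    refine HasCompactSupport.of_support_subset_isCompact (isCompact_closedBall (0 : E3) 2) ?_
    intro x hx
    rw [mem_closedBall_zero_iff]
    by_contra hlt
    exact hx (Real.smoothTransition.zero_of_nonpos (by nlinarith))
  have hm' : ∀ x v, fderiv ℝ m x v = deriv h (‖x‖ ^ 2) * (2 * inner ℝ x v) := by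
    intro x v
    have e := ((hh.differentiable (by simp)) (‖x‖ ^ 2)).hasDerivAt.comp_hasFDerivAt x
      (hasStrictFDerivAt_norm_sq x).hasFDerivAt
    rw [show fderiv ℝ m x = _ from e.fderiv]
    simp
  -- The field `(P₀, P₁, P₂)` is tangent to the spheres, so that `∇m · P = 0`.
  let p : Fin 3 → E3 → ℝ := ![fun x => axisSq x * x 2 ^ 2 * x 0, fun x => axisSq x * x 2 ^ 2 * x 1,
    fun x => -(axisSq x ^ 2 * x 2)]
  have hs := contDiff_axisSq
  have hp : ∀ j, ContDiff ℝ ∞ (p j) := by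
    intro j
    fin_cases j <;> simp [p] <;> fun_prop
  have hdiv : ∀ x, ∑ j, fderiv ℝ (p j) x (EuclideanSpace.single j 1)
      = axisSq x * (4 * ‖x‖ ^ 2 - 5 * axisSq x) := by
    intro x
    have c := fun i : Fin 3 => (EuclideanSpace.proj i : E3 →L[ℝ] ℝ).hasFDerivAt (x := x)
    have hs' : HasFDerivAt axisSq _ x := ((c 0).pow 2).add ((c 1).pow 2)
    have d0 : HasFDerivAt (p 0) _ x := (hs'.mul ((c 2).pow 2)).mul (c 0)
    have d1 : HasFDerivAt (p 1) _ x := (hs'.mul ((c 2).pow 2)).mul (c 1)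
    have d2 : HasFDerivAt (p 2) _ x := ((hs'.pow 2).mul (c 2)).neg
    rw [Fin.sum_univ_three, d0.fderiv, d1.fderiv, d2.fderiv, norm_sq_eq]
    simp [axisSq]
    ring
  have hibp : ∀ j, Integrable (fun x => fderiv ℝ (p j) x (EuclideanSpace.single j 1) * m x) ∧
      ∫ x, fderiv ℝ (p j) x (EuclideanSpace.single j 1) * m x =
        - ∫ x, p j x * fderiv ℝ m x (EuclideanSpace.single j 1) ∧
      Integrable (fun x => p j x * fderiv ℝ m x (EuclideanSpace.single j 1)) := by
    intro j
    have i1 : Integrable (fun x => fderiv ℝ (p j) x (EuclideanSpace.single j 1) * m x) :=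
      (((hp j).continuous_fderiv_apply (by simp)).comp
        (continuous_id.prodMk continuous_const) |>.mul hm.continuous).integrable_of_hasCompactSupport
        hmc.mul_left
    have i2 : Integrable (fun x => p j x * fderiv ℝ m x (EuclideanSpace.single j 1)) :=
      ((hp j).continuous.mul ((hm.continuous_fderiv_apply (by simp)).comp
        (continuous_id.prodMk continuous_const))).integrable_of_hasCompactSupport
        (hmc.fderiv_apply ℝ _).mul_left
    refine ⟨i1, ?_, i2⟩
    rw [integral_mul_fderiv_eq_neg_fderiv_mul_of_integrable i1 i2
      (((hp j).continuous.mul hm.continuous).integrable_of_hasCompactSupport hmc.mul_left)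
      (fun x _ => (hp j).differentiable (by simp) x) (fun x _ => hm.differentiable (by simp) x),
      neg_neg]
  have hzero : ∫ x : E3, axisSq x * (4 * ‖x‖ ^ 2 - 5 * axisSq x) * m x = 0 := by
    simp only [← hdiv, Finset.sum_mul]
    rw [integral_finsetSum _ fun j _ => (hibp j).1]
    simp only [fun j => (hibp j).2.1]
    rw [Finset.sum_neg_distrib, ← integral_finsetSum _ fun j _ => (hibp j).2.2, neg_eq_zero]
    refine integral_eq_zero_of_ae (.of_forall fun x => ?_)
    simp only [hm', Fin.sum_univ_three, p, Pi.zero_apply, inner_eq_sum]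
    simp [axisSq]
    ring
  have hpol := integral_homogeneous_mul_norm (n := 4)
    (p := fun x => axisSq x * (4 * ‖x‖ ^ 2 - 5 * axisSq x)) (fun r x => by
      rw [axisSq_smul, norm_smul, mul_pow, Real.norm_eq_abs, sq_abs]; ring) (fun r => h (r ^ 2))
  rw [show ∫ x : E3, axisSq x * (4 * ‖x‖ ^ 2 - 5 * axisSq x) * h (‖x‖ ^ 2) = 0 from hzero] at hpol
  have hpos : 0 < ∫ r in Set.Ioi (0 : ℝ), r ^ (4 + 2) * h (r ^ 2) := by
    have hc : Continuous fun r : ℝ => r ^ (4 + 2) * h (r ^ 2) :=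
      (continuous_pow _).mul (hh.continuous.comp (continuous_pow 2))
    have hcs : HasCompactSupport fun r : ℝ => r ^ (4 + 2) * h (r ^ 2) := by
      refine HasCompactSupport.of_support_subset_isCompact (isCompact_Icc (a := (-2 : ℝ)) (b := 2)) ?_
      intro r hr
      have : ¬ (2 - r ^ 2 ≤ 0) := fun hle =>
        hr (by simp [h, Real.smoothTransition.zero_of_nonpos hle])
      constructor <;> nlinarith
    have h0 : ∀ r : ℝ, 0 ≤ r ^ (4 + 2) * h (r ^ 2) := fun r =>
      mul_nonneg (Even.pow_nonneg (by decide) r) (Real.smoothTransition.nonneg _)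
    rw [setIntegral_pos_iff_support_of_nonneg_ae (.of_forall h0)
      (hc.integrable_of_hasCompactSupport hcs).integrableOn]
    refine lt_of_lt_of_le ?_ (measure_mono (s := Set.Ioo (0 : ℝ) 1) fun r hr => ⟨?_, hr.1⟩)
    · simp
    · exact mul_ne_zero (pow_pos hr.1 _).ne'
        (Real.smoothTransition.pos_of_pos (by nlinarith [hr.1, hr.2])).ne'
  have hcont : Continuous fun y : Metric.sphere (0 : E3) 1 => axisSq y :=
    hs.continuous.comp continuous_subtype_val
  have e : ∫ y : Metric.sphere (0 : E3) 1, axisSq y * (4 * ‖(y : E3)‖ ^ 2 - 5 * axisSq y)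
      ∂(volume : Measure E3).toSphere = 0 :=
    (mul_eq_zero.1 hpol.symm).resolve_right hpos.ne'
  have e' : ∀ y : Metric.sphere (0 : E3) 1, axisSq y * (4 * ‖(y : E3)‖ ^ 2 - 5 * axisSq y)
      = 4 * axisSq y - 5 * axisSq y ^ 2 := fun y => by
    rw [norm_eq_of_mem_sphere]; ring
  simp only [e'] at e
  rw [integral_sub, integral_const_mul, integral_const_mul] at e
  · linarith
  · exact (continuous_const.mul hcont).integrable_of_hasCompactSupport
      (HasCompactSupport.of_compactSpace _)
  · exact (continuous_const.mul (hcont.pow 2)).integrable_of_hasCompactSupport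
      (HasCompactSupport.of_compactSpace _)

theorem integral_sphere_axisSq_sq_pos :
    0 < ∫ y, axisSq (y : Metric.sphere (0 : E3) 1) ^ 2 ∂(volume : Measure E3).toSphere := by
  refine Continuous.integral_pos_of_hasCompactSupport_nonneg_nonzero
    (x := ⟨EuclideanSpace.single 0 1, by simp⟩)
    ((contDiff_axisSq.continuous.comp continuous_subtype_val).pow 2)
    (HasCompactSupport.of_compactSpace _) (fun y => sq_nonneg _) ?_
  simp [axisSq]

theorem integral_Ioi_eq_integral_exp (g : ℝ → ℝ) :
    ∫ r in Set.Ioi (0 : ℝ), g r = ∫ t, Real.exp t * g (Real.exp t) := by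
  have h := integral_image_eq_integral_abs_deriv_smul (s := Set.univ) MeasurableSet.univ
    (fun t _ => (Real.hasDerivAt_exp t).hasDerivWithinAt) Real.exp_injective.injOn g
  rw [Set.image_univ, Real.range_exp, setIntegral_univ] at h
  simpa using h

theorem integral_homogeneous_mul_log_norm {p : E3 → ℝ} {n : ℕ}
    (hp : ∀ (r : ℝ) (x : E3), p (r • x) = r ^ n * p x) (q : ℝ → ℝ) :
    ∫ x : E3, p x * (q (Real.log ‖x‖) / ‖x‖ ^ (n + 2)) =
      (∫ y, p y ∂(volume : Measure E3).toSphere) * ∫ t, Real.exp t * q t := by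
  rw [integral_homogeneous_mul_norm hp fun r => q (Real.log r) / r ^ (n + 2),
    integral_Ioi_eq_integral_exp]
  congr 1
  refine integral_congr_ae (.of_forall fun t => ?_)
  have := (pow_pos (Real.exp_pos t) (n + 2)).ne'
  simp only [Real.log_exp]
  rw [mul_div_cancel₀ _ this]

/-! ### The third functional on products of `sin² θ` and a radial function -/

/-- The function `k(log r) sin² θ`, with the value `0` at the origin. -/
def sinSqMul (k : ℝ → ℝ) (x : E3) : ℝ := axisSq x / ‖x‖ ^ 2 * k (Real.log ‖x‖)

theorem HasCompactSupport.exists_eq_zero_of_lt_abs {k : ℝ → ℝ} (hk : HasCompactSupport k) :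
    ∃ M, ∀ t, M < |t| → k t = 0 := by
  obtain ⟨M, hM⟩ := hk.isCompact.isBounded.subset_closedBall 0
  refine ⟨M, fun t ht => image_eq_zero_of_notMem_tsupport fun h => ?_⟩
  have := hM h
  rw [mem_closedBall_zero_iff, Real.norm_eq_abs] at this
  linarith

theorem eq_zero_of_norm_lt_exp {k : ℝ → ℝ} {M : ℝ} (hM : ∀ t, M < |t| → k t = 0) {x : E3}
    (hx0 : x ≠ 0) (hx : ‖x‖ < Real.exp (-M)) : k (Real.log ‖x‖) = 0 := by
  refine hM _ (lt_of_lt_of_le ?_ (neg_le_abs _))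
  have := (Real.log_lt_iff_lt_exp (norm_pos_iff.2 hx0)).2 hx
  linarith

theorem eq_zero_of_exp_lt_norm {k : ℝ → ℝ} {M : ℝ} (hM : ∀ t, M < |t| → k t = 0) {x : E3}
    (hx : Real.exp M < ‖x‖) : k (Real.log ‖x‖) = 0 := by
  refine hM _ (lt_of_lt_of_le ?_ (le_abs_self _))
  exact (Real.lt_log_iff_exp_lt ((Real.exp_pos M).trans hx)).2 hx

theorem eventually_sinSqMul_eq_zero {k : ℝ → ℝ} (hk : HasCompactSupport k) :
    ∀ᶠ x in 𝓝 (0 : E3), sinSqMul k x = 0 := by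
  obtain ⟨M, hM⟩ := HasCompactSupport.exists_eq_zero_of_lt_abs hk
  filter_upwards [Metric.ball_mem_nhds (0 : E3) (Real.exp_pos (-M))] with x hx
  by_cases h0 : x = 0
  · simp [sinSqMul, h0]
  · rw [sinSqMul, eq_zero_of_norm_lt_exp hM h0 (by simpa using hx), mul_zero]

theorem contDiff_sinSqMul {k : ℝ → ℝ} (hk : ContDiff ℝ ∞ k) (hkc : HasCompactSupport k) :
    ContDiff ℝ ∞ (sinSqMul k) := by
  refine contDiff_iff_contDiffAt.2 fun x => ?_
  by_cases h0 : x = 0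
  · rw [h0]
    exact contDiffAt_const.congr_of_eventuallyEq (eventually_sinSqMul_eq_zero hkc)
  · have hn : ContDiffAt ℝ ∞ (fun x : E3 => ‖x‖) x := contDiffAt_norm ℝ h0
    have hr : ‖x‖ ≠ 0 := norm_ne_zero_iff.2 h0
    exact (contDiff_axisSq.contDiffAt.div (hn.pow 2) (pow_ne_zero 2 hr)).mul
      (hk.contDiffAt.comp x (hn.log hr))

theorem hasCompactSupport_sinSqMul {k : ℝ → ℝ} (hkc : HasCompactSupport k) :
    HasCompactSupport (sinSqMul k) := by
  obtain ⟨M, hM⟩ := HasCompactSupport.exists_eq_zero_of_lt_abs hkc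
  refine HasCompactSupport.of_support_subset_isCompact
    (isCompact_closedBall (0 : E3) (Real.exp M)) fun x hx => ?_
  rw [mem_closedBall_zero_iff]
  by_contra hlt
  exact hx (by rw [sinSqMul, eq_zero_of_exp_lt_norm hM (not_le.1 hlt), mul_zero])

theorem sinSqMul_eq (k : ℝ → ℝ) (x : E3) : sinSqMul k x =
    if ‖x‖ = 0 then 0 else Real.sin (polarAngle x) ^ 2 * k (Real.log ‖x‖) := by
  split_ifs with h
  · simp [sinSqMul, h]
  · rw [sinSqMul, Real.sin_sq, cos_polarAngle, div_pow]
    have := norm_sq_eq x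
    congr 1
    field_simp
    linarith

theorem fderiv_sinSqMul {k : ℝ → ℝ} {k' : ℝ} {x : E3} (h0 : x ≠ 0)
    (hk : HasDerivAt k k' (Real.log ‖x‖)) (v : E3) :
    fderiv ℝ (sinSqMul k) x v =
      (2 * x 0 * v 0 + 2 * x 1 * v 1) / ‖x‖ ^ 2 * k (Real.log ‖x‖)
      + axisSq x * inner ℝ x v / ‖x‖ ^ 4 * (k' - 2 * k (Real.log ‖x‖)) := by
  have hr := norm_pos_iff.2 h0
  have hq : HasFDerivAt (fun x : E3 => ‖x‖ ^ 2) (2 • innerSL ℝ x) x :=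
    (hasStrictFDerivAt_norm_sq x).hasFDerivAt
  have hlog : ∀ y : E3, Real.log (‖y‖ ^ 2) * (1 / 2) = Real.log ‖y‖ := fun y => by
    rw [Real.log_pow]; push_cast; ring
  rw [← hlog] at hk
  have hl := hk.comp_hasFDerivAt x ((hq.log (pow_pos hr 2).ne').mul_const (1 / 2 : ℝ))
  have hi := (hasDerivAt_inv (pow_pos hr 2).ne').comp_hasFDerivAt x hq
  have hw := ((hasFDerivAt_axisSq x).mul hi).mul hl
  have e : sinSqMul k = (axisSq * (fun y : ℝ => y⁻¹) ∘ fun x : E3 => ‖x‖ ^ 2)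
      * (k ∘ fun x : E3 => Real.log (‖x‖ ^ 2) * (1 / 2)) := by
    funext y
    simp only [sinSqMul, Pi.mul_apply, Function.comp, div_eq_mul_inv]
    rw [← hlog y, div_eq_mul_inv]
  rw [e, hw.fderiv]
  simp only [add_apply, smul_apply, Function.comp, hlog]
  simp
  field_simp
  ring

theorem inner_gradient_sinSqMul {k : ℝ → ℝ} {k' : ℝ} {x : E3} (hx : 0 < axisSq x)
    (hk : HasDerivAt k k' (Real.log ‖x‖)) :
    inner ℝ (gradient (sinSqMul k) x) (radialUnit x) = axisSq x / ‖x‖ ^ 3 * k' ∧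
    inner ℝ (gradient (sinSqMul k) x) (polarUnit x) =
      2 * x 2 * Real.sqrt (axisSq x) / ‖x‖ ^ 3 * k (Real.log ‖x‖) := by
  have hr := norm_pos_of_axisSq_pos hx
  have hs := Real.sqrt_pos.2 hx
  have hn := norm_sq_eq x
  have e := fderiv_sinSqMul (norm_pos_iff.1 hr) hk
  simp only [gradient, InnerProductSpace.toDual_symm_apply, e, radialUnit_eq hx, polarUnit_eq hx,
    inner_eq_sum, Fin.sum_univ_three]
  have hσ := Real.sq_sqrt hx.le
  set σ := Real.sqrt (axisSq x)
  rw [← hσ] at hn ⊢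
  have hσ' : x 0 ^ 2 + x 1 ^ 2 = σ ^ 2 := hσ.symm
  set r := ‖x‖
  have hx0 : x 0 ^ 2 = σ ^ 2 - x 1 ^ 2 := by linarith
  have hx2 : x 2 ^ 2 = r ^ 2 - σ ^ 2 := by linarith
  constructor
  · simp
    field_simp
    rw [hx0, hx2]
    ring
  · simp
    field_simp
    rw [hx0]
    ring

theorem continuous_sinSqMul {k : ℝ → ℝ} (hk : Continuous k) (hkc : HasCompactSupport k) :
    Continuous (sinSqMul k) := by
  refine continuous_iff_continuousAt.2 fun x => ?_
  by_cases h0 : x = 0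
  · rw [h0]
    exact continuousAt_const.congr (EventuallyEq.symm (eventually_sinSqMul_eq_zero hkc))
  · have hr : ‖x‖ ≠ 0 := norm_ne_zero_iff.2 h0
    exact (contDiff_axisSq.continuous.continuousAt.div (continuous_norm.continuousAt.pow 2)
      (pow_ne_zero 2 hr)).mul
        (hk.continuousAt.comp (continuous_norm.continuousAt.log hr))

/-- For a product `sin² θ k(log r)`, the functional `𝒬₃` reduces to a one-dimensional integral. The
angular derivative and the angular coefficient contribute `-6 sin⁴ θ + 8 sin² θ`, which by
`integral_sphere_axisSq` amounts to `4 sin⁴ θ`. -/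
theorem Q_three_sinSqMul (a b c : ℝ) {u : ℝ → ℝ} (hU : Continuous fun t => u (Real.exp t))
    {k k' : ℝ → ℝ} (hk : ∀ t, HasDerivAt k (k' t) t) (hk' : Continuous k')
    (hkc : HasCompactSupport k) :
    Q a b c u 3 (sinSqMul k) (gradient (sinSqMul k)) =
      (((∫ y, axisSq (y : Metric.sphere (0 : E3) 1) ^ 2 ∂(volume : Measure E3).toSphere)
        * ∫ t, Real.exp t * (k' t ^ 2
          + (4 + Real.exp (2 * t) * fTilde a b c (u (Real.exp t))) * k t ^ 2) : ℝ) : EReal) := by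
  have hkcont : Continuous k := continuous_iff_continuousAt.2 fun t => (hk t).continuousAt
  have hkc' : HasCompactSupport k' := by
    have : k' = deriv k := funext fun t => (hk t).deriv.symm
    rw [this]
    exact hkc.deriv
  set p : ℝ → ℝ := fun t => k' t ^ 2
    + (-6 + Real.exp (2 * t) * fTilde a b c (u (Real.exp t))) * k t ^ 2
  have hft := (continuous_bulkCoeff a b c 3).comp hU
  have hpc : Continuous p := (hk'.pow 2).add ((continuous_const.add
    ((Real.continuous_exp.comp (continuous_const.mul continuous_id)).mul hft)).mul (hkcont.pow 2))
  have hps : HasCompactSupport p := by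
    obtain ⟨M, hM⟩ := HasCompactSupport.exists_eq_zero_of_lt_abs hkc
    obtain ⟨M', hM'⟩ := HasCompactSupport.exists_eq_zero_of_lt_abs hkc'
    refine HasCompactSupport.of_support_subset_isCompact
      (isCompact_closedBall (0 : ℝ) (max M M')) fun t ht => ?_
    rw [mem_closedBall_zero_iff, Real.norm_eq_abs]
    by_contra hlt
    obtain ⟨h1, h2⟩ := max_lt_iff.1 (not_le.1 hlt)
    exact ht (by simp [p, hM t h1, hM' t h2])
  set q : ℝ → ℝ := fun t => 8 * k t ^ 2
  have hqc : Continuous q := continuous_const.mul (hkcont.pow 2)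
  have hqs : HasCompactSupport q := hkc.comp_left (g := fun y => 8 * y ^ 2) (by simp)
  have hexp : ∀ (n : ℕ) {x : E3}, 0 < ‖x‖ → Real.exp (-(n * Real.log ‖x‖)) = 1 / ‖x‖ ^ n := by
    intro n x hx
    rw [Real.exp_neg, Real.exp_nat_mul, Real.exp_log hx, one_div]
  -- The two parts of the density, and their continuous representatives.
  have i1 : Integrable fun x : E3 => axisSq x ^ 2 * (p (Real.log ‖x‖) / ‖x‖ ^ (4 + 2)) := by
    have hG : Continuous fun t => Real.exp (-((4 : ℕ) * t)) * p t :=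
      (by fun_prop : Continuous fun t : ℝ => Real.exp (-((4 : ℕ) * t))).mul hpc
    refine ((contDiff_axisSq.continuous.mul (continuous_sinSqMul hG
      hps.mul_left)).integrable_of_hasCompactSupport
        (hasCompactSupport_sinSqMul hps.mul_left).mul_left).congr ?_
    filter_upwards [ae_axisSq_pos] with x hx
    have hr := norm_pos_of_axisSq_pos hx
    simp only [Pi.mul_apply, sinSqMul, hexp 4 hr]
    field_simp
    ring
  have i2 : Integrable fun x : E3 => axisSq x * (q (Real.log ‖x‖) / ‖x‖ ^ (2 + 2)) := by
    have hG : Continuous fun t => Real.exp (-((2 : ℕ) * t)) * q t :=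
      (by fun_prop : Continuous fun t : ℝ => Real.exp (-((2 : ℕ) * t))).mul hqc
    refine ((continuous_sinSqMul hG hqs.mul_left).integrable_of_hasCompactSupport
        (hasCompactSupport_sinSqMul hqs.mul_left)).congr ?_
    filter_upwards [ae_axisSq_pos] with x hx
    have hr := norm_pos_of_axisSq_pos hx
    rw [sinSqMul, hexp 2 hr]
    field_simp
    ring
  have hD : density a b c u 3 (sinSqMul k) (gradient (sinSqMul k)) =ᵐ[volume] fun x =>
      axisSq x ^ 2 * (p (Real.log ‖x‖) / ‖x‖ ^ (4 + 2))
        + axisSq x * (q (Real.log ‖x‖) / ‖x‖ ^ (2 + 2)) := by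
    filter_upwards [ae_axisSq_pos] with x hx
    have hr := norm_pos_of_axisSq_pos hx
    obtain ⟨e1, e2⟩ := inner_gradient_sinSqMul hx (hk (Real.log ‖x‖))
    have e3 : Real.exp (2 * Real.log ‖x‖) = ‖x‖ ^ 2 := by
      rw [two_mul, Real.exp_add, Real.exp_log hr]; ring
    have e4 : x 2 ^ 2 = ‖x‖ ^ 2 - axisSq x := by rw [norm_sq_eq]; ring
    rw [density_eq a b c u 3 _ _ hx, e1, e2]
    simp only [potential, angularCoeff, bulkCoeff, p, q, sinSqMul, e3, sin_polarAngle_sq x hx,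
      div_pow, mul_pow, Real.sq_sqrt hx.le, e4]
    field_simp
    ring
  rw [Q, extIntegral_congr hD]
  refine (extIntegral_eq_integral (i1.add i2)).trans ?_
  rw [integral_add' i1 i2,
    integral_homogeneous_mul_log_norm (p := fun x => axisSq x ^ 2) (n := 4) (fun r x => by
      rw [axisSq_smul]; ring),
    integral_homogeneous_mul_log_norm (p := axisSq) (n := 2) axisSq_smul]
  have hs := integral_sphere_axisSq
  have j1 : Integrable fun t => Real.exp t * p t :=
    (Real.continuous_exp.mul hpc).integrable_of_hasCompactSupport hps.mul_left
  have j2 : Integrable fun t => Real.exp t * q t :=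
    (Real.continuous_exp.mul hqc).integrable_of_hasCompactSupport hqs.mul_left
  have e : ∫ t, Real.exp t * (k' t ^ 2
      + (4 + Real.exp (2 * t) * fTilde a b c (u (Real.exp t))) * k t ^ 2)
      = (∫ t, Real.exp t * p t) + 5 / 4 * ∫ t, Real.exp t * q t := by
    rw [← integral_const_mul, ← integral_add j1 (j2.const_mul _)]
    refine integral_congr_ae (.of_forall fun t => ?_)
    simp only [p, q]
    ring
  rw [e]
  congr 1
  linear_combination (1 / 4 * ∫ t, Real.exp t * q t) * hs

section

/-! ### Instability for large `a²` -/

/-- A bump function to the right of `4` whose Dirichlet integral is small. -/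
theorem exists_bump : ∃ (ξ : ℝ → ℝ) (R : ℝ), ContDiff ℝ ∞ ξ ∧ HasCompactSupport ξ ∧
    tsupport ξ ⊆ Set.Icc 4 R ∧ 8 * ∫ t, deriv ξ t ^ 2 < ∫ t, ξ t ^ 2 := by
  let φ : ContDiffBump (0 : ℝ) := ⟨1, 2, one_pos, one_lt_two⟩
  have hφ : ContDiff ℝ ∞ φ := φ.contDiff
  set A := ∫ t, deriv φ t ^ 2
  set B := ∫ t, φ t ^ 2
  have hB : 0 < B := by
    refine Continuous.integral_pos_of_hasCompactSupport_nonneg_nonzero (x := 0)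
      (φ.continuous.pow 2) (φ.hasCompactSupport.comp_left (g := fun y => y ^ 2) (by simp))
      (fun y => sq_nonneg _) ?_
    rw [φ.one_of_mem_closedBall (by simp [φ])]
    norm_num
  have hA : 0 ≤ A := integral_nonneg fun t => sq_nonneg _
  -- Stretching by the factor `L` multiplies the two integrals by `1 / L` and `L`.
  set L := 1 + 8 * A / B
  have hL : 1 ≤ L := le_add_of_nonneg_right (by positivity)
  have hL0 : L ≠ 0 := by positivity
  have hd : ∀ t, HasDerivAt (fun t => φ (t / L - (4 / L + 2)))
      (deriv φ (t / L - (4 / L + 2)) / L) t := by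
    intro t
    have h1 := ((hφ.differentiable (by simp)) (t / L - (4 / L + 2))).hasDerivAt.comp t
      (((hasDerivAt_id t).div_const L).sub_const (4 / L + 2))
    exact h1.congr_deriv (by simp [div_eq_mul_inv])
  have hsupp : ∀ t, φ (t / L - (4 / L + 2)) ≠ 0 → 4 ≤ t ∧ t ≤ 4 + 4 * L := by
    intro t ht
    have h1 : t / L - (4 / L + 2) ∈ Metric.ball (0 : ℝ) 2 := by
      have : Function.support φ = Metric.ball 0 2 := φ.support_eq
      rw [← this]; exact ht
    rw [mem_ball_zero_iff, Real.norm_eq_abs, abs_lt] at h1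
    have h2 : t = L * (t / L - (4 / L + 2)) + 4 + 2 * L := by field_simp; ring
    constructor <;> nlinarith [h1.1, h1.2]
  refine ⟨fun t => φ (t / L - (4 / L + 2)), 4 + 4 * L, hφ.comp (by fun_prop), ?_,
    closure_minimal hsupp isClosed_Icc, ?_⟩
  · exact HasCompactSupport.of_support_subset_isCompact isCompact_Icc fun t ht => hsupp t ht
  · simp only [fun t => (hd t).deriv, div_pow]
    rw [integral_div, Measure.integral_comp_div (fun y => deriv φ (y - (4 / L + 2)) ^ 2) L,
      Measure.integral_comp_div (fun y => φ (y - (4 / L + 2)) ^ 2) L,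
      integral_sub_right_eq_self (fun y => deriv φ y ^ 2),
      integral_sub_right_eq_self (fun y => φ y ^ 2), abs_of_pos (by positivity), smul_eq_mul,
      smul_eq_mul]
    change 8 * (L * A / L ^ 2) < L * B
    have h1 : L * B = B + 8 * A := by simp only [L]; field_simp
    have h2 : 8 * (L * A / L ^ 2) ≤ 8 * A := by
      rw [show 8 * (L * A / L ^ 2) = 8 * A / L by field_simp]
      exact div_le_self (by positivity) hL
    linarith

namespace LogProfile

variable {a b c : ℝ} {U U' : ℝ → ℝ}

/-- The one-dimensional quadratic form at `U η`, with `η = e^{-t/2} ξ`. Since `U` solves the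
equation with `f` in place of `f̃ = f + b² u`, the derivatives of `U` can be integrated away. -/
theorem integral_mul_exp_mul (h : LogProfile a b c U U') {ξ : ℝ → ℝ} (hξ : ContDiff ℝ ∞ ξ)
    (hξc : HasCompactSupport ξ) :
    ∫ t, Real.exp t * ((Real.exp (-(t / 2)) * (U' t * ξ t + U t * (deriv ξ t - ξ t / 2))) ^ 2
      + (4 + Real.exp (2 * t) * fTilde a b c (U t)) * (Real.exp (-(t / 2)) * (U t * ξ t)) ^ 2) =
    ∫ t, U t ^ 2 * (deriv ξ t ^ 2 - ξ t * deriv ξ t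
      + (-(7 / 4) + Real.exp (2 * t) * (b * U t)) * ξ t ^ 2) := by
  have hU := h.continuous
  have hU' := h.continuous'
  have hξ' : Continuous (deriv ξ) := hξ.continuous_deriv (by simp)
  have hf : Continuous (f a b c) := by unfold f; fun_prop
  set G' : ℝ → ℝ := fun t => U' t ^ 2 * ξ t ^ 2 - U t * U' t * ξ t ^ 2
    + (6 + Real.exp (2 * t) * f a b c (U t)) * U t ^ 2 * ξ t ^ 2 + 2 * U t * U' t * ξ t * deriv ξ t
  set T : ℝ → ℝ := fun t => U t ^ 2 * (deriv ξ t ^ 2 - ξ t * deriv ξ t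
      + (-(7 / 4) + Real.exp (2 * t) * (b * U t)) * ξ t ^ 2)
  have hG : ∀ t, HasDerivAt (fun t => U t * U' t * ξ t ^ 2) (G' t) t := by
    intro t
    have h1 := ((h.hasDerivAt t).mul (h.hasDerivAt' t)).mul
      (((hξ.differentiable (by simp)) t).hasDerivAt.pow 2)
    refine h1.congr_deriv ?_
    simp only [Pi.mul_apply, Pi.pow_apply, G', bulkF_eq]
    ring
  have hcs : ∀ F : ℝ → ℝ, (∀ t, ξ t = 0 → deriv ξ t = 0 → F t = 0) → HasCompactSupport F := by
    intro F hF
    refine HasCompactSupport.intro hξc.isCompact fun t ht => ?_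
    refine hF t (image_eq_zero_of_notMem_tsupport ht) (image_eq_zero_of_notMem_tsupport ?_)
    exact fun h => ht (tsupport_deriv_subset h)
  have iG' : Integrable G' := Continuous.integrable_of_hasCompactSupport
    (by have := hf.comp hU; simp only [G']; fun_prop) (hcs _ fun t h1 h2 => by simp [G', h1])
  have iG : Integrable fun t => U t * U' t * ξ t ^ 2 := Continuous.integrable_of_hasCompactSupport
    (by have := hξ.continuous; fun_prop) (hcs _ fun t h1 h2 => by simp [h1])
  have iT : Integrable T := Continuous.integrable_of_hasCompactSupport
    (by have := hξ.continuous; simp only [T]; fun_prop) (hcs _ fun t h1 h2 => by simp [T, h1, h2])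
  have e : ∫ t, (T t + G' t) = ∫ t, T t := by
    rw [integral_add iT iG', integral_eq_zero_of_hasDerivAt_of_integrable hG iG' iG, add_zero]
  rw [← e]
  refine integral_congr_ae (.of_forall fun t => ?_)
  have e1 : Real.exp t * Real.exp (-(t / 2)) ^ 2 = 1 := by
    rw [← Real.exp_nat_mul, ← Real.exp_add, Real.exp_eq_one_iff]; push_cast; ring
  have e2 : fTilde a b c (U t) = f a b c (U t) + b * U t := by unfold fTilde f; ring
  simp only [e2, T, G']
  linear_combination ((U' t * ξ t + U t * (deriv ξ t - ξ t / 2)) ^ 2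
    + (4 + Real.exp (2 * t) * (f a b c (U t) + b * U t)) * (U t * ξ t) ^ 2) * e1

/-- With `σ = (3a² / 2c²)^{1/2}`, the leading part of `s₊`, the profile is at least `3σ/4` where
`a r ≥ e⁴`. -/
theorem three_fourths_mul_le (h : LogProfile a b c U U') (ha : 0 < a) (hb : 0 < b) (hc : 0 < c)
    {t : ℝ} (ht : Real.exp 8 ≤ a * Real.exp (2 * t)) : 3 / 4 * Real.sqrt (3 * a / (2 * c)) ≤ U t := by
  set σ := Real.sqrt (3 * a / (2 * c))
  have hσ : 0 < σ := Real.sqrt_pos.2 (by positivity)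
  have hσ2 : σ ^ 2 = 3 * a / (2 * c) := Real.sq_sqrt (by positivity)
  have hσ3 : 2 * c * σ ^ 2 = 3 * a := by rw [hσ2]; field_simp
  have hσ' : σ < sPlus a b c := by
    have h1 := f_factor ha hb hc σ
    have h2 : f a b c σ < 0 := by unfold f; nlinarith [mul_pos hb hσ]
    have hs := sPlus_pos ha hb hc
    have h3 : 0 < 2 * c * σ / 3 + a / sPlus a b c := by positivity
    rw [h1] at h2
    linarith [neg_of_mul_neg_left h2 h3.le]
  -- With `K⁴ = 6 / a²` the left-hand side of the barrier condition is not positive.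
  set K := Real.sqrt (Real.sqrt (6 / a))
  have hK0 : 0 < K := Real.sqrt_pos.2 (Real.sqrt_pos.2 (by positivity))
  have hK4 : K ^ 4 = 6 / a := by
    rw [show K ^ 4 = (K ^ 2) ^ 2 by ring, Real.sq_sqrt (Real.sqrt_nonneg _),
      Real.sq_sqrt (by positivity)]
  have hbar := h.barrier ha hb hc hσ hσ' hK0 (fun y hy hy1 => ?_) t
  · have h1 : K * Real.exp (-(t / 2)) ≤ 1 / 4 := by
      refine le_of_pow_le_pow_left₀ (n := 4) (by norm_num) (by norm_num) ?_
      rw [mul_pow, hK4, ← Real.exp_nat_mul]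
      have h8 : (1536 : ℝ) ≤ Real.exp 8 := by
        have := Real.exp_one_gt_d9
        rw [show (8 : ℝ) = (8 : ℕ) * 1 by norm_num, Real.exp_nat_mul]
        calc (1536 : ℝ) ≤ 2.7 ^ 8 := by norm_num
          _ ≤ _ := pow_le_pow_left₀ (by norm_num) (by linarith) 8
      have e : Real.exp ((4 : ℕ) * -(t / 2)) = 1 / Real.exp (2 * t) := by
        rw [one_div, ← Real.exp_neg]; congr 1; push_cast; ring
      rw [e, div_mul_div_comm, div_pow, div_le_div_iff₀ (by positivity) (by norm_num)]
      linarith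
    nlinarith
  · have hf : f a b c (σ * (1 - y)) ≤ -(a * y) := by
      unfold f
      have h1 : 2 * c * (σ * (1 - y)) ^ 2 / 3 = a * (1 - y) ^ 2 := by
        rw [mul_pow]; linear_combination ((1 - y) ^ 2 / 3) * hσ3
      rw [h1]
      have h2 : 0 ≤ b * (σ * (1 - y)) := by
        have : 0 < 1 - y := by linarith
        positivity
      nlinarith [mul_pos (mul_pos ha hy) (sub_pos.2 hy1)]
    have hy' : 0 < 1 - y := by linarith
    have h1 : K ^ 4 / y ^ 4 * (1 - y) * f a b c (σ * (1 - y)) ≤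
        K ^ 4 / y ^ 4 * (1 - y) * -(a * y) :=
      mul_le_mul_of_nonneg_left hf (by positivity)
    have h2 : K ^ 4 / y ^ 4 * (1 - y) * -(a * y) = -(6 * (1 - y) / y ^ 3) := by
      rw [hK4]; field_simp
    have h3 : 6 * (1 - y) ≤ 6 * (1 - y) / y ^ 3 := by
      rw [le_div_iff₀ (by positivity)]
      exact mul_le_of_le_one_right (by positivity) (pow_le_one₀ hy.le hy1.le)
    linarith

theorem sPlus_le (ha : 0 < a) (hb : 0 < b) (hc : 0 < c) (hab : b ^ 2 ≤ a * c) :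
    sPlus a b c ≤ 3 / 2 * Real.sqrt (3 * a / (2 * c)) := by
  set σ := Real.sqrt (3 * a / (2 * c))
  have hσ : 0 < σ := Real.sqrt_pos.2 (by positivity)
  have hσ2 : σ ^ 2 = 3 * a / (2 * c) := Real.sq_sqrt (by positivity)
  have hσ3 : 2 * c * σ ^ 2 = 3 * a := by rw [hσ2]; field_simp
  have hbσ : b * σ ≤ 5 / 2 * a := by
    refine abs_le_of_sq_le_sq' ?_ (by positivity) |>.2
    have : b ^ 2 * (2 * c * σ ^ 2) ≤ a * c * (3 * a) := by
      rw [hσ3]; exact mul_le_mul_of_nonneg_right hab (by positivity)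
    have h2 : b ^ 2 * σ ^ 2 ≤ 3 / 2 * a ^ 2 := by
      refine le_of_mul_le_mul_left ?_ hc
      nlinarith
    rw [mul_pow]
    nlinarith [sq_nonneg a]
  have h1 := f_factor ha hb hc (3 / 2 * σ)
  have h2 : 0 ≤ f a b c (3 / 2 * σ) := by unfold f; nlinarith
  have hs := sPlus_pos ha hb hc
  have h3 : 0 < 2 * c * (3 / 2 * σ) / 3 + a / sPlus a b c := by positivity
  rw [h1] at h2
  linarith [nonneg_of_mul_nonneg_left h2 h3]

theorem integrable_sq_of_hasCompactSupport {g : ℝ → ℝ} (hg : Continuous g)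
    (hgc : HasCompactSupport g) : Integrable fun t => g t ^ 2 := by
  have h : HasCompactSupport fun t => g t ^ 2 :=
    hgc.comp_left (g := fun y : ℝ => y ^ 2) (zero_pow two_ne_zero)
  exact (hg.pow 2).integrable_of_hasCompactSupport h

theorem sq_mul_quadratic_le {v m q x y : ℝ} (hm : 0 < m) (h1 : m ≤ v) (h2 : v ≤ 2 * m)
    (hq : q ≤ 1 / 2) :
    v ^ 2 * (y ^ 2 - x * y + (-(7 / 4) + q) * x ^ 2) ≤ m ^ 2 * (8 * y ^ 2 - x ^ 2) := by
  have h3 : y ^ 2 - x * y + (-(7 / 4) + q) * x ^ 2 ≤ 2 * y ^ 2 - x ^ 2 := by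
    have := mul_le_mul_of_nonneg_right hq (sq_nonneg x)
    linarith [sq_nonneg (y + x / 2), add_sq y (x / 2)]
  have h4 : v ^ 2 ≤ 4 * m ^ 2 := by nlinarith
  have h5 : m ^ 2 ≤ v ^ 2 := by nlinarith
  have h6 := mul_le_mul_of_nonneg_left h3 (sq_nonneg v)
  have h7 := mul_le_mul_of_nonneg_right h4 (sq_nonneg y)
  have h8 := mul_le_mul_of_nonneg_right h5 (sq_nonneg x)
  linarith

/-- If `a²` is large compared with `b⁴ / c²`, then the one-dimensional form is negative at a bump
function in the variable `log (a r)`: there the profile lies between `m` and `2m`, and the term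
`r² b² u` is at most `1/2`. -/
theorem exists_integral_neg (h : LogProfile a b c U U') (ha : 0 < a) (hb : 0 < b) (hc : 0 < c)
    {ξ : ℝ → ℝ} {R : ℝ} (hξ : ContDiff ℝ ∞ ξ) (hξc : HasCompactSupport ξ)
    (hsupp : tsupport ξ ⊆ Set.Icc 4 R) (hlt : 8 * ∫ t, deriv ξ t ^ 2 < ∫ t, ξ t ^ 2)
    (hab : b ^ 2 ≤ a * c) (habR : 27 * b ^ 2 * Real.exp (4 * R) ≤ 2 * (a * c)) :
    ∃ ζ : ℝ → ℝ, ContDiff ℝ ∞ ζ ∧ HasCompactSupport ζ ∧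
      ∫ t, U t ^ 2 * (deriv ζ t ^ 2 - ζ t * deriv ζ t
        + (-(7 / 4) + Real.exp (2 * t) * (b * U t)) * ζ t ^ 2) < 0 := by
  set s := Real.log a / 2
  have hes : Real.exp (2 * s) = a := by
    rw [show 2 * s = Real.log a by simp only [s]; ring, Real.exp_log ha]
  set σ := Real.sqrt (3 * a / (2 * c))
  have hσ : 0 < σ := Real.sqrt_pos.2 (by positivity)
  have hσ2 : σ ^ 2 = 3 * a / (2 * c) := Real.sq_sqrt (by positivity)
  have hσ3 : 2 * c * σ ^ 2 = 3 * a := by rw [hσ2]; field_simp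
  have hle := sPlus_le ha hb hc hab
  have hbσ : 3 * b * σ * Real.exp (2 * R) ≤ a := by
    refine abs_le_of_sq_le_sq' ?_ ha.le |>.2
    refine le_of_mul_le_mul_left ?_ (by positivity : 0 < 2 * c)
    have e : Real.exp (2 * R) ^ 2 = Real.exp (4 * R) := by
      rw [← Real.exp_nat_mul]; congr 1; push_cast; ring
    calc 2 * c * (3 * b * σ * Real.exp (2 * R)) ^ 2
        = 9 * b ^ 2 * Real.exp (4 * R) * (2 * c * σ ^ 2) := by rw [← e]; ring
      _ = a * (27 * b ^ 2 * Real.exp (4 * R)) := by rw [hσ3]; ring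
      _ ≤ a * (2 * (a * c)) := mul_le_mul_of_nonneg_left habR ha.le
      _ = 2 * c * a ^ 2 := by ring
  have hζ : ContDiff ℝ ∞ fun t => ξ (t + s) := hξ.comp (by fun_prop)
  have hζc : HasCompactSupport fun t => ξ (t + s) :=
    hξc.comp_homeomorph (Homeomorph.addRight s)
  have hd : ∀ t, deriv (fun t => ξ (t + s)) t = deriv ξ (t + s) := fun t => deriv_comp_add_const ..
  refine ⟨fun t => ξ (t + s), hζ, hζc, ?_⟩
  simp only [hd]
  set m := 3 / 4 * σ
  have hm : 0 < m := by positivity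
  have hpt : ∀ t, U t ^ 2 * (deriv ξ (t + s) ^ 2 - ξ (t + s) * deriv ξ (t + s)
        + (-(7 / 4) + Real.exp (2 * t) * (b * U t)) * ξ (t + s) ^ 2)
      ≤ m ^ 2 * (8 * deriv ξ (t + s) ^ 2 - ξ (t + s) ^ 2) := by
    intro t
    by_cases ht : t + s ∈ tsupport ξ
    · obtain ⟨h4, hR⟩ := hsupp ht
      have e : a * Real.exp (2 * t) = Real.exp (2 * (t + s)) := by
        rw [mul_add, Real.exp_add, hes]; ring
      have hU1 : m ≤ U t := h.three_fourths_mul_le ha hb hc (by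
        rw [e]; exact Real.exp_le_exp.2 (by linarith))
      have hU2 : U t ≤ 2 * m := by
        have := h.lt_sPlus ha hb hc t
        simp only [m]; linarith
      have h1 : Real.exp (2 * t) * (b * U t) ≤ 1 / 2 := by
        refine le_of_mul_le_mul_left ?_ ha
        calc a * (Real.exp (2 * t) * (b * U t)) = Real.exp (2 * (t + s)) * (b * U t) := by
              rw [← e]; ring
          _ ≤ Real.exp (2 * R) * (b * (2 * m)) :=
              mul_le_mul (Real.exp_le_exp.2 (by linarith))
                (mul_le_mul_of_nonneg_left hU2 hb.le) (mul_pos hb (hm.trans_le hU1)).le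
                (Real.exp_pos _).le
          _ = 3 * b * σ * Real.exp (2 * R) / 2 := by simp only [m]; ring
          _ ≤ a * (1 / 2) := by linarith
      exact sq_mul_quadratic_le hm hU1 hU2 h1
    · have h0 : ξ (t + s) = 0 := image_eq_zero_of_notMem_tsupport ht
      have h1 : deriv ξ (t + s) = 0 :=
        image_eq_zero_of_notMem_tsupport fun h' => ht (tsupport_deriv_subset h')
      simp [h0, h1]
  have hU := h.continuous
  have hξ0 := hξ.continuous
  have hξ' : Continuous (deriv ξ) := hξ.continuous_deriv (by simp)
  have i1 := integrable_sq_of_hasCompactSupport hξ' hξc.deriv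
  have i2 := integrable_sq_of_hasCompactSupport hξ0 hξc
  have i0 : Integrable fun t => m ^ 2 * (8 * deriv ξ t ^ 2 - ξ t ^ 2) :=
    ((i1.const_mul 8).sub i2).const_mul (m ^ 2)
  have i3 : Integrable fun t => m ^ 2 * (8 * deriv ξ (t + s) ^ 2 - ξ (t + s) ^ 2) :=
    i0.comp_add_right s
  have iT : Integrable fun t => U t ^ 2 * (deriv ξ (t + s) ^ 2 - ξ (t + s) * deriv ξ (t + s)
      + (-(7 / 4) + Real.exp (2 * t) * (b * U t)) * ξ (t + s) ^ 2) := by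
    have c1 : Continuous fun t => deriv ξ (t + s) := hξ'.comp (continuous_add_const s)
    refine Continuous.integrable_of_hasCompactSupport (by fun_prop) ?_
    refine HasCompactSupport.intro hζc.isCompact fun t ht => ?_
    have h0 : ξ (t + s) = 0 := image_eq_zero_of_notMem_tsupport (f := fun t => ξ (t + s)) ht
    have h1 : deriv ξ (t + s) = 0 := by
      rw [← hd]
      exact image_eq_zero_of_notMem_tsupport fun h' => ht (tsupport_deriv_subset h')
    simp [h0, h1]
  refine (integral_mono iT i3 hpt).trans_lt ?_
  rw [integral_add_right_eq_self (fun t => m ^ 2 * (8 * deriv ξ t ^ 2 - ξ t ^ 2)) s,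
    integral_const_mul, integral_sub (i1.const_mul 8) i2, integral_const_mul]
  exact mul_neg_of_pos_of_neg (by positivity) (by linarith)

end LogProfile

variable {a b c : ℝ} {u : ℝ → ℝ}

theorem IsProfile.exists_Q_three_neg (hu : IsProfile a b c u) (ha : 0 < a) (hb : 0 < b) (hc : 0 < c)
    {ξ : ℝ → ℝ} {R : ℝ} (hξ : ContDiff ℝ ∞ ξ) (hξc : HasCompactSupport ξ)
    (hsupp : tsupport ξ ⊆ Set.Icc 4 R) (hlt : 8 * ∫ t, deriv ξ t ^ 2 < ∫ t, ξ t ^ 2)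
    (hab : b ^ 2 ≤ a * c) (habR : 27 * b ^ 2 * Real.exp (4 * R) ≤ 2 * (a * c)) :
    ∃ w : E3 → ℝ, ContDiff ℝ ∞ w ∧ HasCompactSupport w ∧
      (∃ W : ℝ → ℝ → ℝ, ∀ x, w x = W ‖x‖ (polarAngle x)) ∧ Q a b c u 3 w (gradient w) < 0 := by
  have hL := hu.logProfile
  obtain ⟨ζ, hζ, hζc, hneg⟩ := hL.exists_integral_neg ha hb hc hξ hξc hsupp hlt hab habR
  set U : ℝ → ℝ := fun t => u (Real.exp t)
  set k : ℝ → ℝ := fun t => Real.exp (-(t / 2)) * (U t * ζ t)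
  have hk : ContDiff ℝ ∞ k :=
    (by fun_prop : ContDiff ℝ ∞ fun t : ℝ => Real.exp (-(t / 2))).mul (hL.contDiff.1.mul hζ)
  have hkc : HasCompactSupport k := hζc.mul_left.mul_left
  have hk' : ∀ t, HasDerivAt k (Real.exp (-(t / 2)) * (Real.exp t * deriv u (Real.exp t) * ζ t
      + U t * (deriv ζ t - ζ t / 2))) t := by
    intro t
    have h1 := ((hasDerivAt_id t).div_const 2).neg.exp.mul
      ((hL.hasDerivAt t).mul ((hζ.differentiable (by simp)) t).hasDerivAt)
    refine h1.congr_deriv ?_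
    simp only [U, id, Pi.mul_apply, Pi.neg_apply]
    ring
  refine ⟨sinSqMul k, contDiff_sinSqMul hk hkc, hasCompactSupport_sinSqMul hkc,
    ⟨fun r θ => if r = 0 then 0 else Real.sin θ ^ 2 * k (Real.log r), sinSqMul_eq k⟩, ?_⟩
  have hζ' : Continuous (deriv ζ) := hζ.continuous_deriv (by simp)
  have hζ0 := hζ.continuous
  have hU := hL.continuous
  have hU' := hL.continuous'
  rw [Q_three_sinSqMul a b c hU hk' (by fun_prop) hkc, hL.integral_mul_exp_mul hζ hζc]
  exact_mod_cast mul_neg_of_pos_of_neg integral_sphere_axisSq_sq_pos hneg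

end

end MeltingHedgehog

end

theorem theorem2p1 (bsq csq : ℝ) (hb : 0 < bsq) (hc : 0 < csq) :
    -- stability along the directions 0, 1 and 2, for all values of the parameters
    (∀ asq : ℝ, 0 < asq → ∀ u : ℝ → ℝ, MeltingHedgehog.IsProfile asq bsq csq u →
      ∀ (w : MeltingHedgehog.E3 → ℝ) (g : MeltingHedgehog.E3 → MeltingHedgehog.E3),
        MeltingHedgehog.MemH1 w g → MeltingHedgehog.IsAxisymmetric w →
          0 ≤ MeltingHedgehog.Q asq bsq csq u 0 w g ∧
          0 ≤ MeltingHedgehog.Q asq bsq csq u 1 w g ∧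
          0 ≤ MeltingHedgehog.Q asq bsq csq u 2 w g) ∧
    -- stability along the directions 3 and 4, for small values of the first parameter
    (∃ asq₀ : ℝ, 0 < asq₀ ∧ ∀ asq : ℝ, 0 < asq → asq < asq₀ →
      ∀ u : ℝ → ℝ, MeltingHedgehog.IsProfile asq bsq csq u →
      ∀ (w : MeltingHedgehog.E3 → ℝ) (g : MeltingHedgehog.E3 → MeltingHedgehog.E3),
        MeltingHedgehog.MemH1 w g → MeltingHedgehog.IsAxisymmetric w →
          0 ≤ MeltingHedgehog.Q asq bsq csq u 3 w g ∧
          0 ≤ MeltingHedgehog.Q asq bsq csq u 4 w g) ∧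
    -- instability along the direction 3, for large values of the first parameter
    (∃ asq₁ : ℝ, 0 < asq₁ ∧ ∀ asq : ℝ, asq₁ < asq →
      ∀ u : ℝ → ℝ, MeltingHedgehog.IsProfile asq bsq csq u →
      ∃ w₃ : MeltingHedgehog.E3 → ℝ, ContDiff ℝ ∞ w₃ ∧ HasCompactSupport w₃ ∧
        (∃ W : ℝ → ℝ → ℝ, ∀ x, w₃ x = W ‖x‖ (MeltingHedgehog.polarAngle x)) ∧
        MeltingHedgehog.Q asq bsq csq u 3 w₃ (gradient w₃) < 0) := by
  refine ⟨fun asq ha u hu w g h _ => ⟨hu.Q_zero_nonneg ha hb hc h, hu.Q_one_nonneg ha hb hc h,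
    hu.Q_two_nonneg ha hb hc h⟩, ⟨bsq ^ 2 / (1000 * csq), by positivity, ?_⟩, ?_⟩
  · intro asq ha hlt u hu w g h _
    have h3 := hu.Q_three_nonneg_of_le ha hb hc (hu.fTilde_nonneg ha hb hc hlt) h
    exact ⟨h3, h3⟩
  · obtain ⟨ξ, R, hξ, hξc, hsupp, hlt⟩ := MeltingHedgehog.exists_bump
    refine ⟨bsq ^ 2 / csq + 27 / 2 * bsq ^ 2 * Real.exp (4 * R) / csq, by positivity, ?_⟩
    intro asq hasq u hu
    have h1 : 0 < bsq ^ 2 / csq := by positivity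
    have h2 : 0 < 27 / 2 * bsq ^ 2 * Real.exp (4 * R) / csq := by positivity
    have h3 := (div_le_iff₀ hc).1 (show bsq ^ 2 / csq ≤ asq by linarith)
    have h4 := (div_le_iff₀ hc).1
      (show 27 / 2 * bsq ^ 2 * Real.exp (4 * R) / csq ≤ asq by linarith)
    exact hu.exists_Q_three_neg (by linarith) hb hc hξ hξc hsupp hlt h3 (by linarith)
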